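/- All simplicial complexes are finite, of dimension at most $2$, and embedded in some Euclidean space $\mathbb{R}^d$ ($d$ may vary; different embeddings count as different complexes). A simplicial surface is such a complex $K$ whose underlying space $|K|$ is a compact topological surface without boundary. Angles are normalized so that a full turn equals $1$; for a $2$-simplex $\sigma$ with vertex $v$, let $\angle(v,\sigma)$ be its interior angle at $v$. A pyramid is the simplicial surface in $\mathbb{R}^3$ obtained from a simplicial disk $D\subset\mathbb{R}^2=\{z=0\}$ by coning from a point $a\notin\mathbb{R}^2$ and taking the boundary, i.e. $D\cup(a*\partial D)$. A bipyramid is the simplicial surface in $\mathbb{R}^3$ whose $2$-simplices are spanned by an edge of a simple closed polygon in $\mathbb{R}^2$ (the boundary of a polygonal disk $R$, all of whose vertices are genuine corners) and one of two points lying strictly on different sides of $\mathbb{R}^2$, i.e. the boundary of the suspension of $R$. Let $\mathcal{S}$ be a set of simplicial surfaces that contains all pyramids and bipyramids and is closed under subdivision (if $K\in\mathcal{S}$ and $J$ is a subdivision of $K$, then $J\in\mathcal{S}$). Let $\Lambda$ assign a real number $\Lambda(K)$ to every $K\in\mathcal{S}$, and let $\phi$ assign a real number $\phi(v,K)$ to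 every $K\in\mathcal{S}$ and every vertex $v$ of $K$. Suppose that $\Lambda$ is geometrically locally determined by $\phi$, that is: 1. if $K,L\in\mathcal{S}$ have vertices $v,w$ and there is a simplicial homeomorphism from the star of $v$ in $K$ to the star of $w$ in $L$ that takes $v$ to $w$ and preserves the lengths of edges, then $\phi(v,K)=\phi(w,L)$; 2. if $K,J\in\mathcal{S}$ and $J$ is a subdivision of $K$, then $\phi(v,K)=\phi(v,J)$ for every vertex $v$ of $K$; 3. if $K$ and $K_1,K_2,\ldots$ are in $\mathcal{S}$ and lie in the same $\mathbb{R}^d$, and for each $n$ there is a combinatorial equivalence from $K$ to $K_n$, taking each vertex $v$ of $K$ to a vertex $v_n$ of $K_n$, such that $v_n\to v$ for every vertex $v$ of $K$, then $\phi(v_n,K_n)\to\phi(v,K)$ for every vertex $v$ of $K$; 4. $\sum_{v}\phi(v,K)=\Lambda(K)$ for every $K\in\mathcal{S}$, the sum being over all vertices $v$ of $K$. Suppose also that $\Lambda$ takes the same value $\Lambda(\text{pyramid})$ on all pyramids and bipyramids. Then for every $K\in\mathcal{S}$ and every vertex $v$ of $K$, $$\phi(v,K)=\tfrac12\,\Lambda(\text{pyramid})\Bigl[1-\sum_{\sigma\ni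 v}\angle(v,\sigma)\Bigr],$$ where the sum is over all $2$-simplices $\sigma$ of $K$ containing $v$. -/

import Mathlib

namespace AngleDefect

open scoped EuclideanGeometry

/-- Euclidean space of dimension `d`. -/
abbrev E (d : ℕ) : Type := EuclideanSpace ℝ (Fin d)

/-- A finite simplicial complex of dimension at most two, embedded in the Euclidean space `E d`.
Different embeddings count as different complexes. -/
structure Cplx (d : ℕ) extends Geometry.SimplicialComplex ℝ (E d) where
  finite_faces : faces.Finite
  card_le_three : ∀ s ∈ faces, s.card ≤ 3

namespace Cplx

variable {d : ℕ}

/-- The underlying space of `K`. -/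
abbrev space (K : Cplx d) : Set (E d) := K.toSimplicialComplex.space

/-- The set of vertices of `K`. -/
abbrev vertices (K : Cplx d) : Set (E d) := K.toSimplicialComplex.vertices

lemma finite_vertices (K : Cplx d) : K.vertices.Finite :=
  Set.Finite.preimage (f := fun x : E d => ({x} : Finset (E d)))
    (fun _ _ _ _ h => Finset.singleton_injective h) K.finite_faces

/-- The vertices of `K`, as a finite set. -/
noncomputable def verts (K : Cplx d) : Finset (E d) := K.finite_vertices.toFinset

open Classical in
/-- The 2-simplices of `K` that contain `v`. -/
noncomputable def trianglesAt (K : Cplx d) (v : E d) : Finset (Finset (E d)) :=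
  K.finite_faces.toFinset.filter (fun s => s.card = 3 ∧ v ∈ s)

open Classical in
/-- The (closed) star of `v` in `K`: all simplices that contain `v`, together with their faces. -/
def star (K : Cplx d) (v : E d) : Cplx d where
  faces := {s | s ∈ K.faces ∧ insert v s ∈ K.faces}
  isRelLowerSet_faces := by
    intro s hs
    refine ⟨K.toSimplicialComplex.nonempty_of_mem_faces hs.1, fun t hts ht => ⟨?_, ?_⟩⟩
    · exact K.toSimplicialComplex.down_closed hs.1 hts ht
    · exact K.toSimplicialComplex.down_closed hs.2 (Finset.insert_subset_insert v hts)
        (Finset.insert_nonempty v t)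
  indep := fun hs => K.indep hs.1
  inter_subset_convexHull := fun hs ht => K.inter_subset_convexHull hs.1 ht.1
  finite_faces := K.finite_faces.subset (fun _ hs => hs.1)
  card_le_three := fun s hs => K.card_le_three s hs.1

end Cplx

/-- A simplicial surface: a finite simplicial complex whose underlying space is a surface (a
topological 2-manifold) without boundary. The space is compact since the complex is finite, and
Hausdorff and second countable since it lies in a Euclidean space. -/
def IsSimplicialSurface {d : ℕ} (K : Cplx d) : Prop :=
  K.space.Nonempty ∧ Nonempty (ChartedSpace (E 2) K.space)

open Classical in
/-- The interior angle at the vertex `v` of the 2-simplex with vertex set `σ`, normalized so that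
a full turn is `1`. If `σ = {v, a, b}`, the sum has the two equal terms `∠ a v b` and `∠ b v a`. -/
noncomputable def angleAt {d : ℕ} (v : E d) (σ : Finset (E d)) : ℝ :=
  ((∑ p ∈ (σ.erase v).offDiag, ∠ p.1 v p.2) / 2) / (2 * Real.pi)

open Classical in
lemma angleAt_eq {d : ℕ} {v a b : E d} (hva : v ≠ a) (hvb : v ≠ b) (hab : a ≠ b) :
    angleAt v {v, a, b} = ∠ a v b / (2 * Real.pi) := by
  have h1 : ({v, a, b} : Finset (E d)).erase v = {a, b} := by
    ext x
    simp only [Finset.mem_erase, Finset.mem_insert, Finset.mem_singleton]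
    constructor
    · rintro ⟨h, h' | h' | h'⟩ <;> simp_all
    · rintro (h | h)
      · exact ⟨by rw [h]; exact hva.symm, Or.inr (Or.inl h)⟩
      · exact ⟨by rw [h]; exact hvb.symm, Or.inr (Or.inr h)⟩
  have h2 : ({a, b} : Finset (E d)).offDiag = {(a, b), (b, a)} := by
    ext ⟨x, y⟩
    simp only [Finset.mem_offDiag, Finset.mem_insert, Finset.mem_singleton, Prod.mk.injEq]
    constructor
    · rintro ⟨hx | hx, hy | hy, hne⟩ <;> simp_all
    · rintro (⟨hx, hy⟩ | ⟨hx, hy⟩) <;> subst hx <;> subst hy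
      · exact ⟨Or.inl rfl, Or.inr rfl, hab⟩
      · exact ⟨Or.inr rfl, Or.inl rfl, hab.symm⟩
  have h3 : (a, b) ≠ (b, a) := fun h => hab (Prod.mk.inj h).1
  rw [angleAt, h1, h2, Finset.sum_pair h3, EuclideanGeometry.angle_comm b v a]
  ring

/-- The sum of the (normalized) angles at `v` of all 2-simplices of `K` that contain `v`. -/
noncomputable def angleSum {d : ℕ} (K : Cplx d) (v : E d) : ℝ :=
  ∑ σ ∈ K.trianglesAt v, angleAt v σ

/-- `J` is a subdivision of `K`: they have the same underlying space, and every simplex of `J` is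
contained in a simplex of `K`. -/
def IsSubdivision {d : ℕ} (J K : Cplx d) : Prop :=
  J.space = K.space ∧
    ∀ s ∈ J.faces, ∃ t ∈ K.faces, convexHull ℝ (s : Set (E d)) ⊆ convexHull ℝ (t : Set (E d))

open Classical in
/-- The vertex map `f` is a combinatorial equivalence (simplicial isomorphism) from `K` to `L`;
it extends uniquely to a simplicial homeomorphism of the underlying spaces. -/
def IsSimplicialIso {d e : ℕ} (K : Cplx d) (L : Cplx e) (f : E d → E e) : Prop :=
  Set.BijOn f K.vertices L.vertices ∧
    ∀ s : Finset (E d), (s : Set (E d)) ⊆ K.vertices → (s ∈ K.faces ↔ s.image f ∈ L.faces)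

open Classical in
/-- The stars of `v` in `K` and of `w` in `L` are simplicially isometric: there is a simplicial
homeomorphism between them that preserves the lengths of edges and takes `v` to `w`. -/
def StarsIsometric {d e : ℕ} (K : Cplx d) (v : E d) (L : Cplx e) (w : E e) : Prop :=
  ∃ f : E d → E e, IsSimplicialIso (K.star v) (L.star w) f ∧ f v = w ∧
    ∀ a b : E d, {a, b} ∈ (K.star v).faces → dist (f a) (f b) = dist a b

/-- A set of complexes, each in some Euclidean space. -/
abbrev CplxSet : Type := ∀ d : ℕ, Set (Cplx d)

/-- A real number for every complex. Only the values on a given set of complexes matter. -/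
abbrev CplxFun : Type := ∀ ⦃d : ℕ⦄, Cplx d → ℝ

/-- A real number for every complex and every vertex of it. Only the values on the complexes in a
given set, and at the vertices of these complexes, matter. -/
abbrev VertexFun : Type := ∀ ⦃d : ℕ⦄, Cplx d → E d → ℝ

/-- Invariance under simplicial isometries of stars. -/
def InvariantUnderStarIsometry (𝒯 : CplxSet) (φ : VertexFun) : Prop :=
  ∀ ⦃d e : ℕ⦄, ∀ K ∈ 𝒯 d, ∀ L ∈ 𝒯 e, ∀ v ∈ K.vertices, ∀ w ∈ L.vertices,
    StarsIsometric K v L w → φ K v = φ L w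

/-- Invariance under subdivision. -/
def InvariantUnderSubdivision (𝒯 : CplxSet) (φ : VertexFun) : Prop :=
  ∀ ⦃d : ℕ⦄, ∀ K ∈ 𝒯 d, ∀ J ∈ 𝒯 d, IsSubdivision J K → ∀ v ∈ K.vertices, φ K v = φ J v

/-- Continuity: if the complexes `K' n` are combinatorially equivalent to `K`, via `f n`, in the
same Euclidean space, and converge to `K` at every vertex, then `φ` converges at every vertex. -/
def IsContinuous (𝒯 : CplxSet) (φ : VertexFun) : Prop :=
  ∀ ⦃d : ℕ⦄, ∀ K ∈ 𝒯 d, ∀ (K' : ℕ → Cplx d) (f : ℕ → E d → E d),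
    (∀ n, K' n ∈ 𝒯 d) → (∀ n, IsSimplicialIso K (K' n) (f n)) →
    (∀ v ∈ K.vertices, Filter.Tendsto (fun n => f n v) Filter.atTop (nhds v)) →
    ∀ v ∈ K.vertices,
      Filter.Tendsto (fun n => φ (K' n) (f n v)) Filter.atTop (nhds (φ K v))

/-- `φ` satisfies the Descartes-Gauss-Bonnet Theorem with respect to `Λ`. -/
def SatisfiesGaussBonnet (𝒯 : CplxSet) (Λ : CplxFun) (φ : VertexFun) : Prop :=
  ∀ ⦃d : ℕ⦄, ∀ K ∈ 𝒯 d, ∑ v ∈ K.verts, φ K v = Λ K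

/-- `Λ` is geometrically locally determined by `φ` on `𝒯`. -/
structure GeometricallyLocallyDetermined (𝒯 : CplxSet) (Λ : CplxFun) (φ : VertexFun) : Prop where
  star_isometry : InvariantUnderStarIsometry 𝒯 φ
  subdivision : InvariantUnderSubdivision 𝒯 φ
  continuous : IsContinuous 𝒯 φ
  gauss_bonnet : SatisfiesGaussBonnet 𝒯 Λ φ

/-- `𝒯` contains every subdivision of every member. -/
def SubdivisionClosed (𝒯 : CplxSet) : Prop :=
  ∀ ⦃d : ℕ⦄, ∀ K ∈ 𝒯 d, ∀ J : Cplx d, IsSubdivision J K → J ∈ 𝒯 d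

/-- The plane as the plane `z = 0` in 3-space. -/
noncomputable def planeIncl (p : E 2) : E 3 := !₂[p 0, p 1, 0]

/-- A simplicial disk in the plane: the underlying space is homeomorphic to a closed disk. -/
def IsSimplicialDisk (D : Cplx 2) : Prop :=
  Nonempty (D.space ≃ₜ Metric.closedBall (0 : E 2) 1)

/-- `t` is a simplex of the boundary of the simplicial disk `D`: a face of an edge that lies in
exactly one 2-simplex. -/
def IsBoundaryFace (D : Cplx 2) (t : Finset (E 2)) : Prop :=
  t.Nonempty ∧ ∃ e ∈ D.faces, e.card = 2 ∧
    (∃! u : Finset (E 2), u ∈ D.faces ∧ u.card = 3 ∧ e ⊆ u) ∧ t ⊆ e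

open Classical in
/-- `P` is a pyramid: the boundary of the cone on a simplicial disk `D` in the plane, from a
point `a` off the plane. Its simplices are those of `D`, the point `a`, and the joins of `a` with
the boundary simplices of `D`. -/
def IsPyramid (P : Cplx 3) : Prop :=
  ∃ (D : Cplx 2) (a : E 3), IsSimplicialDisk D ∧ a 2 ≠ 0 ∧
    ∀ s : Finset (E 3), s ∈ P.faces ↔
      (∃ t ∈ D.faces, s = t.image planeIncl) ∨ s = {a} ∨
      (∃ t, IsBoundaryFace D t ∧ s = insert a (t.image planeIncl))

/-- A simple closed polygon in the plane: distinct vertices, each of them a genuine corner, and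
any two different edges meet at most in a common endpoint. Such polygons are the boundaries of the
polygonal disks: by the Jordan curve theorem each bounds exactly one. -/
def IsSimplePolygon {m : ℕ} [NeZero m] (p : Polygon (E 2) m) : Prop :=
  Function.Injective p.vertices ∧ p.HasNondegenerateVertices ℝ ∧
    ∀ i j : Fin m, i ≠ j →
      segment ℝ (p i) (p (i + 1)) ∩ segment ℝ (p j) (p (j + 1)) ⊆
        {p i, p (i + 1)} ∩ {p j, p (j + 1)}

open Classical in
/-- `B` is a bipyramid: the boundary of the suspension of a polygonal disk in the plane from two
points on different sides of the plane. Its 2-simplices are spanned by an edge of the boundary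
polygon and one of the two apices. -/
def IsBipyramid (B : Cplx 3) : Prop :=
  ∃ (m : ℕ) (_ : NeZero m) (p : Polygon (E 2) m) (x y : E 3),
    IsSimplePolygon p ∧ 0 < x 2 ∧ y 2 < 0 ∧
    ∀ s : Finset (E 3), s ∈ B.faces ↔
      s.Nonempty ∧ ∃ i : Fin m,
        s ⊆ {x, planeIncl (p i), planeIncl (p (i + 1))} ∨
        s ⊆ {y, planeIncl (p i), planeIncl (p (i + 1))}

end AngleDefect

/-! The proof has a local half and a global half.

Locally, `φ` depends only on the total angle at the vertex. Two stars with the same total angle have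
isometric subdivisions: cut both by rays from the centre at the same angles, then move all link
vertices along their rays to one common distance. Corresponding triangles then agree in two sides
and the included angle, so `φ` takes the same value at both centres (`eq_of_fans`). This needs every
star in a surface to be a cyclic fan of triangles (`IsSimplicialSurface.exists_fan`). Invariance of
domain in the plane, proved here with continuous logarithms, shows that each edge lies in exactly
two triangles. The link is connected because a punctured disk is. A finite connected graph with all
degrees two is a cycle.

Hence `φ` is `f` of the angle sum, and Gauss-Bonnet on bipyramids becomes a family of functional
equations for `f` (`exists_function_of_angleSum`). The function `c / 2 * (1 - t)` solves them
because the angles of a triangle add up to half a turn, so the difference `g` solves the homogeneous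
equations. It suffices to use bipyramids over `2m`-gons with alternating radii, where two apex sums
and two kinds of rim sums occur.

Stretching a square bipyramid shows that `g` is continuous on `(0, 1)`. Octahedra with perpendicular
diagonals give `g A + g B + g C = 0` for `A + B + C = 2`, a Cauchy equation whose continuous
solutions are the multiples of `t - 2 / 3`; a hexagonal bipyramid makes the factor zero. Hexagonal
bipyramids with unequal radii carry the vanishing to values slightly above `1`. Finally, any `θ ≥ 1`
is the apex sum of a bipyramid with many sides whose rim sums all lie where `g` is already known to
vanish (`eq_zero_of_bipyramid_relations`). -/

namespace AngleDefect

/-! ### Invariance of domain in the plane, by continuous logarithms. -/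

open Set Filter Topology

/-- `g` has a continuous logarithm. -/
def HasLog {A : Type*} [TopologicalSpace A] (g : A → ℂ) : Prop :=
  ∃ l : A → ℂ, Continuous l ∧ ∀ a, Complex.exp (l a) = g a

/-- The principal logarithm is continuous on the right half-plane, so it can be added to the
logarithm of `g`. -/
lemma HasLog.of_div {A : Type*} [TopologicalSpace A] {g h : A → ℂ} (hg : HasLog g)
    (hg0 : ∀ a, g a ≠ 0) (hgc : Continuous g) (hhc : Continuous h)
    (hd : ∀ a, 0 < (h a / g a).re) : HasLog h := by
  obtain ⟨l, hl, he⟩ := hg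
  refine ⟨fun a => l a + Complex.log (h a / g a), ?_, fun a => ?_⟩
  · exact hl.add ((hhc.div hgc hg0).clog fun a => Or.inl (hd a))
  · have : h a / g a ≠ 0 := fun h0 => by
      have := hd a
      rw [h0] at this
      simp at this
    rw [Complex.exp_add, he, Complex.exp_log this, mul_div_cancel₀ _ (hg0 a)]

lemma re_div_pos {a b : ℂ} (h : ‖b - a‖ < ‖a‖) : 0 < (b / a).re := by
  have ha : a ≠ 0 := by
    rintro rfl
    simp at h
    exact absurd h (not_lt.2 (norm_nonneg _))
  have h1 : ‖b / a - 1‖ < 1 := by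
    rw [div_sub_one ha, norm_div, div_lt_one (norm_pos_iff.2 ha)]
    exact h
  have h2 := (Complex.abs_re_le_norm (b / a - 1)).trans_lt h1
  rw [abs_lt] at h2
  simp at h2
  linarith

lemma re_inv_pos {z : ℂ} (h : 0 < z.re) : 0 < (z⁻¹).re := by
  rw [Complex.inv_re]
  have : z ≠ 0 := by
    rintro rfl
    simp at h
  exact div_pos h (Complex.normSq_pos.2 this)

/-- Having a continuous logarithm is invariant under homotopy in the punctured plane. -/
lemma hasLog_homotopy {A : Type*} [TopologicalSpace A] [CompactSpace A]
    (H : unitInterval → A → ℂ) (hH : Continuous (fun p : unitInterval × A => H p.1 p.2))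
    (h0 : ∀ t a, H t a ≠ 0) : HasLog (H 0) ↔ HasLog (H 1) := by
  have hc : ∀ t, Continuous (H t) := fun t => hH.comp (Continuous.prodMk_right t)
  have key : IsLocallyConstant (fun t => HasLog (H t)) := by
    rw [IsLocallyConstant.iff_eventually_eq]
    intro t
    have hopen : IsOpen {p : unitInterval × A | ‖H p.1 p.2 - H t p.2‖ < ‖H t p.2‖} := by
      refine isOpen_lt ?_ ?_
      · exact (hH.sub ((hc t).comp continuous_snd)).norm
      · exact ((hc t).comp continuous_snd).norm
    -- Compactness of `A` makes the closeness uniform in `a`; the quotient of the two maps then has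
    -- positive real part.
    have htube : ∀ᶠ s in 𝓝 t, ∀ a ∈ (univ : Set A), ‖H s a - H t a‖ < ‖H t a‖ := by
      refine isCompact_univ.eventually_forall_of_forall_eventually fun a _ => ?_
      exact hopen.mem_nhds (by simpa using h0 t a)
    filter_upwards [htube] with s hs
    have hre : ∀ a, 0 < (H s a / H t a).re := fun a => re_div_pos (hs a (mem_univ a))
    refine propext ⟨fun h => ?_, fun h => ?_⟩
    · refine h.of_div (h0 s) (hc s) (hc t) fun a => ?_
      rw [← inv_div]
      exact re_inv_pos (hre a)
    · exact h.of_div (h0 t) (hc t) (hc s) hre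
  exact iff_of_eq (key.apply_eq_of_preconnectedSpace 0 1)

lemma hasLog_const {A : Type*} [TopologicalSpace A] {c : ℂ} (hc : c ≠ 0) :
    HasLog (fun _ : A => c) :=
  ⟨fun _ => Complex.log c, continuous_const, fun _ => Complex.exp_log hc⟩

/-- Two values differ by an integer multiple of `2πi`, and a continuous integer-valued function on a
connected space is constant. -/
lemma continuous_exp_eq_one_const {A : Type*} [TopologicalSpace A] [PreconnectedSpace A]
    {k : A → ℂ} (hk : Continuous k) (he : ∀ a, Complex.exp (k a) = -1) (a b : A) : k a = k b := by
  have hmem : ∀ a, ∃ n : ℤ, k a - k b = n * (2 * Real.pi * Complex.I) := fun a => by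
    rw [← Complex.exp_eq_one_iff, Complex.exp_sub, he, he]
    norm_num
  choose n hn using hmem
  have hnr : ∀ a, (n a : ℝ) = ((k a - k b) / (2 * Real.pi * Complex.I)).re := fun a => by
    rw [hn a, mul_div_cancel_right₀ _ (Complex.two_pi_I_ne_zero)]
    simp
  have hcont : Continuous (fun a => (n a : ℝ)) := by
    simp_rw [hnr]
    exact Complex.continuous_re.comp ((hk.sub continuous_const).div_const _)
  have hcn : Continuous n := Int.isClosedEmbedding_coe_real.isEmbedding.continuous_iff.2 hcont
  have h1 := (IsLocallyConstant.iff_continuous n).2 hcn |>.apply_eq_of_preconnectedSpace a b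
  have h2 := hn a
  have h3 := hn b
  rw [h1, ← h3, sub_self] at h2
  exact sub_eq_zero.1 h2

/-- An odd map from the circle to the punctured plane has no continuous logarithm. -/
lemma not_hasLog_of_odd {g : Circle → ℂ} (hodd : ∀ u, g (-u) = - g u) (h0 : ∀ u, g u ≠ 0) :
    ¬ HasLog g := by
  rintro ⟨l, hl, he⟩
  have hpc : PreconnectedSpace Circle := inferInstance
  have hk : Continuous (fun u : Circle => l (-u) - l u) := by
    refine (hl.comp ?_).sub hl
    exact continuous_neg
  have hk1 : ∀ u, Complex.exp (l (-u) - l u) = -1 := fun u => by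
    rw [Complex.exp_sub, he, he, hodd, neg_div, div_self (h0 u)]
  -- The function `l (-u) - l u` is constant and changes sign under `u ↦ -u`, so it vanishes; but
  -- its exponential is `-1`.
  have h1 := continuous_exp_eq_one_const hk hk1 1 (-1)
  simp only [neg_neg] at h1
  have h2 : l (-1) - l 1 = 0 := by linear_combination (1 / 2) * h1
  have h3 := hk1 1
  rw [h2] at h3
  norm_num at h3

lemma continuous_circle_coe : Continuous (fun u : Circle => (u : ℂ)) :=
  continuous_subtype_val

/-- Invariance of domain for the closed unit disk in the complex plane. -/
lemma image_closedBall_mem_nhds {f : ℂ → ℂ} (hf : ContinuousOn f (Metric.closedBall 0 1))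
    (hi : InjOn f (Metric.closedBall 0 1)) : f '' Metric.closedBall 0 1 ∈ 𝓝 (f 0) := by
  have hmem : ∀ (t : ℝ) (u : Circle), |t| ≤ 1 → (t : ℂ) * u ∈ Metric.closedBall (0 : ℂ) 1 := by
    intro t u ht
    simpa [Circle.norm_coe] using ht
  have hcomp : ∀ {X : Type} [TopologicalSpace X] (t : X → ℝ) (u : X → Circle), Continuous t →
      Continuous u → (∀ x, |t x| ≤ 1) → Continuous (fun x => f ((t x : ℂ) * u x)) := by
    intro X _ t u ht hu h1
    refine hf.comp_continuous ?_ fun x => hmem _ _ (h1 x)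
    exact (Complex.continuous_ofReal.comp ht).mul (continuous_circle_coe.comp hu)
  have hu1 : ∀ u : Circle, (u : ℂ) ∈ Metric.closedBall (0 : ℂ) 1 := fun u => by simp [Circle.norm_coe]
  have hfu : Continuous (fun u : Circle => f u) := hf.comp_continuous continuous_circle_coe hu1
  -- The radius of the neighbourhood is the distance from `f 0` to the image of the unit circle. If
  -- `f` misses a point `q` of this ball, three homotopies lead from a constant to an odd map.
  obtain ⟨u0, hu0⟩ : ∃ u0 : Circle, ∀ u : Circle, ‖f u0 - f 0‖ ≤ ‖f u - f 0‖ := by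
    obtain ⟨u0, -, h⟩ := isCompact_univ.exists_isMinOn (univ_nonempty (α := Circle))
      (hfu.sub (continuous_const (y := f 0))).norm.continuousOn
    exact ⟨u0, fun u => h (mem_univ u)⟩
  have hpos : 0 < ‖f u0 - f 0‖ := by
    rw [norm_pos_iff, sub_ne_zero]
    intro h
    exact Circle.coe_ne_zero u0 (hi (hu1 u0) (by simp) h)
  rw [Metric.mem_nhds_iff]
  refine ⟨_, hpos, fun q hq => ?_⟩
  by_contra hq'
  have hqn : ‖q - f 0‖ < ‖f u0 - f 0‖ := by simpa [dist_eq_norm] using hq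
  have hfq : ∀ z ∈ Metric.closedBall (0 : ℂ) 1, f z - q ≠ 0 := fun z hz h =>
    hq' ⟨z, hz, sub_eq_zero.1 h⟩
  have hI : ∀ t : unitInterval, |(t : ℝ)| ≤ 1 := fun t => by
    rw [abs_of_nonneg t.2.1]
    exact t.2.2
  -- Shrink the circle to its centre; `q` is never hit.
  have s1 : HasLog (fun u : Circle => f u - q) := by
    have := hasLog_homotopy (A := Circle) (fun t u => f (((t : ℝ) : ℂ) * u) - q)
      ((hcomp (X := unitInterval × Circle) (fun p => (p.1 : ℝ)) (fun p => p.2) (by fun_prop)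
        (by fun_prop) (fun p => hI p.1)).sub continuous_const)
      (fun t u => hfq _ (hmem _ _ (hI t)))
    have h2 := this.1 (by simpa using hasLog_const (hfq 0 (by simp)))
    simpa using h2
  -- Move `q` to `f 0` along the segment, which stays closer to `f 0` than the image of the circle.
  have s2 : HasLog (fun u : Circle => f u - f 0) := by
    have := hasLog_homotopy (A := Circle)
      (fun t u => f u - (q + ((t : ℝ) : ℂ) * (f 0 - q)))
      (by
        refine (hfu.comp continuous_snd).sub ?_
        fun_prop)
      (fun t u h => by
        have h1 : f u - f 0 = (1 - ((t : ℝ) : ℂ)) * (q - f 0) := by linear_combination h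
        have h2 : ‖f u - f 0‖ ≤ ‖q - f 0‖ := by
          rw [h1, norm_mul, ← Complex.ofReal_one, ← Complex.ofReal_sub, Complex.norm_real,
            Real.norm_of_nonneg (by linarith [t.2.2])]
          nlinarith [t.2.1, norm_nonneg (q - f 0)]
        linarith [hu0 u])
    simpa using this.1 (by simpa using s1)
  have hb1 : ∀ t : unitInterval, |1 / (1 + (t : ℝ))| ≤ 1 := fun t => by
    have := t.2.1
    rw [abs_of_nonneg (by positivity), div_le_one (by positivity)]
    linarith
  have hb2 : ∀ t : unitInterval, |-(t : ℝ) / (1 + (t : ℝ))| ≤ 1 := fun t => by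
    have := t.2.1
    rw [neg_div, abs_neg, abs_of_nonneg (by positivity), div_le_one (by positivity)]
    linarith
  have hpt : ∀ t : unitInterval, (1 + (t : ℝ)) ≠ 0 := fun t => by
    have := t.2.1
    positivity
  -- The two arguments differ by `u` at all times, so injectivity keeps the difference nonzero. At
  -- time `1` it is `f (u / 2) - f (-u / 2)`, which is odd.
  have s3 := (hasLog_homotopy (A := Circle)
      (fun t u => f (((1 / (1 + (t : ℝ)) : ℝ) : ℂ) * u) -
        f (((-(t : ℝ) / (1 + (t : ℝ)) : ℝ) : ℂ) * u))
      ((hcomp (X := unitInterval × Circle) (fun p => 1 / (1 + (p.1 : ℝ))) (fun p => p.2)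
          (continuous_const.div (by fun_prop) (fun p => hpt p.1))
          (by fun_prop) (fun p => hb1 p.1)).sub
        (hcomp (X := unitInterval × Circle) (fun p => -(p.1 : ℝ) / (1 + (p.1 : ℝ)))
          (fun p => p.2) (Continuous.div (by fun_prop) (by fun_prop) (fun p => hpt p.1))
          (by fun_prop) (fun p => hb2 p.1)))
      (fun t u h => by
        have h1 := hi (hmem _ _ (hb1 t)) (hmem _ _ (hb2 t)) (sub_eq_zero.1 h)
        have h2 := mul_right_cancel₀ (Circle.coe_ne_zero u) h1
        have h3 : 1 / (1 + (t : ℝ)) = -(t : ℝ) / (1 + (t : ℝ)) := by exact_mod_cast h2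
        have h4 := t.2.1
        rw [div_left_inj' (hpt t)] at h3
        linarith)).1 (by simpa using s2)
  refine not_hasLog_of_odd (g := fun u : Circle => f (((1 / 2 : ℝ) : ℂ) * u) -
        f (((-1 / 2 : ℝ) : ℂ) * u)) (fun u => ?_) (fun u h => ?_) ?_
  · have h1 : ((1 / 2 : ℝ) : ℂ) * ((-u : Circle) : ℂ) = ((-1 / 2 : ℝ) : ℂ) * u := by
      simp
      ring
    have h2 : ((-1 / 2 : ℝ) : ℂ) * ((-u : Circle) : ℂ) = ((1 / 2 : ℝ) : ℂ) * u := by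
      simp
      ring
    simp only [h1, h2, neg_sub]
  · have h1 := hi (hmem _ _ (by norm_num [abs_of_nonneg])) (hmem _ _ (by norm_num [abs_div]))
      (sub_eq_zero.1 h)
    have h2 := mul_right_cancel₀ (Circle.coe_ne_zero u) h1
    have h3 : (1 / 2 : ℝ) = -1 / 2 := by exact_mod_cast h2
    norm_num at h3
  · convert! s3 using 5 <;> norm_num

/-- Invariance of domain in the complex plane. -/
lemma image_mem_nhds_complex {U : Set ℂ} {f : ℂ → ℂ} {x : ℂ} (hU : U ∈ 𝓝 x)
    (hf : ContinuousOn f U) (hi : InjOn f U) : f '' U ∈ 𝓝 (f x) := by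
  obtain ⟨r, hr, hrU⟩ := Metric.nhds_basis_closedBall.mem_iff.1 hU
  have hmaps : MapsTo (fun z : ℂ => x + r * z) (Metric.closedBall 0 1) U := fun z hz => by
    refine hrU ?_
    simp only [Metric.mem_closedBall, dist_zero_right, dist_self_add_left, norm_mul,
      Complex.norm_real, Real.norm_of_nonneg hr.le] at hz ⊢
    nlinarith
  have h1 := image_closedBall_mem_nhds (f := fun z => f (x + r * z))
    (hf.comp (by fun_prop) hmaps) (hi.comp (fun a _ b _ hab => by
      have : (r : ℂ) ≠ 0 := by exact_mod_cast hr.ne'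
      simpa [this] using hab) hmaps)
  simp only [mul_zero, add_zero] at h1
  refine mem_of_superset h1 ?_
  rintro _ ⟨z, hz, rfl⟩
  exact ⟨_, hmaps hz, rfl⟩

/-- Invariance of domain in the Euclidean plane. -/
lemma image_mem_nhds {U : Set (E 2)} {f : E 2 → E 2} {x : E 2} (hU : U ∈ 𝓝 x)
    (hf : ContinuousOn f U) (hi : InjOn f U) : f '' U ∈ 𝓝 (f x) := by
  let e := Complex.orthonormalBasisOneI.repr.toHomeomorph
  have h1 : e ⁻¹' U ∈ 𝓝 (e.symm x) :=
    e.continuous.continuousAt.preimage_mem_nhds (by simpa using hU)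
  have h2 := image_mem_nhds_complex (f := fun z => e.symm (f (e z))) h1
    (e.symm.continuous.comp_continuousOn (hf.comp e.continuous.continuousOn (fun z hz => hz)))
    (fun a ha b hb hab => e.injective (hi ha hb (e.symm.injective hab)))
  have h3 := e.symm.continuous.continuousAt.preimage_mem_nhds (x := f x) (by simpa using h2)
  refine mem_of_superset h3 ?_
  rintro y ⟨z, hz, hzy⟩
  exact ⟨e z, hz, by simpa using hzy⟩

/-- An injective continuous map from a plane domain to a surface is open. -/
lemma image_mem_nhds_of_charted {X : Type*} [TopologicalSpace X] [ChartedSpace (E 2) X]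
    {U : Set (E 2)} {f : E 2 → X} {x : E 2} (hU : IsOpen U) (hx : x ∈ U)
    (hf : ContinuousOn f U) (hi : InjOn f U) : f '' U ∈ 𝓝 (f x) := by
  let e := chartAt (E 2) (f x)
  have hs : f x ∈ e.source := mem_chart_source _ _
  have hV : U ∩ f ⁻¹' e.source ∈ 𝓝 x :=
    (hf.isOpen_inter_preimage hU e.open_source).mem_nhds ⟨hx, hs⟩
  have h1 := image_mem_nhds (f := fun z => e (f z)) hV
    (e.continuousOn.comp (hf.mono inter_subset_left) (fun z hz => hz.2))
    (fun a ha b hb hab => hi ha.1 hb.1 (e.injOn ha.2 hb.2 hab))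
  have h2 := (e.continuousAt hs).preimage_mem_nhds h1
  refine mem_of_superset (inter_mem h2 (e.open_source.mem_nhds hs)) ?_
  rintro y ⟨⟨z, hz, hzy⟩, hy⟩
  exact ⟨z, hz.1, e.injOn hz.2 hy hzy⟩

/-- A continuous map from a surface to the plane that is injective near a point is open there. -/
lemma image_mem_nhds_to_plane {X : Type*} [TopologicalSpace X] [ChartedSpace (E 2) X]
    {N : Set X} {f : X → E 2} {x : X} (hN : N ∈ 𝓝 x)
    (hf : ContinuousOn f N) (hi : InjOn f N) : f '' N ∈ 𝓝 (f x) := by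
  let e := chartAt (E 2) x
  have hs : x ∈ e.source := mem_chart_source _ _
  have hV : e.target ∩ e.symm ⁻¹' N ∈ 𝓝 (e x) := by
    refine inter_mem (e.open_target.mem_nhds (e.map_source hs)) ?_
    refine (e.symm.continuousAt (e.map_source hs)).preimage_mem_nhds ?_
    simpa [e.left_inv hs] using hN
  have h1 := image_mem_nhds (f := fun z => f (e.symm z)) hV
    (hf.comp (e.symm.continuousOn.mono inter_subset_left) (fun z hz => hz.2))
    (fun a ha b hb hab => e.symm.injOn ha.1 hb.1 (hi ha.2 hb.2 hab))
  rw [e.left_inv hs] at h1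
  refine mem_of_superset h1 ?_
  rintro y ⟨z, hz, hzy⟩
  exact ⟨_, hz.2, hzy⟩

end AngleDefect


/-! ### Convex weights, and complexes from unique convex representations. -/

namespace AngleDefect

open Set Filter Topology

/-- The point with the given (finitely supported) weights. -/
noncomputable def bary {d : ℕ} : (E d →₀ ℝ) →ₗ[ℝ] E d := Finsupp.linearCombination ℝ id

/-- The total weight. -/
noncomputable def total {d : ℕ} : (E d →₀ ℝ) →ₗ[ℝ] ℝ := Finsupp.linearCombination ℝ (fun _ => 1)

@[simp] lemma bary_single {d : ℕ} (x : E d) (a : ℝ) : bary (Finsupp.single x a) = a • x := by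
  simp [bary]

@[simp] lemma total_single {d : ℕ} (x : E d) (a : ℝ) : total (Finsupp.single x a) = a := by
  simp [total]

lemma bary_eq_sum {d : ℕ} {w : E d →₀ ℝ} {s : Finset (E d)} (h : w.support ⊆ s) :
    bary w = ∑ x ∈ s, w x • x := by
  rw [bary, Finsupp.linearCombination_apply, Finsupp.sum_of_support_subset _ h] <;> simp

lemma total_eq_sum {d : ℕ} {w : E d →₀ ℝ} {s : Finset (E d)} (h : w.support ⊆ s) :
    total w = ∑ x ∈ s, w x := by
  rw [total, Finsupp.linearCombination_apply, Finsupp.sum_of_support_subset _ h] <;> simp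

/-- Weights of convex combinations. -/
structure IsWeight {d : ℕ} (w : E d →₀ ℝ) : Prop where
  nonneg : ∀ x, 0 ≤ w x
  total_eq_one : total w = 1

lemma IsWeight.support_nonempty {d : ℕ} {w : E d →₀ ℝ} (hw : IsWeight w) : w.support.Nonempty := by
  rw [Finsupp.support_nonempty_iff]
  rintro rfl
  have := hw.total_eq_one
  simp at this

lemma mem_convexHull_iff_weight {d : ℕ} {s : Finset (E d)} {z : E d} :
    z ∈ convexHull ℝ (s : Set (E d)) ↔
      ∃ w : E d →₀ ℝ, IsWeight w ∧ w.support ⊆ s ∧ bary w = z := by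
  classical
  constructor
  · intro hz
    rw [Finset.mem_convexHull'] at hz
    obtain ⟨w, h0, h1, h2⟩ := hz
    have hsup : (Finsupp.onFinset s (fun x => if x ∈ s then w x else 0)
        (fun x hx => by by_contra h; simp [h] at hx)).support ⊆ s :=
      Finsupp.support_onFinset_subset
    refine ⟨_, ⟨fun x => ?_, ?_⟩, hsup, ?_⟩
    · simp only [Finsupp.onFinset_apply]
      split_ifs with h
      exacts [h0 x h, le_rfl]
    · rw [total_eq_sum hsup, ← h1]
      exact Finset.sum_congr rfl fun x hx => by simp [hx]
    · rw [bary_eq_sum hsup, ← h2]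
      exact Finset.sum_congr rfl fun x hx => by simp [hx]
  · rintro ⟨w, hw, hs, rfl⟩
    rw [Finset.mem_convexHull']
    exact ⟨w, fun x _ => hw.nonneg x, by rw [← total_eq_sum hs, hw.total_eq_one],
      (bary_eq_sum hs).symm⟩

lemma eq_of_affineIndependent {d : ℕ} {s : Finset (E d)}
    (hs : AffineIndependent ℝ ((↑) : s → E d)) {w w' : E d →₀ ℝ} (h1 : w.support ⊆ s)
    (h2 : w'.support ⊆ s) (ht : total w = total w') (hb : bary w = bary w') : w = w' := by
  rw [affineIndependent_iff] at hs
  have h3 : (w - w').support ⊆ s := by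
    classical
    exact Finsupp.support_sub.trans (Finset.union_subset h1 h2)
  have h4 := hs Finset.univ (fun x => (w - w') x)
    (by
      rw [Finset.sum_coe_sort s (fun x => (w - w') x), ← total_eq_sum h3, map_sub, ht, sub_self])
    (by
      rw [Finset.sum_coe_sort s (fun x => (w - w') x • x), ← bary_eq_sum h3, map_sub, hb, sub_self])
  ext x
  by_cases hx : x ∈ s
  · exact sub_eq_zero.1 (h4 ⟨x, hx⟩ (Finset.mem_univ _))
  · rw [Finsupp.notMem_support_iff.1 (fun h => hx (h1 h)),
      Finsupp.notMem_support_iff.1 (fun h => hx (h2 h))]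

/-- The convex representation of a point of a complex with weights on a simplex is unique. -/
lemma Cplx.weight_unique {d : ℕ} (K : Cplx d) {w w' : E d →₀ ℝ} (hw : IsWeight w)
    (hw' : IsWeight w') {s t : Finset (E d)} (hs : s ∈ K.faces) (ht : t ∈ K.faces)
    (hws : w.support ⊆ s) (hwt : w'.support ⊆ t) (h : bary w = bary w') : w = w' := by
  classical
  -- The common point has weights supported in `s ∩ t`; affine independence of `s` and of `t`
  -- identifies them with `w` and with `w'`.
  have h1 : bary w ∈ convexHull ℝ ((s ∩ t : Finset (E d)) : Set (E d)) := by
    rw [Finset.coe_inter]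
    exact K.inter_subset_convexHull hs ht ⟨mem_convexHull_iff_weight.2 ⟨w, hw, hws, rfl⟩,
      mem_convexHull_iff_weight.2 ⟨w', hw', hwt, h.symm⟩⟩
  obtain ⟨u, hu, hus, hb⟩ := mem_convexHull_iff_weight.1 h1
  rw [← eq_of_affineIndependent (K.indep hs) (hus.trans Finset.inter_subset_left) hws
    (hu.total_eq_one.trans hw.total_eq_one.symm) hb]
  exact eq_of_affineIndependent (K.indep ht) (hus.trans Finset.inter_subset_right) hwt
    (hu.total_eq_one.trans hw'.total_eq_one.symm) (hb.trans h)

lemma Cplx.mem_space_iff_weight {d : ℕ} (K : Cplx d) {z : E d} :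
    z ∈ K.space ↔ ∃ w : E d →₀ ℝ, IsWeight w ∧ w.support ∈ K.faces ∧ bary w = z := by
  rw [Geometry.SimplicialComplex.mem_space_iff]
  constructor
  · rintro ⟨s, hs, hz⟩
    obtain ⟨w, hw, hws, hb⟩ := mem_convexHull_iff_weight.1 hz
    exact ⟨w, hw, K.down_closed hs hws hw.support_nonempty, hb⟩
  · rintro ⟨w, hw, hs, hb⟩
    exact ⟨_, hs, mem_convexHull_iff_weight.2 ⟨w, hw, subset_rfl, hb⟩⟩

/-- A down-closed family of simplices such that convex representations are unique is a complex. -/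
noncomputable def Cplx.ofUnique {d : ℕ} (F : Set (Finset (E d))) (hfin : F.Finite)
    (hcard : ∀ s ∈ F, s.card ≤ 3) (hne : ∀ s ∈ F, s.Nonempty)
    (hdown : ∀ s ∈ F, ∀ t ⊆ s, t.Nonempty → t ∈ F)
    (huniq : ∀ w w' : E d →₀ ℝ, IsWeight w → IsWeight w' → w.support ∈ F → w'.support ∈ F →
      bary w = bary w' → w = w') : Cplx d where
  faces := F
  isRelLowerSet_faces := fun s hs => ⟨hne s hs, fun t hts ht => hdown s hs t hts ht⟩
  indep := by
    classical
    intro s hs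
    rw [affineIndependent_iff]
    intro t c hc0 hc1
    -- An affine dependence is a signed weight with total and barycentre zero. Adding a small
    -- multiple of it to the uniform weight `u` represents the same point twice, so it must vanish.
    set r : E d →₀ ℝ := ∑ x ∈ t, Finsupp.single (x : E d) (c x) with hr
    have hrx : ∀ x ∈ t, r x = c x := by
      intro x hx
      rw [hr, Finsupp.finsetSum_apply, Finset.sum_eq_single x]
      · simp
      · intro y _ hyx
        exact Finsupp.single_eq_of_ne (fun h => hyx (Subtype.ext h.symm))
      · exact fun h => absurd hx h
    have hrs : r.support ⊆ s := by
      refine (Finsupp.support_finsetSum).trans ?_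
      intro y hy
      obtain ⟨x, -, hx⟩ := Finset.mem_biUnion.1 hy
      have := Finsupp.support_single_subset hx
      rw [Finset.mem_singleton] at this
      rw [this]
      exact x.2
    have htot : total r = 0 := by
      rw [hr, map_sum]
      simpa using hc0
    have hbar : bary r = 0 := by
      rw [hr, map_sum]
      simpa using hc1
    set M : ℝ := 1 + ∑ x ∈ s, |r x| with hM
    have hM0 : 0 < M := by
      have := Finset.sum_nonneg (s := s) (f := fun x => |r x|) (fun x _ => abs_nonneg _)
      linarith
    have hsc : (0 : ℝ) < s.card := by exact_mod_cast (hne s hs).card_pos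
    set u : E d →₀ ℝ := ∑ x ∈ s, Finsupp.single x (1 / (s.card : ℝ)) with hu
    have hux : ∀ x, u x = if x ∈ s then 1 / (s.card : ℝ) else 0 := by
      intro x
      rw [hu, Finsupp.finsetSum_apply]
      simp [Finsupp.single_apply]
    have hus : u.support ⊆ s := by
      intro x hx
      by_contra h
      simp [hux, h] at hx
    have hut : total u = 1 := by
      rw [hu, map_sum]
      simp [hsc.ne']
    -- Since `|r x| ≤ M`, the perturbation `ε * r x` is at most the uniform weight in absolute
    -- value.
    set ε : ℝ := 1 / (M * s.card) with hε
    have hε0 : 0 < ε := by positivity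
    have hsupp : (u + ε • r).support ⊆ s := by
      refine Finsupp.support_add.trans (Finset.union_subset hus ?_)
      exact Finsupp.support_smul.trans hrs
    have hW : IsWeight (u + ε • r) := by
      refine ⟨fun x => ?_, by rw [map_add, map_smul, hut, htot]; simp⟩
      by_cases hx : x ∈ s
      · have h1 : |r x| ≤ M := by
          have := Finset.single_le_sum (f := fun x => |r x|) (fun x _ => abs_nonneg _) hx
          linarith
        have h2 : -M ≤ r x := (abs_le.1 h1).1
        have h3 : ε * M = 1 / s.card := by
          rw [hε]
          field_simp
        simp only [Finsupp.coe_add, Finsupp.coe_smul, Pi.add_apply, Pi.smul_apply, smul_eq_mul,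
          hux, hx, if_true]
        nlinarith
      · rw [Finsupp.notMem_support_iff.1 (fun h => hx (hsupp h))]
    have hU : IsWeight u := by
      refine ⟨fun x => ?_, hut⟩
      rw [hux]
      split_ifs <;> positivity
    have heq := huniq _ _ hW hU (hdown s hs _ hsupp hW.support_nonempty)
      (hdown s hs _ hus hU.support_nonempty) (by rw [map_add, map_smul, hbar]; simp)
    have h0 : r = 0 := by
      have : ε • r = 0 := by simpa using heq
      exact (smul_eq_zero.1 this).resolve_left hε0.ne'
    intro x hx
    rw [← hrx x hx, h0]
    rfl
  inter_subset_convexHull := by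
    classical
    rintro s t hs ht z ⟨hzs, hzt⟩
    obtain ⟨w, hw, hws, rfl⟩ := mem_convexHull_iff_weight.1 hzs
    obtain ⟨w', hw', hwt, hb⟩ := mem_convexHull_iff_weight.1 hzt
    have := huniq w' w hw' hw (hdown t ht _ hwt hw'.support_nonempty)
      (hdown s hs _ hws hw.support_nonempty) hb
    subst this
    rw [← Finset.coe_inter]
    exact mem_convexHull_iff_weight.2 ⟨w', hw, Finset.subset_inter hws hwt, rfl⟩
  finite_faces := hfin
  card_le_three := hcard

lemma IsSubdivision.refl {d : ℕ} (K : Cplx d) : IsSubdivision K K :=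
  ⟨rfl, fun s hs => ⟨s, hs, subset_rfl⟩⟩

lemma IsSubdivision.trans {d : ℕ} {K J L : Cplx d} (h1 : IsSubdivision L J)
    (h2 : IsSubdivision J K) : IsSubdivision L K := by
  refine ⟨h1.1.trans h2.1, fun s hs => ?_⟩
  obtain ⟨t, ht, hst⟩ := h1.2 s hs
  obtain ⟨u, hu, htu⟩ := h2.2 t ht
  exact ⟨u, hu, hst.trans htu⟩

end AngleDefect


/-! ### Stellar subdivision of an edge. -/

namespace AngleDefect

open Set Filter Topology

section Stellar

variable {d : ℕ} {K : Cplx d} {x y : E d} {μ : ℝ}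

/-- The point that divides the edge from `x` to `y` in the ratio `μ : 1 - μ`. -/
noncomputable def edgePoint (x y : E d) (μ : ℝ) : E d := (1 - μ) • x + μ • y

open Classical in
/-- The simplices of the stellar subdivision of `K` at the point `q` of the edge `{x, y}`. -/
def stellarFaces (K : Cplx d) (x y q : E d) : Set (Finset (E d)) :=
  {s | (s ∈ K.faces ∧ ¬ {x, y} ⊆ s) ∨
    (q ∈ s ∧ ¬ {x, y} ⊆ s.erase q ∧ s.erase q ∪ {x, y} ∈ K.faces)}

/-- The weights of the edge point. -/
noncomputable def edgeWeight (x y : E d) (μ : ℝ) : E d →₀ ℝ :=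
  Finsupp.single x (1 - μ) + Finsupp.single y μ

lemma bary_edgeWeight : bary (edgeWeight x y μ) = edgePoint x y μ := by
  simp only [edgeWeight, edgePoint, map_add, bary_single]

lemma total_edgeWeight : total (edgeWeight x y μ) = 1 := by
  simp [edgeWeight]

lemma edgeWeight_left (hxy : x ≠ y) : edgeWeight x y μ x = 1 - μ := by
  simp [edgeWeight, hxy]

lemma edgeWeight_right (hxy : x ≠ y) : edgeWeight x y μ y = μ := by
  simp [edgeWeight, hxy.symm]

lemma edgeWeight_of_ne {z : E d} (hx : z ≠ x) (hy : z ≠ y) : edgeWeight x y μ z = 0 := by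
  simp [edgeWeight, hx, hy]

lemma edgeWeight_nonneg (h0 : 0 ≤ μ) (h1 : μ ≤ 1) (z : E d) : 0 ≤ edgeWeight x y μ z := by
  simp only [edgeWeight, Finsupp.add_apply, Finsupp.single_apply]
  split_ifs <;> simp <;> linarith

open Classical in
lemma edgeWeight_support : (edgeWeight x y μ).support ⊆ {x, y} := by
  intro z hz
  by_contra h
  simp only [Finset.mem_insert, Finset.mem_singleton, not_or] at h
  exact Finsupp.mem_support_iff.1 hz (edgeWeight_of_ne h.1 h.2)

open Classical in
-- As a vertex the point would be represented by a single weight, while it already has a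
-- representation with two positive weights.
lemma edgePoint_notMem (hxy : x ≠ y) (hK : {x, y} ∈ K.faces) (h0 : 0 < μ) (h1 : μ < 1)
    {s : Finset (E d)} (hs : s ∈ K.faces) : edgePoint x y μ ∉ s := by
  intro hq
  have h2 := K.weight_unique (w := edgeWeight x y μ) (w' := Finsupp.single (edgePoint x y μ) 1)
    ⟨edgeWeight_nonneg h0.le h1.le, total_edgeWeight⟩
    ⟨fun z => by
      rw [Finsupp.single_apply]
      split_ifs <;> norm_num, by simp⟩
    hK hs edgeWeight_support
    (Finsupp.support_single_subset.trans (Finset.singleton_subset_iff.2 hq))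
    (by simp [bary_edgeWeight])
  have h3 := DFunLike.congr_fun h2 x
  have h4 := DFunLike.congr_fun h2 y
  rw [edgeWeight_left hxy, Finsupp.single_apply] at h3
  rw [edgeWeight_right hxy, Finsupp.single_apply] at h4
  split_ifs at h3 h4 with hqx hqy
  · exact hxy (hqx.symm.trans hqy)
  all_goals linarith

/-- Distribute the weight of the edge point to the ends of the edge. -/
noncomputable def pushWeight (x y : E d) (μ : ℝ) (w : E d →₀ ℝ) : E d →₀ ℝ :=
  w.erase (edgePoint x y μ) + w (edgePoint x y μ) • edgeWeight x y μ

lemma bary_pushWeight (w : E d →₀ ℝ) : bary (pushWeight x y μ w) = bary w := by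
  conv_rhs => rw [← Finsupp.erase_add_single (edgePoint x y μ) w]
  rw [pushWeight, map_add, map_add, map_smul, bary_edgeWeight, bary_single]

lemma total_pushWeight (w : E d →₀ ℝ) : total (pushWeight x y μ w) = total w := by
  conv_rhs => rw [← Finsupp.erase_add_single (edgePoint x y μ) w]
  rw [pushWeight, map_add, map_add, map_smul, total_edgeWeight, total_single]
  simp

lemma isWeight_pushWeight (h0 : 0 < μ) (h1 : μ < 1) {w : E d →₀ ℝ} (hw : IsWeight w) :
    IsWeight (pushWeight x y μ w) := by
  refine ⟨fun z => ?_, (total_pushWeight w).trans hw.total_eq_one⟩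
  simp only [pushWeight, Finsupp.add_apply, Finsupp.smul_apply, smul_eq_mul]
  refine add_nonneg ?_ (mul_nonneg (hw.nonneg _) (edgeWeight_nonneg h0.le h1.le z))
  rw [Finsupp.erase_apply]
  split_ifs
  exacts [le_rfl, hw.nonneg z]

open Classical in
lemma pushWeight_support (hxy : x ≠ y) (hK : {x, y} ∈ K.faces) (h0 : 0 < μ) (h1 : μ < 1)
    {w : E d →₀ ℝ} (hw : IsWeight w) (hs : w.support ∈ stellarFaces K x y (edgePoint x y μ)) :
    (pushWeight x y μ w).support ∈ K.faces := by
  rcases hs with ⟨hs, -⟩ | ⟨hq, -, hs⟩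
  · have hq := edgePoint_notMem hxy hK h0 h1 hs
    rw [Finsupp.notMem_support_iff] at hq
    rw [pushWeight, hq, zero_smul, add_zero, Finsupp.erase_of_notMem_support]
    · exact hs
    · simpa using hq
  · refine K.down_closed hs ?_ (isWeight_pushWeight h0 h1 hw).support_nonempty
    refine Finsupp.support_add.trans (Finset.union_subset_union ?_ ?_)
    · rw [Finsupp.support_erase]
    · exact Finsupp.support_smul.trans edgeWeight_support

open Classical in
-- No simplex of the subdivision contains both ends of the divided edge. This is what makes
-- `pushWeight` injective there.
lemma stellar_weight_zero {w : E d →₀ ℝ}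
    (hqx : edgePoint x y μ ≠ x) (hqy : edgePoint x y μ ≠ y)
    (hs : w.support ∈ stellarFaces K x y (edgePoint x y μ)) : w x = 0 ∨ w y = 0 := by
  by_contra! h
  have hx := Finsupp.mem_support_iff.2 h.1
  have hy := Finsupp.mem_support_iff.2 h.2
  rcases hs with ⟨-, hs⟩ | ⟨-, hs, -⟩
  · exact hs (by simp [Finset.insert_subset_iff, h.1, h.2])
  · exact hs (by simp [Finset.insert_subset_iff, h.1, h.2, hqx.symm, hqy.symm])

open Classical in
lemma edgePoint_ne_left (hxy : x ≠ y) (hK : {x, y} ∈ K.faces) (h0 : 0 < μ) (h1 : μ < 1) :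
    edgePoint x y μ ≠ x := fun h =>
  edgePoint_notMem hxy hK h0 h1 hK (by simp [h])

open Classical in
lemma edgePoint_ne_right (hxy : x ≠ y) (hK : {x, y} ∈ K.faces) (h0 : 0 < μ) (h1 : μ < 1) :
    edgePoint x y μ ≠ y := fun h =>
  edgePoint_notMem hxy hK h0 h1 hK (by simp [h])

lemma pushWeight_left (hxy : x ≠ y) (hqx : edgePoint x y μ ≠ x) (w : E d →₀ ℝ) :
    pushWeight x y μ w x = w x + w (edgePoint x y μ) * (1 - μ) := by
  simp [pushWeight, Finsupp.erase_ne hqx.symm, edgeWeight_left hxy]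

lemma pushWeight_right (hxy : x ≠ y) (hqy : edgePoint x y μ ≠ y) (w : E d →₀ ℝ) :
    pushWeight x y μ w y = w y + w (edgePoint x y μ) * μ := by
  simp [pushWeight, Finsupp.erase_ne hqy.symm, edgeWeight_right hxy]

open Classical in
-- If the edge point weighed less in one of the two, both ends of the edge would weigh strictly more
-- there, hence be positive, against `stellar_weight_zero`. Once the weights of the edge point
-- agree, so do all others.
lemma pushWeight_injective (hxy : x ≠ y) (hK : {x, y} ∈ K.faces) (h0 : 0 < μ) (h1 : μ < 1)
    {w w' : E d →₀ ℝ} (hw : IsWeight w) (hw' : IsWeight w')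
    (hs : w.support ∈ stellarFaces K x y (edgePoint x y μ))
    (hs' : w'.support ∈ stellarFaces K x y (edgePoint x y μ))
    (h : pushWeight x y μ w = pushWeight x y μ w') : w = w' := by
  have hqx := edgePoint_ne_left hxy hK h0 h1
  have hqy := edgePoint_ne_right hxy hK h0 h1
  have hx := DFunLike.congr_fun h x
  have hy := DFunLike.congr_fun h y
  rw [pushWeight_left hxy hqx, pushWeight_left hxy hqx] at hx
  rw [pushWeight_right hxy hqy, pushWeight_right hxy hqy] at hy
  have a1 := hw.nonneg x
  have a2 := hw.nonneg y
  have a3 := hw'.nonneg x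
  have a4 := hw'.nonneg y
  have h2 : 0 < 1 - μ := by linarith
  have hq : w (edgePoint x y μ) = w' (edgePoint x y μ) := by
    rcases lt_trichotomy (w (edgePoint x y μ)) (w' (edgePoint x y μ)) with hlt | heq | hlt
    · have b1 := mul_lt_mul_of_pos_right hlt h2
      have b2 := mul_lt_mul_of_pos_right hlt h0
      rcases stellar_weight_zero hqx hqy hs with e | e <;> linarith
    · exact heq
    · have b1 := mul_lt_mul_of_pos_right hlt h2
      have b2 := mul_lt_mul_of_pos_right hlt h0
      rcases stellar_weight_zero hqx hqy hs' with e | e <;> linarith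
  rw [← Finsupp.erase_add_single (edgePoint x y μ) w,
    ← Finsupp.erase_add_single (edgePoint x y μ) w', hq]
  rw [pushWeight, pushWeight, hq] at h
  rw [add_right_cancel h]

open Classical in
/-- The stellar subdivision of `K` at a point of the edge `{x, y}`. -/
noncomputable def stellar (K : Cplx d) (hxy : x ≠ y) (hK : {x, y} ∈ K.faces) (h0 : 0 < μ)
    (h1 : μ < 1) : Cplx d :=
  Cplx.ofUnique (stellarFaces K x y (edgePoint x y μ))
    (by
      have : stellarFaces K x y (edgePoint x y μ) ⊆ K.faces ∪
          (⋃ t ∈ K.faces, ((insert (edgePoint x y μ) t).powerset : Set (Finset (E d)))) := by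
        rintro s (⟨hs, -⟩ | ⟨hq, -, hs⟩)
        · exact Or.inl hs
        · refine Or.inr (mem_biUnion hs ?_)
          simp only [Finset.coe_powerset, mem_preimage, Set.mem_powerset_iff, Finset.coe_subset]
          intro z hz
          by_cases hzq : z = edgePoint x y μ
          · simp [hzq]
          · simp [hz, hzq]
      exact (K.finite_faces.union (K.finite_faces.biUnion fun t _ => Finset.finite_toSet _)).subset
        this)
    (by
      rintro s (⟨hs, -⟩ | ⟨hq, hn, hs⟩)
      · exact K.card_le_three s hs
      · have h2 := K.card_le_three _ hs
        -- Without `q`, the simplex misses an end of the edge and is a proper face of a simplex of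
        -- `K`; putting `q` back does not exceed the bound.
        have h3 : (s.erase (edgePoint x y μ)).card < (s.erase (edgePoint x y μ) ∪ {x, y}).card := by
          refine Finset.card_lt_card ⟨Finset.subset_union_left, fun h => hn ?_⟩
          exact Finset.subset_union_right.trans h
        have h4 := Finset.card_erase_add_one hq
        omega)
    (by
      rintro s (⟨hs, -⟩ | ⟨hq, -, -⟩)
      · exact K.nonempty_of_mem_faces hs
      · exact ⟨_, hq⟩)
    (by
      rintro s (⟨hs, hn⟩ | ⟨hq, hn, hs⟩) t hts htn
      · exact Or.inl ⟨K.down_closed hs hts htn, fun h => hn (h.trans hts)⟩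
      · by_cases hqt : edgePoint x y μ ∈ t
        · refine Or.inr ⟨hqt, fun h => hn (h.trans (Finset.erase_subset_erase _ hts)), ?_⟩
          exact K.down_closed hs (Finset.union_subset_union (Finset.erase_subset_erase _ hts)
            subset_rfl) (by simp)
        · have h2 : t ⊆ s.erase (edgePoint x y μ) := Finset.subset_erase.2 ⟨hts, hqt⟩
          exact Or.inl ⟨K.down_closed hs (h2.trans Finset.subset_union_left) htn,
            fun h => hn (h.trans h2)⟩)
    -- Uniqueness of weights is inherited from `K` through `pushWeight`.
    (fun w w' hw hw' hs hs' hb => pushWeight_injective hxy hK h0 h1 hw hw' hs hs'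
      (K.weight_unique (isWeight_pushWeight h0 h1 hw) (isWeight_pushWeight h0 h1 hw')
        (pushWeight_support hxy hK h0 h1 hw hs) (pushWeight_support hxy hK h0 h1 hw' hs')
        subset_rfl subset_rfl (by rw [bary_pushWeight, bary_pushWeight, hb])))

open Classical in
lemma mem_stellar (hxy : x ≠ y) (hK : {x, y} ∈ K.faces) (h0 : 0 < μ) (h1 : μ < 1)
    {s : Finset (E d)} : s ∈ (stellar K hxy hK h0 h1).faces ↔
      (s ∈ K.faces ∧ ¬ {x, y} ⊆ s) ∨ (edgePoint x y μ ∈ s ∧ ¬ {x, y} ⊆ s.erase (edgePoint x y μ) ∧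
        s.erase (edgePoint x y μ) ∪ {x, y} ∈ K.faces) := Iff.rfl

open Classical in
/-- A weight of `K` comes from a weight of the stellar subdivision. -/
lemma exists_pushWeight_eq (hxy : x ≠ y) (hK : {x, y} ∈ K.faces) (h0 : 0 < μ) (h1 : μ < 1)
    {W : E d →₀ ℝ} (hW : IsWeight W) (hs : W.support ∈ K.faces) :
    ∃ w : E d →₀ ℝ, IsWeight w ∧ w.support ∈ (stellar K hxy hK h0 h1).faces ∧
      bary w = bary W := by
  have hqx := edgePoint_ne_left hxy hK h0 h1
  have hqy := edgePoint_ne_right hxy hK h0 h1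
  have hμ : 0 < 1 - μ := by linarith
  by_cases hn : {x, y} ⊆ W.support
  swap
  · exact ⟨W, hW, (mem_stellar ..).2 (Or.inl ⟨hs, hn⟩), rfl⟩
  have hq : W (edgePoint x y μ) = 0 :=
    Finsupp.notMem_support_iff.1 (edgePoint_notMem hxy hK h0 h1 hs)
  have hWx : 0 < W x := lt_of_le_of_ne (hW.nonneg x)
    (Finsupp.mem_support_iff.1 (hn (by simp))).symm
  have hWy : 0 < W y := lt_of_le_of_ne (hW.nonneg y)
    (Finsupp.mem_support_iff.1 (hn (by simp))).symm
  -- The largest multiple of the edge weight that fits under `W`. Trading it for weight at the edge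
  -- point leaves at least one end with weight zero.
  set l := min (W x / (1 - μ)) (W y / μ) with hl
  have hl0 : 0 < l := lt_min (by positivity) (by positivity)
  have hlx : l * (1 - μ) ≤ W x := by
    rw [← le_div_iff₀ hμ]
    exact min_le_left _ _
  have hly : l * μ ≤ W y := by
    rw [← le_div_iff₀ h0]
    exact min_le_right _ _
  have hlz : l * (1 - μ) = W x ∨ l * μ = W y := by
    rcases min_choice (W x / (1 - μ)) (W y / μ) with h | h
    · left
      rw [hl, h]
      field_simp
    · right
      rw [hl, h]
      field_simp
  set w : E d →₀ ℝ := W - l • edgeWeight x y μ + Finsupp.single (edgePoint x y μ) l with hw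
  have hwx : w x = W x - l * (1 - μ) := by
    simp [hw, edgeWeight_left hxy, hqx.symm]
  have hwy : w y = W y - l * μ := by
    simp [hw, edgeWeight_right hxy, hqy.symm]
  have hwq : w (edgePoint x y μ) = l := by
    simp [hw, edgeWeight_of_ne hqx hqy, hq]
  have hwz : ∀ z, z ≠ x → z ≠ y → z ≠ edgePoint x y μ → w z = W z := by
    intro z hzx hzy hzq
    simp [hw, edgeWeight_of_ne hzx hzy, hzq]
  have hnn : ∀ z, 0 ≤ w z := by
    intro z
    by_cases hzx : z = x
    · rw [hzx, hwx]
      linarith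
    by_cases hzy : z = y
    · rw [hzy, hwy]
      linarith
    by_cases hzq : z = edgePoint x y μ
    · rw [hzq, hwq]
      exact hl0.le
    rw [hwz z hzx hzy hzq]
    exact hW.nonneg z
  refine ⟨w, ⟨hnn, ?_⟩, (mem_stellar ..).2 (Or.inr ⟨?_, ?_, ?_⟩), ?_⟩
  · rw [hw, map_add, map_sub, map_smul, total_edgeWeight, total_single, hW.total_eq_one]
    simp
  · rw [Finsupp.mem_support_iff, hwq]
    exact hl0.ne'
  · intro h
    have h2 := Finset.mem_of_mem_erase (h (Finset.mem_insert_self x {y}))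
    have h3 := Finset.mem_of_mem_erase (h (Finset.mem_insert_of_mem (Finset.mem_singleton_self y)))
    rw [Finsupp.mem_support_iff] at h2 h3
    rcases hlz with e | e
    · exact h2 (by rw [hwx, e, sub_self])
    · exact h3 (by rw [hwy, e, sub_self])
  · convert! hs using 1
    ext z
    simp only [Finset.mem_union, Finset.mem_erase, Finset.mem_insert, Finset.mem_singleton]
    constructor
    · rintro (⟨hzq, hz⟩ | rfl | rfl)
      · by_cases hzx : z = x
        · exact hn (by simp [hzx])
        by_cases hzy : z = y
        · exact hn (by simp [hzy])
        rw [Finsupp.mem_support_iff, hwz z hzx hzy hzq] at hz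
        exact Finsupp.mem_support_iff.2 hz
      · exact hn (by simp)
      · exact hn (by simp)
    · intro hz
      by_cases hzx : z = x
      · exact Or.inr (Or.inl hzx)
      by_cases hzy : z = y
      · exact Or.inr (Or.inr hzy)
      have hzq : z ≠ edgePoint x y μ := by
        rintro rfl
        exact Finsupp.mem_support_iff.1 hz hq
      refine Or.inl ⟨hzq, ?_⟩
      rw [Finsupp.mem_support_iff, hwz z hzx hzy hzq]
      exact Finsupp.mem_support_iff.1 hz
  · rw [hw, map_add, map_sub, map_smul, bary_edgeWeight, bary_single]
    simp

open Classical in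
lemma isSubdivision_stellar (hxy : x ≠ y) (hK : {x, y} ∈ K.faces) (h0 : 0 < μ) (h1 : μ < 1) :
    IsSubdivision (stellar K hxy hK h0 h1) K := by
  refine ⟨?_, ?_⟩
  · ext z
    rw [Cplx.mem_space_iff_weight, Cplx.mem_space_iff_weight]
    constructor
    · rintro ⟨w, hw, hs, rfl⟩
      exact ⟨_, isWeight_pushWeight h0 h1 hw, pushWeight_support hxy hK h0 h1 hw hs,
        bary_pushWeight w⟩
    · rintro ⟨W, hW, hs, rfl⟩
      exact exists_pushWeight_eq hxy hK h0 h1 hW hs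
  · rintro s (⟨hs, -⟩ | ⟨hq, -, hs⟩)
    · exact ⟨s, hs, subset_rfl⟩
    · refine ⟨_, hs, convexHull_min ?_ (convex_convexHull ℝ _)⟩
      intro z hz
      by_cases hzq : z = edgePoint x y μ
      · rw [hzq]
        refine mem_convexHull_iff_weight.2 ⟨edgeWeight x y μ,
          ⟨edgeWeight_nonneg h0.le h1.le, total_edgeWeight⟩, ?_, bary_edgeWeight⟩
        exact edgeWeight_support.trans Finset.subset_union_right
      · refine subset_convexHull ℝ _ ?_
        rw [Finset.mem_coe] at hz ⊢
        exact Finset.mem_union_left _ (Finset.mem_erase.2 ⟨hzq, hz⟩)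

end Stellar

end AngleDefect


/-! ### Fans: the star of a vertex recorded by cumulative angles. -/

namespace AngleDefect

open Set Filter Topology
open scoped EuclideanGeometry

section Combinatorics

variable {α : Type*} [DecidableEq α] {v x y q a b : α} {s : Finset α}

/-- This and the next two lemmas describe what dividing the edge `{x, y}` opposite `v` does to the
triangle at `v`: it becomes two triangles. -/
lemma subset_split_of_subset (h : s ⊆ {v, x, y}) (hn : ¬ {x, y} ⊆ s) :
    s ⊆ {v, x, q} ∨ s ⊆ {v, q, y} := by
  simp only [Finset.subset_iff, Finset.mem_insert, Finset.mem_singleton] at *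
  grind

lemma subset_split_of_erase (h : s.erase q ∪ {x, y} ⊆ {v, x, y}) (hn : ¬ {x, y} ⊆ s.erase q) :
    s ⊆ {v, x, q} ∨ s ⊆ {v, q, y} := by
  simp only [Finset.subset_iff, Finset.mem_insert, Finset.mem_singleton, Finset.mem_union,
    Finset.mem_erase] at *
  grind

lemma split_cases (hqx : q ≠ x) (hqy : q ≠ y) (hxv : x ≠ v) (hyv : y ≠ v)
    (hxy : x ≠ y) (h : s ⊆ {v, x, q} ∨ s ⊆ {v, q, y}) :
    (s ⊆ {v, x, y} ∧ ¬ {x, y} ⊆ s) ∨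
      (q ∈ s ∧ ¬ {x, y} ⊆ s.erase q ∧ s.erase q ∪ {x, y} ⊆ {v, x, y}) := by
  have h1 : ¬ {x, y} ⊆ s := fun h2 => by
    have hx : x ∈ s := h2 (by simp)
    have hy : y ∈ s := h2 (by simp)
    clear h2
    simp only [Finset.subset_iff, Finset.mem_insert, Finset.mem_singleton] at *
    grind
  by_cases hq : q ∈ s
  · refine Or.inr ⟨hq, fun h2 => h1 (h2.trans (Finset.erase_subset _ _)), ?_⟩
    simp only [Finset.subset_iff, Finset.mem_insert, Finset.mem_singleton, Finset.mem_union,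
      Finset.mem_erase] at *
    grind
  · refine Or.inl ⟨?_, h1⟩
    simp only [Finset.subset_iff, Finset.mem_insert, Finset.mem_singleton] at *
    grind

/-- This and the next two lemmas describe what dividing the edge `{v, y}` does to the star of `v`:
the vertex `y` is replaced by `q` throughout. -/
lemma subset_move_of_subset (hv : v ∈ s) (h : s ⊆ {v, a, b}) (hn : ¬ {v, y} ⊆ s) :
    s ⊆ {v, if a = y then q else a, if b = y then q else b} := by
  simp only [Finset.subset_iff, Finset.mem_insert, Finset.mem_singleton] at *
  grind

lemma subset_move_of_erase (hv : v ∈ s) (hqv : q ≠ v) (hn : ¬ {v, y} ⊆ s.erase q)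
    (hyv : v ≠ y) (h : s.erase q ∪ {v, y} ⊆ {v, a, b}) :
    s ⊆ {v, if a = y then q else a, if b = y then q else b} := by
  simp only [Finset.subset_iff, Finset.mem_insert, Finset.mem_singleton, Finset.mem_union,
    Finset.mem_erase] at *
  grind

lemma move_cases (hqa : q ≠ a) (hqb : q ≠ b) (hqv : q ≠ v) (hqy : q ≠ y) (hyv : v ≠ y)
    (h : s ⊆ {v, if a = y then q else a, if b = y then q else b}) :
    (s ⊆ {v, a, b} ∧ ¬ {v, y} ⊆ s) ∨
      (q ∈ s ∧ ¬ {v, y} ⊆ s.erase q ∧ s.erase q ∪ {v, y} ⊆ {v, a, b}) := by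
  have h1 : ¬ {v, y} ⊆ s := fun h2 => by
    have hy : y ∈ s := h2 (by simp)
    clear h2
    simp only [Finset.subset_iff, Finset.mem_insert, Finset.mem_singleton] at *
    grind
  by_cases hq : q ∈ s
  · refine Or.inr ⟨hq, fun h2 => h1 (h2.trans (Finset.erase_subset _ _)), ?_⟩
    simp only [Finset.subset_iff, Finset.mem_insert, Finset.mem_singleton, Finset.mem_union,
      Finset.mem_erase] at *
    grind
  · refine Or.inl ⟨?_, h1⟩
    simp only [Finset.subset_iff, Finset.mem_insert, Finset.mem_singleton] at *
    grind

end Combinatorics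
/-- `a` and `b` are consecutive elements of `C`. -/
def Consec (C : Finset ℝ) (a b : ℝ) : Prop :=
  a ∈ C ∧ b ∈ C ∧ a < b ∧ ∀ c ∈ C, c ≤ a ∨ b ≤ c

lemma exists_greatest_lt {C : Finset ℝ} {t c : ℝ} (hc : c ∈ C) (hct : c < t) :
    ∃ a ∈ C, a < t ∧ ∀ e ∈ C, e < t → e ≤ a := by
  obtain ⟨a, ha, hm⟩ := (C.filter (· < t)).exists_max_image id ⟨c, by simp [hc, hct]⟩
  simp only [Finset.mem_filter, id] at ha hm
  exact ⟨a, ha.1, ha.2, fun e he het => hm e ⟨he, het⟩⟩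

lemma exists_least_gt {C : Finset ℝ} {t c : ℝ} (hc : c ∈ C) (hct : t < c) :
    ∃ a ∈ C, t < a ∧ ∀ e ∈ C, t < e → a ≤ e := by
  obtain ⟨a, ha, hm⟩ := (C.filter (t < ·)).exists_min_image id ⟨c, by simp [hc, hct]⟩
  simp only [Finset.mem_filter, id] at ha hm
  exact ⟨a, ha.1, ha.2, fun e he het => hm e ⟨he, het⟩⟩

lemma exists_consec_of_lt {C : Finset ℝ} {t c : ℝ} (ht : t ∈ C) (hc : c ∈ C) (htc : t < c) :
    ∃ b, Consec C t b := by
  obtain ⟨b, hb, htb, hm⟩ := exists_least_gt hc htc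
  exact ⟨b, ht, hb, htb, fun e he => (le_or_gt e t).imp_right (hm e he)⟩

lemma exists_consec_of_gt {C : Finset ℝ} {t c : ℝ} (ht : t ∈ C) (hc : c ∈ C) (htc : c < t) :
    ∃ a, Consec C a t := by
  obtain ⟨b, hb, htb, hm⟩ := exists_greatest_lt hc htc
  exact ⟨b, hb, ht, htb, fun e he => (lt_or_ge e t).imp_left (hm e he)⟩

lemma exists_consec_between {C : Finset ℝ} {t c e : ℝ} (ht : t ∉ C) (hc : c ∈ C) (he : e ∈ C)
    (hct : c < t) (hte : t < e) : ∃ a b, Consec C a b ∧ a < t ∧ t < b := by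
  obtain ⟨a, ha, hat, hma⟩ := exists_greatest_lt hc hct
  obtain ⟨b, hb, htb, hmb⟩ := exists_least_gt he hte
  refine ⟨a, b, ⟨ha, hb, hat.trans htb, fun z hz => ?_⟩, hat, htb⟩
  rcases lt_trichotomy z t with h | h | h
  · exact Or.inl (hma z hz h)
  · exact absurd (h ▸ hz) ht
  · exact Or.inr (hmb z hz h)

lemma Consec.right_unique {C : Finset ℝ} {a b b' : ℝ} (h : Consec C a b) (h' : Consec C a b') :
    b = b' := by
  have h1 := h.2.2.2 b' h'.2.1
  have h2 := h'.2.2.2 b h.2.1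
  have h3 := h.2.2.1
  have h4 := h'.2.2.1
  rcases h1 with h1 | h1 <;> rcases h2 with h2 | h2 <;> linarith

lemma consec_insert_iff {C : Finset ℝ} {t s₀ t₁ a b : ℝ} (ht : t ∉ C) (h : Consec C s₀ t₁)
    (h0 : s₀ < t) (h1 : t < t₁) : Consec (insert t C) a b ↔
      (Consec C a b ∧ a ≠ s₀) ∨ (a = s₀ ∧ b = t) ∨ (a = t ∧ b = t₁) := by
  obtain ⟨hs, ht1, -, hm⟩ := h
  simp only [Consec, Finset.mem_insert]
  constructor
  · rintro ⟨ha, hb, hab, hc⟩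
    have c1 := hc t (Or.inl rfl)
    have c2 := hc s₀ (Or.inr hs)
    have c3 := hc t₁ (Or.inr ht1)
    rcases ha with rfl | ha
    · right; right
      refine ⟨rfl, ?_⟩
      rcases hb with rfl | hb
      · exact absurd hab (lt_irrefl _)
      · have := hm b hb
        rcases this with h | h <;> rcases c3 with h' | h' <;> linarith
    · have ma := hm a ha
      rcases hb with rfl | hb
      · right; left
        refine ⟨?_, rfl⟩
        rcases ma with h | h <;> rcases c2 with h' | h' <;> linarith
      · left
        refine ⟨⟨ha, hb, hab, fun c hcC => hc c (Or.inr hcC)⟩, ?_⟩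
        rintro rfl
        have mb := hm b hb
        rcases mb with h | h <;> rcases c1 with h' | h' <;> linarith
  · rintro (⟨⟨ha, hb, hab, hc⟩, hne⟩ | ⟨rfl, rfl⟩ | ⟨rfl, rfl⟩)
    · refine ⟨Or.inr ha, Or.inr hb, hab, ?_⟩
      rintro c (rfl | hcC)
      · rcases hm a ha with h | h
        · have := hc s₀ hs
          rcases this with h' | h'
          · exact absurd (le_antisymm h h') hne
          · right
            linarith
        · left
          linarith
      · exact hc c hcC
    · refine ⟨Or.inr hs, Or.inl rfl, h0, ?_⟩
      rintro c (rfl | hcC)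
      · exact Or.inr le_rfl
      · rcases hm c hcC with h | h
        · exact Or.inl h
        · right
          linarith
    · refine ⟨Or.inl rfl, Or.inr ht1, h1, ?_⟩
      rintro c (rfl | hcC)
      · exact Or.inl le_rfl
      · rcases hm c hcC with h | h
        · left
          linarith
        · exact Or.inr h

open Classical in
/-- The star of `v` in `K` is a cyclic fan of triangles with total angle `Θ` (in radians). The
link vertices are the points `u t`, where `t ∈ C` is the angle at which the vertex is seen from
`v`, and `0` and `Θ` give the same vertex. -/
structure FanAt {d : ℕ} (K : Cplx d) (v : E d) (Θ : ℝ) (C : Finset ℝ) (u : ℝ → E d) : Prop where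
  zero_mem : 0 ∈ C
  top_mem : Θ ∈ C
  nonneg : ∀ t ∈ C, 0 ≤ t
  le_top : ∀ t ∈ C, t ≤ Θ
  four_le_card : 4 ≤ C.card
  closed : u 0 = u Θ
  inj : ∀ s ∈ C, ∀ t ∈ C, s < Θ → t < Θ → u s = u t → s = t
  ne_center : ∀ t ∈ C, u t ≠ v
  faces_iff : ∀ s : Finset (E d), v ∈ s →
    (s ∈ K.faces ↔ ∃ a b, Consec C a b ∧ s ⊆ {v, u a, u b})
  angle_eq : ∀ a b, Consec C a b → ∠ (u a) v (u b) = b - a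

namespace FanAt

variable {d : ℕ} {K : Cplx d} {v : E d} {Θ : ℝ} {C : Finset ℝ} {u : ℝ → E d}

lemma eq_cases (h : FanAt K v Θ C u) {s t : ℝ} (hs : s ∈ C) (ht : t ∈ C) (he : u s = u t) :
    s = t ∨ (s = 0 ∧ t = Θ) ∨ (s = Θ ∧ t = 0) := by
  have h0 := h.zero_mem
  rcases (h.le_top s hs).lt_or_eq with h1 | h1 <;> rcases (h.le_top t ht).lt_or_eq with h2 | h2
  · exact Or.inl (h.inj s hs t ht h1 h2 he)
  · refine Or.inr (Or.inl ⟨h.inj s hs 0 h0 h1 ?_ ?_, h2⟩)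
    · exact (h.nonneg s hs).trans_lt h1
    · rw [he, h2, h.closed]
  · refine Or.inr (Or.inr ⟨h1, h.inj t ht 0 h0 h2 ?_ ?_⟩)
    · exact (h.nonneg t ht).trans_lt h2
    · rw [← he, h1, h.closed]
  · exact Or.inl (h1.trans h2.symm)

/-- The form in which `four_le_card` is used. As `0` and `Θ` name the same vertex, four angles mean
at least three link vertices. -/
lemma exists_ne (h : FanAt K v Θ C u) (x y z : ℝ) : ∃ c ∈ C, c ≠ x ∧ c ≠ y ∧ c ≠ z := by
  by_contra! hc
  have h1 : C ⊆ {x, y, z} := by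
    intro c hcC
    have := hc c hcC
    simp only [Finset.mem_insert, Finset.mem_singleton]
    tauto
  have h2 := (Finset.card_le_card h1).trans Finset.card_le_three
  have h3 := h.four_le_card
  omega

lemma ne_of_consec (h : FanAt K v Θ C u) {a b : ℝ} (hc : Consec C a b) : u a ≠ u b := by
  intro he
  obtain ⟨ha, hb, hab, hm⟩ := hc
  obtain ⟨c, hcC, h1, h2, -⟩ := h.exists_ne a b b
  have h3 := h.nonneg c hcC
  have h4 := h.le_top c hcC
  have h5 := h.nonneg a ha
  rcases h.eq_cases ha hb he with e | ⟨e, e'⟩ | ⟨e, e'⟩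
  · exact hab.ne e
  · rcases hm c hcC with h' | h'
    · exact h1 (by linarith)
    · exact h2 (by linarith)
  · linarith

open Classical in
-- A triangle determines its gap in `C`. The dangerous case is a match with the two ends
-- interchanged: then the two gaps would fill all of `[0, Θ]`, and `C` would have only three
-- elements.
lemma consec_unique (h : FanAt K v Θ C u) {a b a' b' : ℝ} (hc : Consec C a b)
    (hc' : Consec C a' b') (h1 : u a ∈ ({v, u a', u b'} : Finset (E d)))
    (h2 : u b ∈ ({v, u a', u b'} : Finset (E d))) : a = a' := by
  have hn := h.ne_of_consec hc
  obtain ⟨ha, hb, hab, hm⟩ := hc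
  obtain ⟨ha', hb', hab', hm'⟩ := hc'
  have na := h.nonneg a ha
  have lb := h.le_top b hb
  have na' := h.nonneg a' ha'
  have lb' := h.le_top b' hb'
  simp only [Finset.mem_insert, Finset.mem_singleton, h.ne_center a ha, h.ne_center b hb,
    false_or] at h1 h2
  rcases h1 with h1 | h1
  · rcases h.eq_cases ha ha' h1 with e | ⟨e, e'⟩ | ⟨e, e'⟩
    · exact e
    · linarith
    · linarith
  · rcases h2 with h2 | h2
    swap
    · exact absurd (h1.trans h2.symm) hn
    rcases h.eq_cases ha hb' h1 with e | ⟨e, e'⟩ | ⟨e, e'⟩ <;>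
      rcases h.eq_cases hb ha' h2 with f | ⟨f, f'⟩ | ⟨f, f'⟩
    · linarith
    · linarith
    · obtain ⟨c, hcC, c1, c2, c3⟩ := h.exists_ne 0 a Θ
      have g1 := h.nonneg c hcC
      have g2 := h.le_top c hcC
      rcases hm c hcC with g | g <;> rcases hm' c hcC with g' | g'
      · exact absurd (le_antisymm (by linarith) g1) c1
      · exact absurd (le_antisymm (by linarith) (by linarith)) c2
      · exact absurd (le_antisymm (by linarith) (by linarith)) c3
      · exact absurd (le_antisymm g2 (by linarith)) c3
    · obtain ⟨c, hcC, c1, c2, c3⟩ := h.exists_ne 0 b Θ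
      have g1 := h.nonneg c hcC
      have g2 := h.le_top c hcC
      rcases hm c hcC with g | g <;> rcases hm' c hcC with g' | g'
      · exact absurd (le_antisymm (by linarith) g1) c1
      · exact absurd (le_antisymm (by linarith) (by linarith)) c1
      · exact absurd (le_antisymm (by linarith) (by linarith)) c2
      · exact absurd (le_antisymm g2 (by linarith)) c3
    · linarith
    · linarith
    · linarith
    · linarith
    · linarith

open Classical in
lemma triangle_mem (h : FanAt K v Θ C u) {a b : ℝ} (hc : Consec C a b) :
    {v, u a, u b} ∈ K.faces :=
  (h.faces_iff _ (by simp)).2 ⟨a, b, hc, subset_rfl⟩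

lemma mem_vertices (h : FanAt K v Θ C u) : v ∈ K.vertices := by
  classical
  obtain ⟨c, hcC, h1, h2, -⟩ := h.exists_ne 0 Θ Θ
  obtain ⟨b, hb⟩ := exists_consec_of_lt hcC h.top_mem (lt_of_le_of_ne (h.le_top c hcC) h2)
  exact K.down_closed (h.triangle_mem hb) (by simp) (by simp)

lemma zero_lt_top (h : FanAt K v Θ C u) : 0 < Θ := by
  obtain ⟨c, hcC, h1, h2, -⟩ := h.exists_ne 0 Θ Θ
  exact (lt_of_le_of_ne (h.nonneg c hcC) h1.symm).trans_le (h.le_top c hcC)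

lemma exists_consec_mem (h : FanAt K v Θ C u) {t : ℝ} (ht : t ∈ C) :
    ∃ a b, Consec C a b ∧ (t = a ∨ t = b) := by
  rcases (h.le_top t ht).lt_or_eq with h1 | h1
  · obtain ⟨b, hb⟩ := exists_consec_of_lt ht h.top_mem h1
    exact ⟨t, b, hb, Or.inl rfl⟩
  · obtain ⟨a, ha⟩ := exists_consec_of_gt ht h.zero_mem (h1 ▸ h.zero_lt_top)
    exact ⟨a, t, ha, Or.inr rfl⟩

open Classical in
lemma edge_mem (h : FanAt K v Θ C u) {t : ℝ} (ht : t ∈ C) : {v, u t} ∈ K.faces := by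
  obtain ⟨a, b, hab, rfl | rfl⟩ := h.exists_consec_mem ht
  · exact K.down_closed (h.triangle_mem hab) (by simp [Finset.insert_subset_iff]) (by simp)
  · exact K.down_closed (h.triangle_mem hab) (by simp [Finset.insert_subset_iff]) (by simp)

end FanAt

lemma continuous_edgePoint {d : ℕ} (x y : E d) : Continuous (edgePoint x y) := by
  unfold edgePoint
  fun_prop

lemma edgePoint_wbtw {d : ℕ} (x y : E d) {μ : ℝ} (h0 : 0 ≤ μ) (h1 : μ ≤ 1) :
    Wbtw ℝ x (edgePoint x y μ) y := by
  refine ⟨μ, ⟨h0, h1⟩, ?_⟩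
  rw [AffineMap.lineMap_apply_module, edgePoint]

open Classical in
/-- Every angle between `0` and `∠ x v y` occurs at an interior point of the edge `{x, y}`. -/
lemma exists_edgePoint_angle {d : ℕ} {K : Cplx d} {v x y : E d} (hvx : x ≠ v) (hvy : y ≠ v)
    (hxy : x ≠ y) (hK : {v, x, y} ∈ K.faces) {θ : ℝ} (h0 : 0 < θ) (h1 : θ < ∠ x v y) :
    ∃ μ : ℝ, 0 < μ ∧ μ < 1 ∧ ∠ x v (edgePoint x y μ) = θ := by
  have hK' : {x, y} ∈ K.faces := K.down_closed hK (by simp) (by simp)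
  have e0 : edgePoint x y 0 = x := by simp [edgePoint]
  have e1 : edgePoint x y 1 = y := by simp [edgePoint]
  have hne : ∀ μ ∈ Icc (0 : ℝ) 1, edgePoint x y μ ≠ v := by
    rintro μ ⟨ha, hb⟩ he
    rcases ha.eq_or_lt with rfl | ha
    · exact hvx (e0 ▸ he)
    rcases hb.eq_or_lt with rfl | hb
    · exact hvy (e1 ▸ he)
    · exact edgePoint_notMem hxy hK' ha hb hK (by simp [he])
  have hc : ContinuousOn (fun μ => ∠ x v (edgePoint x y μ)) (Icc 0 1) := by
    intro μ hμ
    have h2 := EuclideanGeometry.continuousAt_angle (x := (x, v, edgePoint x y μ)) hvx (hne μ hμ)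
    refine ContinuousAt.continuousWithinAt ?_
    exact ContinuousAt.comp (f := fun μ => (x, v, edgePoint x y μ)) h2
      (by
        have := continuous_edgePoint x y
        fun_prop)
  have h2 := intermediate_value_Icc (zero_le_one' ℝ) hc
  simp only [e0, e1, EuclideanGeometry.angle_self_of_ne hvx] at h2
  obtain ⟨μ, ⟨ha, hb⟩, he⟩ := h2 ⟨h0.le, h1.le⟩
  simp only at he
  refine ⟨μ, lt_of_le_of_ne ha ?_, lt_of_le_of_ne hb ?_, he⟩
  · rintro rfl
    rw [e0, EuclideanGeometry.angle_self_of_ne hvx] at he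
    exact h0.ne he
  · rintro rfl
    rw [e1] at he
    exact h1.ne' he

namespace FanAt

variable {d : ℕ} {K : Cplx d} {v : E d} {Θ : ℝ} {C : Finset ℝ} {u : ℝ → E d}

/-- A fan can be subdivided by a ray at any prescribed angle. -/
lemma exists_insert (h : FanAt K v Θ C u) {t : ℝ} (ht : t ∉ C) (h0 : 0 < t) (h1 : t < Θ) :
    ∃ (J : Cplx d) (u' : ℝ → E d), IsSubdivision J K ∧ FanAt J v Θ (insert t C) u' := by
  classical
  obtain ⟨a, b, hab, hat, htb⟩ := exists_consec_between ht h.zero_mem h.top_mem h0 h1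
  have hT := h.triangle_mem hab
  have hxy := h.ne_of_consec hab
  have hxv := h.ne_center a hab.1
  have hyv := h.ne_center b hab.2.1
  have hang := h.angle_eq a b hab
  -- The new ray meets the opposite edge in the point seen from `v` at angle `t - a` from `u a`;
  -- additivity of angles leaves `b - t` on the other side.
  obtain ⟨μ, hμ0, hμ1, hμ⟩ := exists_edgePoint_angle hxv hyv hxy hT (θ := t - a) (by linarith)
    (by linarith)
  have hE : {u a, u b} ∈ K.faces := K.down_closed hT (by simp) (by simp)
  set q := edgePoint (u a) (u b) μ with hq
  have hqK : ∀ s ∈ K.faces, q ∉ s := fun s hs => edgePoint_notMem hxy hE hμ0 hμ1 hs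
  have hqv : q ≠ v := fun e => hqK _ hT (by simp [e])
  have hqC : ∀ s ∈ C, q ≠ u s := fun s hs e => hqK _ (h.edge_mem hs) (by simp [e])
  have hang2 : ∠ q v (u b) = b - t := by
    have := EuclideanGeometry.angle_add_of_ne_of_ne hxv.symm hyv.symm
      (edgePoint_wbtw (u a) (u b) hμ0.le hμ1.le)
    rw [hμ, hang] at this
    linarith
  have hu' : ∀ s ∈ C, Function.update u t q s = u s := fun s hs =>
    Function.update_of_ne (fun e : s = t => ht (e ▸ hs)) _ _
  have hut : Function.update u t q t = q := Function.update_self _ _ _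
  refine ⟨stellar K hxy hE hμ0 hμ1, Function.update u t q,
    isSubdivision_stellar hxy hE hμ0 hμ1, ?_⟩
  refine ⟨Finset.mem_insert_of_mem h.zero_mem, Finset.mem_insert_of_mem h.top_mem, ?_, ?_, ?_,
    ?_, ?_, ?_, ?_, ?_⟩
  · rintro s hs
    rcases Finset.mem_insert.1 hs with rfl | hs
    exacts [h0.le, h.nonneg s hs]
  · rintro s hs
    rcases Finset.mem_insert.1 hs with rfl | hs
    exacts [h1.le, h.le_top s hs]
  · exact h.four_le_card.trans (Finset.card_le_card (Finset.subset_insert _ _))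
  · rw [hu' 0 h.zero_mem, hu' Θ h.top_mem, h.closed]
  · intro s hs r hr hsΘ hrΘ he
    rcases Finset.mem_insert.1 hs with hst | hs <;> rcases Finset.mem_insert.1 hr with hrt | hr
    · rw [hst, hrt]
    · rw [hst, hut, hu' r hr] at he
      exact absurd he (hqC r hr)
    · rw [hrt, hut, hu' s hs] at he
      exact absurd he.symm (hqC s hs)
    · rw [hu' s hs, hu' r hr] at he
      exact h.inj s hs r hr hsΘ hrΘ he
  · intro s hs
    rcases Finset.mem_insert.1 hs with rfl | hs
    · rwa [hut]
    · rw [hu' s hs]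
      exact h.ne_center s hs
  · intro s hvs
    have hsplit : s ⊆ {v, u a, q} ∨ s ⊆ {v, q, u b} → ∃ a' b', Consec (insert t C) a' b' ∧
        s ⊆ {v, Function.update u t q a', Function.update u t q b'} := by
      rintro (h2 | h2)
      · refine ⟨a, t, (consec_insert_iff ht hab hat htb).2 (by simp), ?_⟩
        rwa [hut, hu' _ hab.1]
      · refine ⟨t, b, (consec_insert_iff ht hab hat htb).2 (by simp), ?_⟩
        rwa [hut, hu' _ hab.2.1]
    rw [mem_stellar, ← hq]
    constructor
    · rintro (⟨hs, hn⟩ | ⟨hqs, hn, hs⟩)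
      · obtain ⟨a', b', hab', hsub⟩ := (h.faces_iff s hvs).1 hs
        by_cases haa : a' = a
        · subst haa
          rw [← hab.right_unique hab'] at hsub
          exact hsplit (subset_split_of_subset hsub hn)
        · refine ⟨a', b', (consec_insert_iff ht hab hat htb).2 (Or.inl ⟨hab', haa⟩), ?_⟩
          rwa [hu' _ hab'.1, hu' _ hab'.2.1]
      · obtain ⟨a', b', hab', hsub⟩ := (h.faces_iff _ (Finset.mem_union_left _
          (Finset.mem_erase.2 ⟨hqv.symm, hvs⟩))).1 hs
        have haa := h.consec_unique hab hab' (hsub (by simp)) (hsub (by simp))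
        subst haa
        rw [← hab.right_unique hab'] at hsub
        exact hsplit (subset_split_of_erase hsub hn)
    · rintro ⟨a', b', hab', hsub⟩
      rcases (consec_insert_iff ht hab hat htb).1 hab' with ⟨hc, hne⟩ | hnew
      · rw [hu' _ hc.1, hu' _ hc.2.1] at hsub
        refine Or.inl ⟨(h.faces_iff s hvs).2 ⟨a', b', hc, hsub⟩, fun hs => hne ?_⟩
        exact (h.consec_unique hab hc (hsub (hs (by simp))) (hsub (hs (by simp)))).symm
      · have h2 : s ⊆ {v, u a, q} ∨ s ⊆ {v, q, u b} := by
          rcases hnew with ⟨rfl, rfl⟩ | ⟨rfl, rfl⟩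
          · rw [hut, hu' _ hab.1] at hsub
            exact Or.inl hsub
          · rw [hut, hu' _ hab.2.1] at hsub
            exact Or.inr hsub
        rcases split_cases (hqC a hab.1) (hqC b hab.2.1) hxv hyv hxy h2 with
          ⟨h3, h4⟩ | ⟨h3, h4, h5⟩
        · exact Or.inl ⟨K.down_closed hT h3 ⟨v, hvs⟩, h4⟩
        · exact Or.inr ⟨h3, h4, K.down_closed hT h5 (by simp)⟩
  · intro a' b' hab'
    rcases (consec_insert_iff ht hab hat htb).1 hab' with ⟨hc, -⟩ | ⟨rfl, rfl⟩ | ⟨rfl, rfl⟩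
    · rw [hu' _ hc.1, hu' _ hc.2.1]
      exact h.angle_eq a' b' hc
    · rw [hut, hu' _ hab.1, hμ]
    · rw [hut, hu' _ hab.2.1, hang2]

/-- A link vertex of a fan can be moved towards the center. -/
lemma exists_shrink (h : FanAt K v Θ C u) {t : ℝ} (ht : t ∈ C) {μ : ℝ} (hμ0 : 0 < μ)
    (hμ1 : μ < 1) : ∃ (J : Cplx d) (u' : ℝ → E d), IsSubdivision J K ∧ FanAt J v Θ C u' ∧
      ∀ s, u' s = if u s = u t then edgePoint v (u t) μ else u s := by
  classical
  have hvy : v ≠ u t := (h.ne_center t ht).symm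
  have hE := h.edge_mem ht
  set q := edgePoint v (u t) μ with hq
  have hqK : ∀ s ∈ K.faces, q ∉ s := fun s hs => edgePoint_notMem hvy hE hμ0 hμ1 hs
  have hqv : q ≠ v := fun e => hqK _ hE (by simp [e])
  have hqC : ∀ s ∈ C, q ≠ u s := fun s hs e => hqK _ (h.edge_mem hs) (by simp [e])
  have hqsub : q -ᵥ v = μ • (u t -ᵥ v) := by
    rw [hq, edgePoint]
    simp only [vsub_eq_sub]
    module
  -- The test compares points rather than angles, since `0` and `Θ` name the same vertex and must
  -- move together.
  refine ⟨stellar K hvy hE hμ0 hμ1, fun s => if u s = u t then q else u s,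
    isSubdivision_stellar hvy hE hμ0 hμ1, ?_, fun s => by congr⟩
  set u' : ℝ → E d := fun s => if u s = u t then q else u s with hu'
  have e1 : ∀ s, u s = u t → u' s = q := fun s hs => if_pos hs
  have e2 : ∀ s, u s ≠ u t → u' s = u s := fun s hs => if_neg hs
  -- Each new link vertex lies on the ray of the old one, so the angles at `v` do not change.
  have hray : ∀ s, ∃ c : ℝ, 0 < c ∧ u' s -ᵥ v = c • (u s -ᵥ v) := by
    intro s
    by_cases hs : u s = u t
    · exact ⟨μ, hμ0, by rw [e1 s hs, hqsub, hs]⟩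
    · exact ⟨1, one_pos, by rw [e2 s hs, one_smul]⟩
  refine ⟨h.zero_mem, h.top_mem, h.nonneg, h.le_top, h.four_le_card, ?_, ?_, ?_, ?_, ?_⟩
  · simp only [hu', h.closed]
  · intro s hs r hr hsΘ hrΘ he
    refine h.inj s hs r hr hsΘ hrΘ ?_
    by_cases g1 : u s = u t <;> by_cases g2 : u r = u t
    · rw [g1, g2]
    · rw [e1 s g1, e2 r g2] at he
      exact absurd he (hqC r hr)
    · rw [e2 s g1, e1 r g2] at he
      exact absurd he.symm (hqC s hs)
    · rwa [e2 s g1, e2 r g2] at he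
  · intro s hs
    by_cases g1 : u s = u t
    · rwa [e1 s g1]
    · rw [e2 s g1]
      exact h.ne_center s hs
  · intro s hvs
    rw [mem_stellar, ← hq]
    constructor
    · rintro (⟨hs, hn⟩ | ⟨hqs, hn, hs⟩)
      · obtain ⟨a, b, hab, hsub⟩ := (h.faces_iff s hvs).1 hs
        exact ⟨a, b, hab, subset_move_of_subset hvs hsub hn⟩
      · obtain ⟨a, b, hab, hsub⟩ := (h.faces_iff _ (Finset.mem_union_left _
          (Finset.mem_erase.2 ⟨hqv.symm, hvs⟩))).1 hs
        exact ⟨a, b, hab, subset_move_of_erase hvs hqv hn hvy hsub⟩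
    · rintro ⟨a, b, hab, hsub⟩
      have hT := h.triangle_mem hab
      rcases move_cases (hqC a hab.1) (hqC b hab.2.1) hqv (hqC t ht) hvy hsub with
        ⟨h3, h4⟩ | ⟨h3, h4, h5⟩
      · exact Or.inl ⟨K.down_closed hT h3 ⟨v, hvs⟩, h4⟩
      · exact Or.inr ⟨h3, h4, K.down_closed hT h5 (by simp)⟩
  · intro a b hab
    obtain ⟨c, hc, h1⟩ := hray a
    obtain ⟨e, he, h2⟩ := hray b
    rw [← h.angle_eq a b hab]
    unfold EuclideanGeometry.angle
    rw [h1, h2, InnerProductGeometry.angle_smul_left_of_pos _ _ hc,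
      InnerProductGeometry.angle_smul_right_of_pos _ _ he]

end FanAt

end AngleDefect


/-! ### Fans with equal total angle have isometric subdivisions. -/

namespace AngleDefect

open Set Filter Topology
open scoped EuclideanGeometry

namespace FanAt

variable {d : ℕ} {K : Cplx d} {v : E d} {Θ : ℝ} {C : Finset ℝ} {u : ℝ → E d}

/-- A fan can be subdivided by rays at finitely many prescribed angles. -/
lemma exists_refine (h : FanAt K v Θ C u) (D : Finset ℝ) (hD : ∀ t ∈ D, 0 ≤ t ∧ t ≤ Θ) :
    ∃ (J : Cplx d) (u' : ℝ → E d), IsSubdivision J K ∧ FanAt J v Θ (C ∪ D) u' := by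
  induction D using Finset.induction_on with
  | empty => exact ⟨K, u, .refl K, by simpa using h⟩
  | insert t D _ ih =>
    obtain ⟨J, u', hJ, hu'⟩ := ih fun s hs => hD s (Finset.mem_insert_of_mem hs)
    rw [Finset.union_insert]
    by_cases ht : t ∈ C ∪ D
    · rw [Finset.insert_eq_of_mem ht]
      exact ⟨J, u', hJ, hu'⟩
    · obtain ⟨h0, h1⟩ := hD t (Finset.mem_insert_self _ _)
      have h0' : 0 < t := lt_of_le_of_ne h0 fun e => ht (e ▸ hu'.zero_mem)
      have h1' : t < Θ := lt_of_le_of_ne h1 fun e => ht (e ▸ hu'.top_mem)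
      obtain ⟨J', u'', hJ', hu''⟩ := hu'.exists_insert ht h0' h1'
      exact ⟨J', u'', hJ'.trans hJ, hu''⟩

/-- The link vertices of a fan can be moved to the same distance from the center. -/
lemma exists_dist_eq (h : FanAt K v Θ C u) {ε : ℝ} (hε : 0 < ε)
    (hle : ∀ s ∈ C, ε ≤ dist (u s) v) :
    ∃ (J : Cplx d) (u' : ℝ → E d), IsSubdivision J K ∧ FanAt J v Θ C u' ∧
      ∀ s ∈ C, dist (u' s) v = ε := by
  have key : ∀ T : Finset ℝ, T ⊆ C → ∃ (J : Cplx d) (u' : ℝ → E d), IsSubdivision J K ∧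
      FanAt J v Θ C u' ∧ (∀ s ∈ C, ε ≤ dist (u' s) v) ∧ ∀ s ∈ T, dist (u' s) v = ε := by
    intro T
    induction T using Finset.induction_on with
    | empty => exact fun _ => ⟨K, u, .refl K, h, hle, by simp⟩
    | insert t T _ ih =>
      intro hT
      obtain ⟨J, u', hJ, hu', h1, h2⟩ := ih ((Finset.subset_insert _ _).trans hT)
      have ht : t ∈ C := hT (Finset.mem_insert_self _ _)
      -- A vertex already at distance `ε`, perhaps reached earlier under its other name, is left
      -- alone: a stellar subdivision needs a ratio strictly below `1`.
      rcases (h1 t ht).eq_or_lt with he | hlt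
      · refine ⟨J, u', hJ, hu', h1, fun s hs => ?_⟩
        rcases Finset.mem_insert.1 hs with rfl | hs
        exacts [he.symm, h2 s hs]
      · have hpos := hε.trans hlt
        obtain ⟨J', u'', hJ', hu'', heq⟩ := hu'.exists_shrink ht (μ := ε / dist (u' t) v)
          (div_pos hε hpos) ((div_lt_one hpos).2 hlt)
        have hd : dist (edgePoint v (u' t) (ε / dist (u' t) v)) v = ε := by
          have : edgePoint v (u' t) (ε / dist (u' t) v) - v = (ε / dist (u' t) v) • (u' t - v) := by
            rw [edgePoint]
            module
          rw [dist_eq_norm, this, norm_smul, ← dist_eq_norm, Real.norm_of_nonneg (by positivity),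
            div_mul_cancel₀ _ hpos.ne']
        have h3 : ∀ s, dist (u' s) v = ε ∨ s = t → dist (u'' s) v = ε := by
          intro s hs
          rw [heq]
          split_ifs with h4
          · exact hd
          · rcases hs with hs | rfl
            exacts [hs, absurd rfl h4]
        refine ⟨J', u'', hJ'.trans hJ, hu'', fun s hs => ?_, fun s hs => ?_⟩
        · rw [heq]
          split_ifs
          exacts [hd.ge, h1 s hs]
        · rcases Finset.mem_insert.1 hs with hs | hs
          exacts [h3 s (Or.inr hs), h3 s (Or.inl (h2 s hs))]
  obtain ⟨J, u', hJ, hu', -, h2⟩ := key C subset_rfl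
  exact ⟨J, u', hJ, hu', h2⟩

lemma exists_pos_le_dist (h : FanAt K v Θ C u) : ∃ ε, 0 < ε ∧ ∀ s ∈ C, ε ≤ dist (u s) v := by
  obtain ⟨t, ht, hm⟩ := C.exists_min_image (fun s => dist (u s) v) ⟨0, h.zero_mem⟩
  exact ⟨_, dist_pos.2 (h.ne_center t ht), hm⟩

open Classical in
lemma mem_star_faces (s : Finset (E d)) :
    s ∈ (K.star v).faces ↔ s.Nonempty ∧ insert v s ∈ K.faces :=
  ⟨fun hs => ⟨K.nonempty_of_mem_faces hs.1, hs.2⟩,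
    fun hs => ⟨K.down_closed hs.2 (Finset.subset_insert _ _) hs.1, hs.2⟩⟩

lemma mem_star_vertices (h : FanAt K v Θ C u) (x : E d) :
    x ∈ (K.star v).vertices ↔ x = v ∨ ∃ t ∈ C, x = u t := by
  classical
  rw [Geometry.SimplicialComplex.mem_vertices, mem_star_faces, h.faces_iff _ (by simp)]
  constructor
  · rintro ⟨-, a, b, hab, hs⟩
    have hx := hs (show x ∈ _ by simp)
    simp only [Finset.mem_insert, Finset.mem_singleton] at hx
    rcases hx with hx | hx | hx
    · exact Or.inl hx
    · exact Or.inr ⟨a, hab.1, hx⟩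
    · exact Or.inr ⟨b, hab.2.1, hx⟩
  · rintro (rfl | ⟨t, ht, rfl⟩)
    · refine ⟨by simp, ?_⟩
      obtain ⟨a, b, hab, -⟩ := h.exists_consec_mem h.zero_mem
      exact ⟨a, b, hab, by simp⟩
    · refine ⟨by simp, ?_⟩
      obtain ⟨a, b, hab, rfl | rfl⟩ := h.exists_consec_mem ht
      · exact ⟨t, b, hab, by simp [Finset.insert_subset_iff]⟩
      · exact ⟨a, t, hab, by simp [Finset.insert_subset_iff]⟩

lemma dist_sq_of_consec (h : FanAt K v Θ C u) {ε : ℝ} (hd : ∀ s ∈ C, dist (u s) v = ε)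
    {a b : ℝ} (hab : Consec C a b) :
    dist (u a) (u b) * dist (u a) (u b) = ε * ε + ε * ε - 2 * ε * ε * Real.cos (b - a) := by
  rw [EuclideanGeometry.law_cos (u a) v (u b), h.angle_eq a b hab, hd a hab.1, hd b hab.2.1]

/-- Two fans with the same angles and the same distances to the center are isometric. -/
lemma starsIsometric (h : FanAt K v Θ C u) {e : ℕ} {L : Cplx e} {w : E e} {u' : ℝ → E e}
    (h' : FanAt L w Θ C u') {ε : ℝ} (hd : ∀ s ∈ C, dist (u s) v = ε)
    (hd' : ∀ s ∈ C, dist (u' s) w = ε) : StarsIsometric K v L w := by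
  classical
  -- Link vertices are matched by their angle. The angle chosen is irrelevant, because `0` and `Θ`
  -- give one vertex in both fans; the default value serves the centre.
  set f : E d → E e := fun x => if hx : ∃ t ∈ C, x = u t then u' hx.choose else w with hf
  have hfv : f v = w := dif_neg fun ⟨t, ht, he⟩ => h.ne_center t ht he.symm
  have hfu : ∀ t ∈ C, f (u t) = u' t := by
    intro t ht
    have hx : ∃ s ∈ C, u t = u s := ⟨t, ht, rfl⟩
    have h1 : f (u t) = u' hx.choose := dif_pos hx
    rw [h1]
    obtain ⟨hs, he⟩ := hx.choose_spec
    rcases h.eq_cases ht hs he with h2 | ⟨h2, h3⟩ | ⟨h2, h3⟩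
    · rw [← h2]
    · rw [h3, h2, h'.closed]
    · rw [h3, h2, h'.closed]
  have hinj : InjOn f (K.star v).vertices := by
    intro x hx y hy hxy
    rw [h.mem_star_vertices] at hx hy
    rcases hx with rfl | ⟨s, hs, rfl⟩ <;> rcases hy with rfl | ⟨t, ht, rfl⟩
    · rfl
    · rw [hfv, hfu t ht] at hxy
      exact absurd hxy.symm (h'.ne_center t ht)
    · rw [hfv, hfu s hs] at hxy
      exact absurd hxy (h'.ne_center s hs)
    · rw [hfu s hs, hfu t ht] at hxy
      rcases h'.eq_cases hs ht hxy with h2 | ⟨h2, h3⟩ | ⟨h2, h3⟩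
      · rw [h2]
      · rw [h2, h3, h.closed]
      · rw [h2, h3, h.closed]
  refine ⟨f, ⟨⟨?_, hinj, ?_⟩, ?_⟩, hfv, ?_⟩
  · intro x hx
    rw [h.mem_star_vertices] at hx
    rw [h'.mem_star_vertices]
    rcases hx with rfl | ⟨t, ht, rfl⟩
    · exact Or.inl hfv
    · exact Or.inr ⟨t, ht, hfu t ht⟩
  · intro y hy
    rw [h'.mem_star_vertices] at hy
    rcases hy with rfl | ⟨t, ht, rfl⟩
    · exact ⟨v, (h.mem_star_vertices v).2 (Or.inl rfl), hfv⟩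
    · exact ⟨u t, (h.mem_star_vertices _).2 (Or.inr ⟨t, ht, rfl⟩), hfu t ht⟩
  · intro s hs
    rw [mem_star_faces, mem_star_faces, Finset.image_nonempty]
    refine and_congr_right fun _ => ?_
    rw [h.faces_iff _ (Finset.mem_insert_self _ _), h'.faces_iff _ (Finset.mem_insert_self _ _)]
    refine exists_congr fun a => exists_congr fun b => and_congr_right fun hab => ?_
    have himg : ({w, u' a, u' b} : Finset (E e)) = ({v, u a, u b} : Finset (E d)).image f := by
      rw [Finset.image_insert, Finset.image_insert, Finset.image_singleton, hfv, hfu a hab.1,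
        hfu b hab.2.1]
    have hins : insert w (s.image f) = (insert v s).image f := by
      rw [Finset.image_insert, hfv]
    have hV : ∀ x ∈ ({v, u a, u b} : Finset (E d)), x ∈ (K.star v).vertices := by
      intro x hx
      rw [h.mem_star_vertices]
      simp only [Finset.mem_insert, Finset.mem_singleton] at hx
      rcases hx with hx | hx | hx
      · exact Or.inl hx
      · exact Or.inr ⟨a, hab.1, hx⟩
      · exact Or.inr ⟨b, hab.2.1, hx⟩
    rw [himg, hins]
    refine ⟨fun hsub => Finset.image_subset_image hsub, fun hsub x hx => ?_⟩
    obtain ⟨y, hy, hyx⟩ := Finset.mem_image.1 (hsub (Finset.mem_image_of_mem f hx))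
    have hxV : x ∈ (K.star v).vertices := by
      rcases Finset.mem_insert.1 hx with rfl | hx
      · exact hV _ (by simp)
      · exact hs hx
    exact hinj (hV y hy) hxV hyx ▸ hy
  · intro x y hxy
    rw [mem_star_faces, h.faces_iff _ (Finset.mem_insert_self _ _)] at hxy
    obtain ⟨-, a, b, hab, hs⟩ := hxy
    have hx := hs (show x ∈ _ by simp)
    have hy := hs (show y ∈ _ by simp)
    have hda := hd a hab.1
    have hdb := hd b hab.2.1
    have hda' := hd' a hab.1
    have hdb' := hd' b hab.2.1
    -- Both triangles have two sides `ε` with the same included angle.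
    have hab2 : dist (u' a) (u' b) = dist (u a) (u b) := by
      have h1 := h.dist_sq_of_consec hd hab
      have h2 := h'.dist_sq_of_consec hd' hab
      rw [← h1] at h2
      exact (mul_self_inj dist_nonneg dist_nonneg).1 h2
    simp only [Finset.mem_insert, Finset.mem_singleton] at hx hy
    rcases hx with hx | hx | hx <;> rcases hy with hy | hy | hy <;> rw [hx, hy] <;>
      simp only [hfv, hfu a hab.1, hfu b hab.2.1, dist_self, hda, hdb, hda', hdb', hab2,
        dist_comm v (u a), dist_comm v (u b), dist_comm w (u' a), dist_comm w (u' b),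
        dist_comm (u b) (u a), dist_comm (u' b) (u' a)]

end FanAt

/-- The value of `φ` at a vertex depends only on the total angle. -/
theorem eq_of_fans {𝒮 : CplxSet} {φ : VertexFun} (hsub : SubdivisionClosed 𝒮)
    (h1 : InvariantUnderStarIsometry 𝒮 φ) (h2 : InvariantUnderSubdivision 𝒮 φ) {d e : ℕ}
    {K : Cplx d} (hK : K ∈ 𝒮 d) {L : Cplx e} (hL : L ∈ 𝒮 e) {v : E d} {w : E e} {Θ : ℝ}
    {C D : Finset ℝ} {u : ℝ → E d} {u' : ℝ → E e} (h : FanAt K v Θ C u)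
    (h' : FanAt L w Θ D u') : φ K v = φ L w := by
  -- Both fans are cut at the union of the two sets of angles, then brought to a common radius.
  -- Invariance under subdivision carries `φ` along.
  obtain ⟨J₁, u₁, hJ₁, hu₁⟩ := h.exists_refine D fun t ht => ⟨h'.nonneg t ht, h'.le_top t ht⟩
  obtain ⟨M₁, w₁, hM₁, hw₁⟩ := h'.exists_refine C fun t ht => ⟨h.nonneg t ht, h.le_top t ht⟩
  rw [Finset.union_comm] at hw₁
  obtain ⟨ε₁, hε₁, hle₁⟩ := hu₁.exists_pos_le_dist
  obtain ⟨ε₂, hε₂, hle₂⟩ := hw₁.exists_pos_le_dist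
  obtain ⟨J, u₂, hJ, hu₂, hd₁⟩ := hu₁.exists_dist_eq (lt_min hε₁ hε₂)
    fun s hs => (min_le_left _ _).trans (hle₁ s hs)
  obtain ⟨M, w₂, hM, hw₂, hd₂⟩ := hw₁.exists_dist_eq (lt_min hε₁ hε₂)
    fun s hs => (min_le_right _ _).trans (hle₂ s hs)
  have hJS := hJ.trans hJ₁
  have hMS := hM.trans hM₁
  rw [h2 K hK J (hsub K hK J hJS) hJS v h.mem_vertices,
    h2 L hL M (hsub L hL M hMS) hMS w h'.mem_vertices]
  exact h1 J (hsub K hK J hJS) M (hsub L hL M hMS) v hu₂.mem_vertices w hw₂.mem_vertices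
    (hu₂.starsIsometric hw₂ hd₁ hd₂)

end AngleDefect


/-! ### The local structure of simplicial surfaces. -/

namespace AngleDefect

open Set Filter Topology
open scoped EuclideanGeometry

/-- Invariance of domain for a surface given as a subset of Euclidean space. The map is corestricted
to `X`, with an irrelevant default value outside `U`. -/
lemma mapsTo_image_mem_nhdsWithin {d : ℕ} {X : Set (E d)} [ChartedSpace (E 2) X] {U : Set (E 2)}
    {m : E 2 → E d} {x : E 2} (hU : IsOpen U) (hx : x ∈ U) (hm : ContinuousOn m U)
    (hi : InjOn m U) (hX : MapsTo m U X) : m '' U ∈ 𝓝[X] (m x) := by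
  classical
  set f : E 2 → X := fun z => if h : m z ∈ X then ⟨m z, h⟩ else ⟨m x, hX hx⟩ with hf
  have hfm : ∀ z ∈ U, (f z : E d) = m z := fun z hz => by simp [hf, hX hz]
  have h1 : ContinuousOn f U := by
    rw [Topology.IsInducing.subtypeVal.continuousOn_iff]
    exact hm.congr hfm
  have h2 : InjOn f U := fun a ha b hb hab => hi ha hb (by rw [← hfm a ha, ← hfm b hb, hab])
  have h3 := image_mem_nhds_of_charted hU hx h1 h2
  rw [← hfm x hx, ← map_nhds_subtype_val (f x)]
  refine mem_map.2 (mem_of_superset h3 ?_)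
  rintro _ ⟨z, hz, rfl⟩
  exact ⟨z, hz, (hfm z hz).symm⟩

lemma image_inter_mem_nhds {d : ℕ} {X : Set (E d)} [ChartedSpace (E 2) X] {N : Set (E d)}
    {π : E d → E 2} {x : E d} (hx : x ∈ X) (hN : N ∈ 𝓝[X] x) (hπ : Continuous π)
    (hi : InjOn π (N ∩ X)) : π '' (N ∩ X) ∈ 𝓝 (π x) := by
  have h1 : (Subtype.val ⁻¹' N : Set X) ∈ 𝓝 (⟨x, hx⟩ : X) := by
    rw [nhds_subtype_eq_comap_nhdsWithin]
    exact preimage_mem_comap hN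
  have h2 := image_mem_nhds_to_plane (f := fun z : X => π z) h1
    (hπ.comp continuous_subtype_val).continuousOn
    (fun a ha b hb hab => Subtype.ext (hi ⟨ha, a.2⟩ ⟨hb, b.2⟩ hab))
  refine mem_of_superset h2 ?_
  rintro _ ⟨z, hz, rfl⟩
  exact ⟨z, ⟨hz, z.2⟩, rfl⟩

lemma pos_of_mem_nhds_of_nonneg {S : Set (E 2)} {q : E 2} (hS : S ∈ 𝓝 q)
    (h : ∀ z ∈ S, 0 ≤ z 1) : 0 < q 1 := by
  have hc : Tendsto (fun t : ℝ => q + t • (EuclideanSpace.single 1 1 : E 2)) (𝓝[<] 0) (𝓝 q) := by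
    have : Tendsto (fun t : ℝ => q + t • (EuclideanSpace.single 1 1 : E 2)) (𝓝 0)
        (𝓝 (q + (0 : ℝ) • (EuclideanSpace.single 1 1 : E 2))) := by
      refine Continuous.tendsto ?_ 0
      fun_prop
    rw [zero_smul, add_zero] at this
    exact this.mono_left nhdsWithin_le_nhds
  obtain ⟨t, ht, ht0⟩ := ((hc.eventually hS).and self_mem_nhdsWithin).exists
  have := h _ ht
  simp at this
  have ht0' : t < 0 := ht0
  linarith

lemma convexHull_face_closed {d : ℕ} (s : Finset (E d)) : IsClosed (convexHull ℝ (s : Set (E d))) :=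
  (s.finite_toSet.isCompact_convexHull (𝕜 := ℝ)).isClosed

/-- Near a point, only the simplices that contain the point matter. -/
lemma Cplx.eventually_mem_imp {d : ℕ} (K : Cplx d) (p : E d) :
    ∀ᶠ z in 𝓝 p, ∀ s ∈ K.faces, z ∈ convexHull ℝ (s : Set (E d)) →
      p ∈ convexHull ℝ (s : Set (E d)) := by
  rw [K.finite_faces.eventually_all]
  intro s _
  by_cases hp : p ∈ convexHull ℝ (s : Set (E d))
  · exact Eventually.of_forall fun _ _ => hp
  · filter_upwards [(convexHull_face_closed s).isOpen_compl.mem_nhds hp] with z hz hz'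
    exact absurd hz' hz

lemma Cplx.subset_of_mem_convexHull {d : ℕ} (K : Cplx d) {w : E d →₀ ℝ} (hw : IsWeight w)
    {τ s : Finset (E d)} (hτ : τ ∈ K.faces) (hwτ : w.support = τ) (hs : s ∈ K.faces)
    (h : bary w ∈ convexHull ℝ (s : Set (E d))) : τ ⊆ s := by
  obtain ⟨w', hw', hws, hb⟩ := mem_convexHull_iff_weight.1 h
  have := K.weight_unique hw hw' hτ hs hwτ.le hws hb.symm
  rw [← hwτ, this]
  exact hws

/-- A surface is nowhere contained in a simplex near a point that the map `π` sends to the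
boundary of the half-plane. -/
lemma not_eventually_mem_of_half {d : ℕ} {K : Cplx d} (hK : IsSimplicialSurface K) {p : E d}
    (hp : p ∈ K.space) {σ : Set (E d)} {π : E d → E 2} (hπ : Continuous π) (hi : InjOn π σ)
    (hn : ∀ z ∈ σ, 0 ≤ π z 1) (h0 : π p 1 = 0) : ¬ ∀ᶠ z in 𝓝[K.space] p, z ∈ σ := by
  intro h
  obtain ⟨-, ⟨hch⟩⟩ := hK
  -- By invariance of domain, the image would be a neighbourhood of a boundary point of the
  -- half-plane, yet contained in the half-plane.
  have h1 := image_inter_mem_nhds hp h hπ (hi.mono inter_subset_left)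
  have h2 := pos_of_mem_nhds_of_nonneg h1 (by
    rintro _ ⟨z, hz, rfl⟩
    exact hn z hz.1)
  exact h2.ne' h0

open Classical in
lemma not_eventually_mem_vertex {d : ℕ} {K : Cplx d} (hK : IsSimplicialSurface K) {v : E d}
    (hv : v ∈ K.vertices) :
    ¬ ∀ᶠ z in 𝓝[K.space] v, z ∈ convexHull ℝ (({v} : Finset (E d)) : Set (E d)) := by
  refine not_eventually_mem_of_half hK ?_ (π := fun _ => 0) continuous_const ?_ (by simp) (by simp)
  · exact K.toSimplicialComplex.subset_space hv (by simp)
  · intro a ha b hb _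
    simp only [Finset.coe_singleton, convexHull_singleton, mem_singleton_iff] at ha hb
    rw [ha, hb]

open Classical in
-- The inner product with the direction of the edge maps the edge injectively into the boundary line
-- of the half-plane.
lemma not_eventually_mem_edge {d : ℕ} {K : Cplx d} (hK : IsSimplicialSurface K) {v b p : E d}
    (hvb : v ≠ b) (hp : p ∈ K.space) :
    ¬ ∀ᶠ z in 𝓝[K.space] p, z ∈ convexHull ℝ (({v, b} : Finset (E d)) : Set (E d)) := by
  refine not_eventually_mem_of_half hK hp
    (π := fun z => EuclideanSpace.single 0 (inner ℝ (z - v) (b - v))) ?_ ?_ (by simp) (by simp)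
  · have : Continuous fun z : E d => (inner ℝ (z - v) (b - v) : ℝ) := by fun_prop
    refine (PiLp.continuous_toLp 2 _).comp (continuous_pi fun i => ?_)
    fin_cases i
    · simpa using this
    · simpa using continuous_const
  · have hmem : ∀ z ∈ convexHull ℝ (({v, b} : Finset (E d)) : Set (E d)),
        ∃ s : ℝ, z - v = s • (b - v) := by
      intro z hz
      rw [Finset.coe_pair, convexHull_pair, segment_eq_image'] at hz
      obtain ⟨s, -, rfl⟩ := hz
      exact ⟨s, by simp⟩
    have hbv : (0 : ℝ) < inner ℝ (b - v) (b - v) :=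
      real_inner_self_pos.2 (sub_ne_zero.2 hvb.symm)
    intro z hz z' hz' h
    obtain ⟨s, hs⟩ := hmem z hz
    obtain ⟨s', hs'⟩ := hmem z' hz'
    have h1 := congrArg (fun q : E 2 => q 0) h
    simp only [PiLp.single_apply, if_true] at h1
    rw [hs, hs', inner_smul_left, inner_smul_left] at h1
    have h2 : s = s' := mul_right_cancel₀ hbv.ne' (by simpa using h1)
    rw [← sub_left_inj (a := v), hs, hs', h2]

open Classical in
-- Coordinates with respect to `b - v` and `c - v`, extended to the whole space by a left inverse,
-- put the triangle into the half-plane with the edge `{v, b}` on its boundary.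
lemma not_eventually_mem_triangle {d : ℕ} {K : Cplx d} (hK : IsSimplicialSurface K)
    {v b c p : E d} (hvb : v ≠ b) (hvc : v ≠ c) (hbc : b ≠ c) (hT : {v, b, c} ∈ K.faces)
    (hp : p ∈ K.space) (hp' : p ∈ convexHull ℝ (({v, b} : Finset (E d)) : Set (E d))) :
    ¬ ∀ᶠ z in 𝓝[K.space] p, z ∈ convexHull ℝ (({v, b, c} : Finset (E d)) : Set (E d)) := by
  let m : E 2 →ₗ[ℝ] E d :=
    { toFun := fun q => q 0 • (b - v) + q 1 • (c - v)
      map_add' := fun x y => by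
        simp only [PiLp.add_apply]
        module
      map_smul' := fun a x => by
        simp only [PiLp.smul_apply, smul_eq_mul, RingHom.id_apply]
        module }
  have hinj : LinearMap.ker m = ⊥ := by
    rw [LinearMap.ker_eq_bot']
    intro q hq
    have hq' : q 0 • (b - v) + q 1 • (c - v) = 0 := hq
    have h1 := eq_of_affineIndependent (K.indep hT) (w := Finsupp.single v (-(q 0) - q 1) +
        Finsupp.single b (q 0) + Finsupp.single c (q 1)) (w' := 0)
      (by
        refine Finsupp.support_add.trans (Finset.union_subset (Finsupp.support_add.trans
          (Finset.union_subset ?_ ?_)) ?_) <;>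
          refine Finsupp.support_single_subset.trans ?_ <;> simp)
      (by simp) (by
        simp only [map_add, total_single, map_zero]
        ring) (by
        simp only [map_add, bary_single, map_zero]
        rw [← hq']
        module)
    have h2 := DFunLike.congr_fun h1 b
    have h3 := DFunLike.congr_fun h1 c
    simp [hvb.symm, hbc] at h2
    simp [hvc.symm, hbc.symm] at h3
    ext i
    fin_cases i
    · simpa using h2
    · simpa using h3
  obtain ⟨g, hg⟩ := LinearMap.exists_leftInverse_of_injective m hinj
  have hgm : ∀ s t : ℝ, g (s • (b - v) + t • (c - v)) = !₂[s, t] := fun s t => by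
    have := LinearMap.congr_fun hg !₂[s, t]
    simpa [m] using this
  have hmem : ∀ z ∈ convexHull ℝ (({v, b, c} : Finset (E d)) : Set (E d)),
      ∃ s t : ℝ, 0 ≤ t ∧ z - v = s • (b - v) + t • (c - v) := by
    intro z hz
    obtain ⟨w, hw, hws, rfl⟩ := mem_convexHull_iff_weight.1 hz
    refine ⟨w b, w c, hw.nonneg c, ?_⟩
    have h1 := hw.total_eq_one
    rw [total_eq_sum hws, Finset.sum_insert (by simp [hvb, hvc]), Finset.sum_pair hbc] at h1
    rw [bary_eq_sum hws, Finset.sum_insert (by simp [hvb, hvc]), Finset.sum_pair hbc]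
    have h2 : w v = 1 - w b - w c := by linarith
    rw [h2]
    module
  refine not_eventually_mem_of_half hK hp (π := fun z => g (z - v)) ?_ ?_ ?_ ?_
  · exact (LinearMap.continuous_of_finiteDimensional g).comp (by fun_prop)
  · intro z hz z' hz' h
    obtain ⟨s, t, -, hs⟩ := hmem z hz
    obtain ⟨s', t', -, hs'⟩ := hmem z' hz'
    simp only [hs, hs', hgm] at h
    have h0 := congrArg (fun q : E 2 => q 0) h
    have h1 := congrArg (fun q : E 2 => q 1) h
    simp only [Matrix.cons_val_zero, Matrix.cons_val_one] at h0 h1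
    rw [← sub_left_inj (a := v), hs, hs', h0, h1]
  · intro z hz
    obtain ⟨s, t, ht, hs⟩ := hmem z hz
    simp only [hs, hgm]
    simpa using ht
  · rw [Finset.coe_pair, convexHull_pair, segment_eq_image'] at hp'
    obtain ⟨s, -, rfl⟩ := hp'
    have := hgm s 0
    simp only [zero_smul, add_zero] at this
    simp [this]

open Classical in
/-- No three triangles of a surface share an edge. -/
lemma not_three_triangles {d : ℕ} {K : Cplx d} (hK : IsSimplicialSurface K) {v b : E d}
    {c₁ c₂ c₃ : E d} (hvb : v ≠ b) (h1 : {v, b, c₁} ∈ K.faces) (h2 : {v, b, c₂} ∈ K.faces)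
    (h3 : {v, b, c₃} ∈ K.faces) (hc1 : c₁ ≠ v ∧ c₁ ≠ b) (hc2 : c₂ ≠ v ∧ c₂ ≠ b)
    (hc3 : c₃ ≠ v ∧ c₃ ≠ b) (h12 : c₁ ≠ c₂) (h13 : c₁ ≠ c₃) (h23 : c₂ ≠ c₃) : False := by
  obtain ⟨-, ⟨hch⟩⟩ := hK
  -- The midpoint of the edge, shifted by `s` along the edge and by `t₁`, `t₂`, `t₃` towards the
  -- third vertices.
  let W : ℝ → ℝ → ℝ → ℝ → (E d →₀ ℝ) := fun s t₁ t₂ t₃ =>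
    Finsupp.single v (1 / 2 - s - (t₁ + t₂ + t₃) / 2) +
    Finsupp.single b (1 / 2 + s - (t₁ + t₂ + t₃) / 2) + Finsupp.single c₁ t₁ +
    Finsupp.single c₂ t₂ + Finsupp.single c₃ t₃
  have Wv : ∀ s t₁ t₂ t₃, W s t₁ t₂ t₃ v = 1 / 2 - s - (t₁ + t₂ + t₃) / 2 := fun s t₁ t₂ t₃ => by
    simp [W, hvb, hc1.1.symm, hc2.1.symm, hc3.1.symm]
  have W1 : ∀ s t₁ t₂ t₃, W s t₁ t₂ t₃ c₁ = t₁ := fun s t₁ t₂ t₃ => by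
    simp [W, hc1.1, hc1.2, h12, h13]
  have W2 : ∀ s t₁ t₂ t₃, W s t₁ t₂ t₃ c₂ = t₂ := fun s t₁ t₂ t₃ => by
    simp [W, hc2.1, hc2.2, h12.symm, h23]
  have W3 : ∀ s t₁ t₂ t₃, W s t₁ t₂ t₃ c₃ = t₃ := fun s t₁ t₂ t₃ => by
    simp [W, hc3.1, hc3.2, h13.symm, h23.symm]
  have hW : ∀ s t₁ t₂ t₃ : ℝ, |s| ≤ 1 / 4 → t₁ + t₂ + t₃ ≤ 1 / 4 → 0 ≤ t₁ → 0 ≤ t₂ → 0 ≤ t₃ →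
      IsWeight (W s t₁ t₂ t₃) := by
    intro s t₁ t₂ t₃ hs ht a1 a2 a3
    rw [abs_le] at hs
    refine ⟨fun z => ?_, ?_⟩
    · have e1 : 0 ≤ 1 / 2 - s - (t₁ + t₂ + t₃) / 2 := by linarith
      have e2 : 0 ≤ 1 / 2 + s - (t₁ + t₂ + t₃) / 2 := by linarith
      have hsing : ∀ (x : E d) (r : ℝ), 0 ≤ r → 0 ≤ Finsupp.single x r z := by
        intro x r hr
        rw [Finsupp.single_apply]
        split_ifs
        exacts [hr, le_rfl]
      simp only [W, Finsupp.add_apply]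
      have := hsing v _ e1
      have := hsing b _ e2
      have := hsing c₁ _ a1
      have := hsing c₂ _ a2
      have := hsing c₃ _ a3
      positivity
    · simp only [W, map_add, total_single]
      ring
  have hsupp : ∀ s t₁ t₂ t₃, (W s t₁ t₂ t₃).support ⊆
      {v, b} ∪ (if t₁ = 0 then ∅ else {c₁}) ∪ (if t₂ = 0 then ∅ else {c₂}) ∪
        (if t₃ = 0 then ∅ else {c₃}) := by
    intro s t₁ t₂ t₃
    have hz : ∀ (x : E d) (t : ℝ), (Finsupp.single x t).support ⊆ if t = 0 then ∅ else {x} := by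
      intro x t
      split_ifs with h
      · simp [h]
      · exact Finsupp.support_single_subset
    refine Finsupp.support_add.trans (Finset.union_subset_union ?_ (hz _ _))
    refine Finsupp.support_add.trans (Finset.union_subset_union ?_ (hz _ _))
    refine Finsupp.support_add.trans (Finset.union_subset_union ?_ (hz _ _))
    refine Finsupp.support_add.trans (Finset.union_subset ?_ ?_) <;>
      refine Finsupp.support_single_subset.trans ?_ <;> simp
  have hface1 : ∀ s t, (W s t 0 0).support ⊆ {v, b, c₁} := fun s t =>
    (hsupp s t 0 0).trans (by
      simp only [if_true, Finset.union_empty]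
      split_ifs <;> simp [Finset.insert_subset_iff])
  have hface2 : ∀ s t, (W s 0 t 0).support ⊆ {v, b, c₂} := fun s t =>
    (hsupp s 0 t 0).trans (by
      simp only [if_true, Finset.union_empty]
      split_ifs <;> simp [Finset.insert_subset_iff])
  have hface3 : ∀ s t, (W s 0 0 t).support ⊆ {v, b, c₃} := fun s t =>
    (hsupp s 0 0 t).trans (by
      simp only [if_true, Finset.union_empty]
      split_ifs <;> simp [Finset.insert_subset_iff])
  have hbary : ∀ s t₁ t₂ t₃, bary (W s t₁ t₂ t₃) = (1 / 2 - s - (t₁ + t₂ + t₃) / 2) • v +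
      (1 / 2 + s - (t₁ + t₂ + t₃) / 2) • b + t₁ • c₁ + t₂ • c₂ + t₃ • c₃ := by
    intro s t₁ t₂ t₃
    simp only [W, map_add, bary_single]
  -- An open square is bent along the edge: positive second coordinates go into the first triangle,
  -- negative ones into the second.
  let V : E 2 → (E d →₀ ℝ) := fun q => W (q 0) (max (q 1) 0) (max (-(q 1)) 0) 0
  let U : Set (E 2) := {q | |q 0| < 1 / 4 ∧ |q 1| < 1 / 4}
  have hUo : IsOpen U := by
    have h0 : Continuous fun q : E 2 => |q 0| := by fun_prop
    have h1 : Continuous fun q : E 2 => |q 1| := by fun_prop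
    exact (isOpen_lt h0 continuous_const).inter (isOpen_lt h1 continuous_const)
  have hVw : ∀ q ∈ U, IsWeight (V q) := by
    rintro q ⟨a1, a2⟩
    rw [abs_lt] at a2
    refine hW _ _ _ _ a1.le ?_ (le_max_right _ _) (le_max_right _ _) le_rfl
    rcases le_total (q 1) 0 with h | h
    · rw [max_eq_right h, max_eq_left (by linarith)]
      linarith
    · rw [max_eq_left h, max_eq_right (by linarith)]
      linarith
  have hVf : ∀ q, ∃ σ ∈ K.faces, (V q).support ⊆ σ := by
    intro q
    rcases le_total (q 1) 0 with h | h
    · refine ⟨_, h2, ?_⟩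
      simp only [V]
      rw [max_eq_right h]
      exact hface2 _ _
    · refine ⟨_, h1, ?_⟩
      simp only [V]
      rw [max_eq_right (show -(q 1) ≤ 0 by linarith)]
      exact hface1 _ _
  have hx : (0 : E 2) ∈ U := by simp [U]
  -- By invariance of domain the first two triangles fill a neighbourhood of the midpoint in the
  -- surface. It contains points of the third triangle close to the midpoint, whose weight at `c₃`
  -- is positive.
  have hnh := mapsTo_image_mem_nhdsWithin (X := K.space) (m := fun q => bary (V q)) hUo hx
    (by
      simp only [V, hbary]
      fun_prop)
    (by
      intro q hq q' hq' he
      obtain ⟨σ, hσ, hs⟩ := hVf q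
      obtain ⟨σ', hσ', hs'⟩ := hVf q'
      have heq := K.weight_unique (hVw q hq) (hVw q' hq') hσ hσ' hs hs' he
      have e1 := DFunLike.congr_fun heq c₁
      have e2 := DFunLike.congr_fun heq c₂
      have e3 := DFunLike.congr_fun heq v
      simp only [V, W1, W2, Wv] at e1 e2 e3
      have e4 : q 1 = q' 1 := by
        have g : ∀ r : ℝ, r = max r 0 - max (-r) 0 := fun r => by
          rcases le_total r 0 with h | h
          · rw [max_eq_right h, max_eq_left (by linarith)]
            ring
          · rw [max_eq_left h, max_eq_right (by linarith)]
            ring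
        rw [g (q 1), g (q' 1), e1, e2]
      rw [e4] at e3
      ext i
      fin_cases i
      · simp only [Fin.zero_eta]
        linarith
      · exact e4)
    (by
      intro q hq
      obtain ⟨σ, hσ, hs⟩ := hVf q
      exact K.toSimplicialComplex.convexHull_subset_space hσ
        (mem_convexHull_iff_weight.2 ⟨V q, hVw q hq, hs, rfl⟩))
  have hV0 : bary (V 0) = bary (W 0 0 0 0) := by simp [V]
  simp only [hV0] at hnh
  have hmem3 : ∀ t : ℝ, 0 ≤ t → t ≤ 1 / 4 → bary (W 0 0 0 t) ∈ K.space := fun t ht ht' =>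
    K.toSimplicialComplex.convexHull_subset_space h3 (mem_convexHull_iff_weight.2
      ⟨_, hW 0 0 0 t (by norm_num) (by linarith) le_rfl le_rfl ht, hface3 _ _, rfl⟩)
  have htend : Tendsto (fun t : ℝ => bary (W 0 0 0 t)) (𝓝[>] 0)
      (𝓝[K.space] (bary (W 0 0 0 0))) := by
    refine tendsto_nhdsWithin_iff.2 ⟨?_, ?_⟩
    · have : Continuous (fun t : ℝ => bary (W 0 0 0 t)) := by
        simp only [hbary]
        fun_prop
      exact (this.tendsto 0).mono_left nhdsWithin_le_nhds
    · filter_upwards [Ioc_mem_nhdsGT (show (0 : ℝ) < 1 / 4 by norm_num)] with t ht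
      exact hmem3 t ht.1.le ht.2
  obtain ⟨t, ht, ht'⟩ := ((htend.eventually hnh).and
    (Ioc_mem_nhdsGT (show (0 : ℝ) < 1 / 4 by norm_num))).exists
  obtain ⟨q, hq, hqe⟩ := ht
  obtain ⟨σ, hσ, hs⟩ := hVf q
  have heq := K.weight_unique (hVw q hq)
    (hW 0 0 0 t (by norm_num) (by linarith [ht'.2]) le_rfl le_rfl ht'.1.le) hσ h3 hs
    (hface3 _ _) hqe
  have := DFunLike.congr_fun heq c₃
  simp only [V, W3] at this
  exact ht'.1.ne this

end AngleDefect


/-! ### Edges and links in a simplicial surface. -/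

namespace AngleDefect

open Set Filter Topology
open scoped EuclideanGeometry

open Classical in
-- Near a relatively interior point of `τ`, every simplex that is met contains that point and hence
-- all of `τ`.
lemma eventually_mem_of_faces_subset {d : ℕ} {K : Cplx d} {w : E d →₀ ℝ} (hw : IsWeight w)
    {τ σ : Finset (E d)} (hτ : τ ∈ K.faces) (hwτ : w.support = τ)
    (h : ∀ s ∈ K.faces, τ ⊆ s → s ⊆ σ) :
    ∀ᶠ z in 𝓝[K.space] (bary w), z ∈ convexHull ℝ (σ : Set (E d)) := by
  filter_upwards [mem_nhdsWithin_of_mem_nhds (K.eventually_mem_imp (bary w)),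
    self_mem_nhdsWithin] with z hz hzK
  obtain ⟨s, hs, hzs⟩ := Geometry.SimplicialComplex.mem_space_iff.1 hzK
  have h1 := K.subset_of_mem_convexHull hw hτ hwτ hs (hz s hs hzs)
  exact convexHull_mono (Finset.coe_subset.2 (h s hs h1)) hzs

lemma isWeight_single {d : ℕ} (v : E d) : IsWeight (Finsupp.single v 1) := by
  classical
  refine ⟨fun z => ?_, by simp⟩
  rw [Finsupp.single_apply]
  split_ifs <;> norm_num

open Classical in
/-- Every vertex of a surface is a vertex of an edge. -/
lemma exists_edge {d : ℕ} {K : Cplx d} (hK : IsSimplicialSurface K) {v : E d}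
    (hv : v ∈ K.vertices) : ∃ b, b ≠ v ∧ {v, b} ∈ K.faces := by
  by_contra! h
  have h1 := eventually_mem_of_faces_subset (isWeight_single v) (σ := {v}) hv
    (Finsupp.support_single _ one_ne_zero) (fun s hs hvs x hx => by
      rw [Finset.mem_singleton]
      by_contra hxv
      refine h x hxv (K.down_closed hs ?_ (by simp))
      rw [Finset.insert_subset_iff, Finset.singleton_subset_iff]
      exact ⟨hvs (by simp), hx⟩)
  rw [bary_single, one_smul] at h1
  exact not_eventually_mem_vertex hK hv h1

open Classical in
/-- Every edge of a surface lies in exactly two triangles. -/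
lemma exists_two_triangles {d : ℕ} {K : Cplx d} (hK : IsSimplicialSurface K) {v b : E d}
    (hvb : v ≠ b) (hE : {v, b} ∈ K.faces) :
    ∃ c₁ c₂, c₁ ≠ c₂ ∧ (c₁ ≠ v ∧ c₁ ≠ b ∧ {v, b, c₁} ∈ K.faces) ∧
      (c₂ ≠ v ∧ c₂ ≠ b ∧ {v, b, c₂} ∈ K.faces) ∧
      ∀ c, c ≠ v → c ≠ b → {v, b, c} ∈ K.faces → c = c₁ ∨ c = c₂ := by
  -- The surface is tested at the midpoint of the edge: with no triangle it would be locally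
  -- contained in a segment, with one triangle locally in a half-plane.
  have hw : IsWeight (edgeWeight v b (1 / 2)) :=
    ⟨edgeWeight_nonneg (by norm_num) (by norm_num), total_edgeWeight⟩
  have hsupp : (edgeWeight v b (1 / 2)).support = {v, b} := by
    refine edgeWeight_support.antisymm ?_
    rw [Finset.insert_subset_iff, Finset.singleton_subset_iff, Finsupp.mem_support_iff,
      Finsupp.mem_support_iff, edgeWeight_left hvb, edgeWeight_right hvb]
    norm_num
  have hpe : bary (edgeWeight v b (1 / 2)) ∈ convexHull ℝ (({v, b} : Finset (E d)) : Set (E d)) :=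
    mem_convexHull_iff_weight.2 ⟨_, hw, edgeWeight_support, rfl⟩
  have hp : bary (edgeWeight v b (1 / 2)) ∈ K.space :=
    K.toSimplicialComplex.convexHull_subset_space hE hpe
  have htri : ∀ s ∈ K.faces, {v, b} ⊆ s → ∀ x ∈ s, x ≠ v → x ≠ b → s = {v, b, x} := by
    intro s hs hsub x hx hxv hxb
    refine (Finset.eq_of_subset_of_card_le (s := {v, b, x}) ?_ ?_).symm
    · rw [Finset.insert_subset_iff] at hsub
      simp only [Finset.insert_subset_iff, Finset.singleton_subset_iff] at hsub ⊢
      exact ⟨hsub.1, hsub.2, hx⟩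
    · refine (K.card_le_three s hs).trans ?_
      rw [Finset.card_insert_of_notMem (by simp [hvb, hxv.symm]),
        Finset.card_pair hxb.symm]
  obtain ⟨c₁, h1v, h1b, h1⟩ : ∃ c, c ≠ v ∧ c ≠ b ∧ {v, b, c} ∈ K.faces := by
    by_contra! h
    refine not_eventually_mem_edge hK hvb hp
      (eventually_mem_of_faces_subset hw hE hsupp fun s hs hsub x hx => ?_)
    by_contra hx'
    simp only [Finset.mem_insert, Finset.mem_singleton, not_or] at hx'
    have := htri s hs hsub x hx hx'.1 hx'.2
    exact h x hx'.1 hx'.2 (this ▸ hs)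
  obtain ⟨c₂, h21, h2v, h2b, h2⟩ : ∃ c, c ≠ c₁ ∧ c ≠ v ∧ c ≠ b ∧ {v, b, c} ∈ K.faces := by
    by_contra! h
    refine not_eventually_mem_triangle hK hvb h1v.symm h1b.symm h1 hp hpe
      (eventually_mem_of_faces_subset hw hE hsupp fun s hs hsub x hx => ?_)
    by_contra hx'
    simp only [Finset.mem_insert, Finset.mem_singleton, not_or] at hx'
    have := htri s hs hsub x hx hx'.1 hx'.2.1
    exact h x hx'.2.2 hx'.1 hx'.2.1 (this ▸ hs)
  refine ⟨c₁, c₂, h21.symm, ⟨h1v, h1b, h1⟩, ⟨h2v, h2b, h2⟩, fun c hcv hcb hc => ?_⟩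
  by_contra! h3
  exact not_three_triangles hK hvb h1 h2 hc ⟨h1v, h1b⟩ ⟨h2v, h2b⟩ ⟨hcv, hcb⟩ h21.symm
    h3.1.symm h3.2.symm

lemma isPreconnected_ball_diff_singleton (c : E 2) {r : ℝ} (hr : 0 < r) :
    IsPreconnected (Metric.ball c r \ {c}) := by
  have h1 : IsConnected ({0}ᶜ : Set (E 2)) :=
    isConnected_compl_singleton_of_one_lt_rank (by
      rw [← Module.finrank_eq_rank, finrank_euclideanSpace_fin]
      norm_num) 0
  let e := OpenPartialHomeomorph.univBall c r
  have h2 : e '' {0}ᶜ = Metric.ball c r \ {c} := by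
    have hs : e.source = univ := OpenPartialHomeomorph.univBall_source c r
    have hinj : Function.Injective e := by
      have := e.injOn
      rwa [hs, injOn_univ] at this
    have h3 : e '' univ = Metric.ball c r := by
      rw [← hs, e.image_source_eq_target]
      exact OpenPartialHomeomorph.univBall_target c hr
    rw [compl_eq_univ_sdiff, image_sdiff hinj, h3, image_singleton]
    congr 2
    exact OpenPartialHomeomorph.univBall_apply_zero c r
  rw [← h2]
  exact h1.isPreconnected.image _ (OpenPartialHomeomorph.continuous_univBall c r).continuousOn

open Classical in
/-- The link of a vertex of a surface is connected. -/
lemma link_connected {d : ℕ} {K : Cplx d} (hK : IsSimplicialSurface K) {v : E d}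
    {S : Set (E d)}
    (hS : ∀ a b, a ∈ S → a ≠ v → b ≠ v → {v, a, b} ∈ K.faces → b ∈ S) {b₀ b₁ : E d}
    (h0 : b₀ ≠ v) (h1 : b₁ ≠ v) (hE0 : {v, b₀} ∈ K.faces) (hE1 : {v, b₁} ∈ K.faces)
    (h0S : b₀ ∈ S) : b₁ ∈ S := by
  by_contra h1S
  obtain ⟨-, ⟨hch⟩⟩ := hK
  have hv : v ∈ K.vertices := K.down_closed hE0 (by simp) (by simp)
  have hvK : v ∈ K.space := K.toSimplicialComplex.subset_space hv (by simp)
  -- `star T` is the union of the simplices at `v` with all other vertices in `T`. The stars of `S`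
  -- and of its complement are closed, cover a neighbourhood of `v` and meet at most in `v`, so they
  -- would disconnect a punctured disk around `v`.
  let star : Set (E d) → Set (E d) := fun T =>
    ⋃ s ∈ {s | s ∈ K.faces ∧ v ∈ s ∧ ∀ x ∈ s, x = v ∨ x ∈ T}, convexHull ℝ (s : Set (E d))
  have hclosed : ∀ T, IsClosed (star T) := fun T =>
    (K.finite_faces.subset fun s hs => hs.1).isClosed_biUnion fun s _ => convexHull_face_closed s
  have hcover : ∀ᶠ z in 𝓝[K.space] v, z ∈ star S ∪ star Sᶜ := by
    filter_upwards [mem_nhdsWithin_of_mem_nhds (K.eventually_mem_imp v),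
      self_mem_nhdsWithin] with z hz hzK
    obtain ⟨s, hs, hzs⟩ := Geometry.SimplicialComplex.mem_space_iff.1 hzK
    have hvs : v ∈ s := by
      have := K.subset_of_mem_convexHull (isWeight_single v) (τ := {v}) hv
        (Finsupp.support_single _ one_ne_zero) hs
        (by
          rw [bary_single, one_smul]
          exact hz s hs hzs)
      simpa using this
    by_cases hall : ∀ x ∈ s, x = v ∨ x ∈ S
    · exact Or.inl (mem_biUnion (show s ∈ {s | _} from ⟨hs, hvs, hall⟩) hzs)
    · push Not at hall
      obtain ⟨x, hxs, hxv, hxS⟩ := hall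
      refine Or.inr (mem_biUnion (show s ∈ {s | _} from ⟨hs, hvs, fun y hy => ?_⟩) hzs)
      by_contra! hy'
      refine hxS (hS y x (not_notMem.1 hy'.2) hy'.1 hxv (K.down_closed hs ?_ (by simp)))
      simp only [Finset.insert_subset_iff, Finset.singleton_subset_iff]
      exact ⟨hvs, hy, hxs⟩
  have hinter : star S ∩ star Sᶜ ⊆ {v} := by
    rintro z ⟨hz, hz'⟩
    simp only [star, mem_iUnion, mem_ofPred_eq, exists_prop] at hz hz'
    obtain ⟨s, ⟨hs, hvs, hsS⟩, hzs⟩ := hz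
    obtain ⟨t, ⟨ht, hvt, htS⟩, hzt⟩ := hz'
    have h2 := K.inter_subset_convexHull hs ht ⟨hzs, hzt⟩
    have h3 : (s ∩ t : Set (E d)) ⊆ {v} := by
      rintro x ⟨hx, hx'⟩
      by_contra hxv
      exact ((htS x hx').resolve_left hxv) ((hsS x hx).resolve_left hxv)
    have h4 := convexHull_mono (𝕜 := ℝ) h3 h2
    rwa [convexHull_singleton] at h4
  let e := chartAt (E 2) (⟨v, hvK⟩ : K.space)
  have hve : (⟨v, hvK⟩ : K.space) ∈ e.source := mem_chart_source _ _
  have hN : ∀ᶠ y in 𝓝 (e ⟨v, hvK⟩), y ∈ e.target ∧ ((e.symm y : K.space) : E d) ∈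
      star S ∪ star Sᶜ := by
    refine (e.open_target.eventually_mem (e.map_source hve)).and ?_
    have h2 : Tendsto (fun y => ((e.symm y : K.space) : E d)) (𝓝 (e ⟨v, hvK⟩)) (𝓝[K.space] v) := by
      refine tendsto_nhdsWithin_iff.2 ⟨?_, Eventually.of_forall fun y => (e.symm y).2⟩
      have h3 := (e.symm.continuousAt (e.map_source hve)).tendsto
      rw [e.left_inv hve] at h3
      exact (continuous_subtype_val.tendsto _).comp h3
    exact h2.eventually hcover
  obtain ⟨r, hr, hball⟩ := Metric.eventually_nhds_iff_ball.1 hN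
  set c := e ⟨v, hvK⟩ with hc
  let Q : Set (E d) := (fun y => ((e.symm y : K.space) : E d)) '' (Metric.ball c r \ {c})
  have hQc : IsPreconnected Q := by
    refine (isPreconnected_ball_diff_singleton c hr).image _ ?_
    refine continuous_subtype_val.comp_continuousOn (e.symm.continuousOn.mono ?_)
    exact fun y hy => (hball y hy.1).1
  have hQcov : Q ⊆ star S ∪ star Sᶜ := by
    rintro _ ⟨y, hy, rfl⟩
    exact (hball y hy.1).2
  have hQv : v ∉ Q := by
    rintro ⟨y, hy, hyv⟩
    have h2 : e.symm y = ⟨v, hvK⟩ := Subtype.ext hyv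
    refine hy.2 ?_
    rw [mem_singleton_iff, hc, ← h2, e.right_inv (hball y hy.1).1]
  -- Points of the edge from `v` to `b` close to `v` show that both parts are nonempty.
  have hmeet : ∀ b, b ≠ v → {v, b} ∈ K.faces → ∀ T, b ∈ T → (Q ∩ star T).Nonempty := by
    intro b hb hE T hbT
    have hseg : ∀ t ∈ Icc (0 : ℝ) 1, edgePoint v b t ∈
        convexHull ℝ (({v, b} : Finset (E d)) : Set (E d)) := fun t ht =>
      mem_convexHull_iff_weight.2 ⟨edgeWeight v b t, ⟨edgeWeight_nonneg ht.1 ht.2,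
        total_edgeWeight⟩, edgeWeight_support, bary_edgeWeight⟩
    have htend : Tendsto (fun t : Icc (0 : ℝ) 1 => (⟨edgePoint v b t,
        K.toSimplicialComplex.convexHull_subset_space hE (hseg t t.2)⟩ : K.space))
        (𝓝 ⟨0, by simp⟩) (𝓝 ⟨v, hvK⟩) := by
      have hcont : Continuous (fun t : Icc (0 : ℝ) 1 => (⟨edgePoint v b t,
        K.toSimplicialComplex.convexHull_subset_space hE (hseg t t.2)⟩ : K.space)) :=
        ((continuous_edgePoint v b).comp continuous_subtype_val).subtype_mk _
      have := hcont.tendsto ⟨0, by simp⟩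
      simpa [edgePoint] using this
    have hmem : ∀ᶠ z in 𝓝 (⟨v, hvK⟩ : K.space), z ∈ e.source ∧ e z ∈ Metric.ball c r :=
      (e.open_source.eventually_mem hve).and
        ((e.continuousAt hve).eventually (Metric.ball_mem_nhds _ hr))
    have h2 := htend.eventually hmem
    rw [nhds_subtype_eq_comap, eventually_comap] at h2
    obtain ⟨t, ht, ht'⟩ := ((h2.filter_mono
      (nhdsWithin_le_nhds (s := Ioi 0))).and (Ioc_mem_nhdsGT (zero_lt_one' ℝ))).exists
    obtain ⟨h3, h4⟩ := ht ⟨t, ht'.1.le, ht'.2⟩ rfl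
    refine ⟨edgePoint v b t, ⟨_, ⟨h4, ?_⟩, ?_⟩, ?_⟩
    · intro h5
      have h6 := congrArg Subtype.val (e.injOn h3 hve h5)
      simp only [edgePoint] at h6
      have h7 : t • (b - v) = 0 := by
        rw [← sub_eq_zero] at h6
        rw [← h6]
        module
      rcases smul_eq_zero.1 h7 with h8 | h8
      · exact ht'.1.ne' h8
      · exact hb (sub_eq_zero.1 h8)
    · simp only [e.left_inv h3]
    · refine mem_biUnion (show ({v, b} : Finset (E d)) ∈ {s | _} from ⟨hE, by simp, ?_⟩)
        (hseg t ⟨ht'.1.le, ht'.2⟩)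
      intro x hx
      simp only [Finset.mem_insert, Finset.mem_singleton] at hx
      rcases hx with hx | hx
      · exact Or.inl hx
      · exact Or.inr (hx ▸ hbT)
  obtain ⟨z, hzQ, hz⟩ := isPreconnected_closed_iff.1 hQc _ _ (hclosed S) (hclosed Sᶜ) hQcov
    (hmeet b₀ h0 hE0 S h0S) (hmeet b₁ h1 hE1 Sᶜ h1S)
  have h2 := hinter hz
  rw [mem_singleton_iff] at h2
  exact hQv (h2 ▸ hzQ)

end AngleDefect


/-! ### Every star in a surface is a fan. -/

namespace AngleDefect

open Set Filter Topology
open scoped EuclideanGeometry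

open Classical in
-- A zero angle would put `y` on the ray from `v` through `x`, against affine independence.
lemma angle_pos_of_triangle {d : ℕ} {K : Cplx d} {v x y : E d} (hy : y ≠ v)
    (hxy : x ≠ y) (hT : {v, x, y} ∈ K.faces) : 0 < ∠ x v y := by
  refine lt_of_le_of_ne (EuclideanGeometry.angle_nonneg _ _ _) fun h => ?_
  obtain ⟨-, r, -, hr⟩ := InnerProductGeometry.angle_eq_zero_iff.1 h.symm
  simp only [vsub_eq_sub] at hr
  have h1 := eq_of_affineIndependent (K.indep hT) (w := Finsupp.single v (1 - r) +
      Finsupp.single x r) (w' := Finsupp.single y 1)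
    (by
      refine Finsupp.support_add.trans (Finset.union_subset ?_ ?_) <;>
        refine Finsupp.support_single_subset.trans ?_ <;> simp)
    (by
      refine Finsupp.support_single_subset.trans ?_
      simp)
    (by simp) (by
      simp only [map_add, bary_single, one_smul]
      rw [← sub_add_cancel y v, hr]
      module)
  have h2 := DFunLike.congr_fun h1 y
  simp [hxy.symm, hy] at h2

open Classical in
/-- A cyclic enumeration of the link of a vertex gives a fan. -/
lemma exists_fan_of_cycle {d : ℕ} {K : Cplx d} {v : E d} {n : ℕ} (hn : 3 ≤ n) {b : ℕ → E d}
    (hb0 : b n = b 0) (hinj : ∀ i < n, ∀ j < n, b i = b j → i = j) (hbv : ∀ i ≤ n, b i ≠ v)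
    (hne : ∀ i < n, b i ≠ b (i + 1))
    (hface : ∀ s : Finset (E d), v ∈ s →
      (s ∈ K.faces ↔ ∃ i < n, s ⊆ {v, b i, b (i + 1)})) :
    ∃ (C : Finset ℝ) (u : ℝ → E d), FanAt K v (2 * Real.pi * angleSum K v) C u := by
  -- The angle of the `i`-th link vertex is the sum of the angles of the first `i` triangles. These
  -- sums increase strictly, so the vertex can be recovered from its angle.
  let S : ℕ → ℝ := fun i => ∑ j ∈ Finset.range i, ∠ (b j) v (b (j + 1))
  have hS : ∀ i, S (i + 1) = S i + ∠ (b i) v (b (i + 1)) := fun i => Finset.sum_range_succ _ _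
  have hpos : ∀ i < n, 0 < ∠ (b i) v (b (i + 1)) := fun i hi =>
    angle_pos_of_triangle (hbv (i + 1) hi) (hne i hi)
      ((hface _ (by simp)).2 ⟨i, hi, subset_rfl⟩)
  have hmono : ∀ i ≤ n, ∀ j, j < i → S j < S i := by
    intro i hi
    induction i with
    | zero => exact fun j hj => absurd hj (Nat.not_lt_zero j)
    | succ i ih =>
      intro j hj
      have h1 := hpos i hi
      have h2 := hS i
      rcases (Nat.lt_succ_iff.1 hj).eq_or_lt with rfl | hj
      · linarith
      · linarith [ih (by omega) j hj]
  have hlt : ∀ i ≤ n, ∀ j ≤ n, S i < S j → i < j := by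
    intro i hi j hj hij
    by_contra! h
    rcases h.eq_or_lt with rfl | h
    · exact lt_irrefl _ hij
    · exact lt_asymm hij (hmono i hi j h)
  have hSinj : ∀ i ≤ n, ∀ j ≤ n, S i = S j → i = j := by
    intro i hi j hj hij
    rcases lt_trichotomy i j with h | h | h
    · exact absurd hij (hmono j hj i h).ne
    · exact h
    · exact absurd hij (hmono i hi j h).ne'
  have hmonole : ∀ i ≤ n, ∀ j, j ≤ i → S j ≤ S i := fun i hi j hj => by
    rcases hj.eq_or_lt with rfl | hj
    exacts [le_rfl, (hmono i hi j hj).le]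
  let C : Finset ℝ := (Finset.range (n + 1)).image S
  let u : ℝ → E d := fun t => if h : ∃ i, i ≤ n ∧ S i = t then b h.choose else v
  have hu : ∀ i ≤ n, u (S i) = b i := by
    intro i hi
    have h : ∃ j, j ≤ n ∧ S j = S i := ⟨i, hi, rfl⟩
    have h1 : u (S i) = b h.choose := dif_pos h
    rw [h1, hSinj _ h.choose_spec.1 i hi h.choose_spec.2]
  have hC : ∀ t, t ∈ C ↔ ∃ i ≤ n, S i = t := fun t => by
    simp [C, Finset.mem_image]
  have hcon : ∀ x y, Consec C x y ↔ ∃ i < n, x = S i ∧ y = S (i + 1) := by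
    intro x y
    constructor
    · rintro ⟨hx, hy, hxy, hm⟩
      obtain ⟨i, hi, rfl⟩ := (hC x).1 hx
      obtain ⟨j, hj, rfl⟩ := (hC y).1 hy
      have hij := hlt i hi j hj hxy
      refine ⟨i, by omega, rfl, ?_⟩
      rcases hm (S (i + 1)) ((hC _).2 ⟨i + 1, by omega, rfl⟩) with h | h
      · exact absurd h (not_le.2 (hmono (i + 1) (by omega) i (by omega)))
      · exact le_antisymm h (hmonole j hj (i + 1) hij)
    · rintro ⟨i, hi, rfl, rfl⟩
      refine ⟨(hC _).2 ⟨i, hi.le, rfl⟩, (hC _).2 ⟨i + 1, hi, rfl⟩,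
        hmono (i + 1) hi i (by omega), fun c hc => ?_⟩
      obtain ⟨j, hj, rfl⟩ := (hC c).1 hc
      rcases le_or_gt j i with h | h
      · exact Or.inl (hmonole i hi.le j h)
      · exact Or.inr (hmonole j hj (i + 1) h)
  have hfan : FanAt K v (S n) C u := by
    have hS0 : S 0 = 0 := by simp [S]
    refine ⟨(hC 0).2 ⟨0, by omega, hS0⟩, (hC _).2 ⟨n, le_rfl, rfl⟩, ?_, ?_, ?_, ?_, ?_, ?_, ?_, ?_⟩
    · intro t ht
      obtain ⟨i, hi, rfl⟩ := (hC t).1 ht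
      exact hS0 ▸ hmonole i hi 0 (Nat.zero_le i)
    · intro t ht
      obtain ⟨i, hi, rfl⟩ := (hC t).1 ht
      exact hmonole n le_rfl i hi
    · rw [Finset.card_image_of_injOn, Finset.card_range]
      · omega
      · intro i hi j hj
        simp only [Finset.coe_range, mem_Iio] at hi hj
        exact hSinj i (by omega) j (by omega)
    · rw [← hS0, hu 0 (by omega), hu n le_rfl, hb0]
    · intro s hs t ht hsn htn he
      obtain ⟨i, hi, rfl⟩ := (hC s).1 hs
      obtain ⟨j, hj, rfl⟩ := (hC t).1 ht
      rw [hu i hi, hu j hj] at he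
      rw [hinj i (hlt i hi n le_rfl hsn) j (hlt j hj n le_rfl htn) he]
    · intro t ht
      obtain ⟨i, hi, rfl⟩ := (hC t).1 ht
      rw [hu i hi]
      exact hbv i hi
    · intro s hvs
      rw [hface s hvs]
      constructor
      · rintro ⟨i, hi, hs⟩
        refine ⟨S i, S (i + 1), (hcon _ _).2 ⟨i, hi, rfl, rfl⟩, ?_⟩
        rwa [hu i hi.le, hu (i + 1) hi]
      · rintro ⟨x, y, hxy, hs⟩
        obtain ⟨i, hi, rfl, rfl⟩ := (hcon _ _).1 hxy
        rw [hu i hi.le, hu (i + 1) hi] at hs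
        exact ⟨i, hi, hs⟩
    · intro x y hxy
      obtain ⟨i, hi, rfl, rfl⟩ := (hcon _ _).1 hxy
      rw [hu i hi.le, hu (i + 1) hi, hS]
      ring
  refine ⟨C, u, ?_⟩
  suffices h : 2 * Real.pi * angleSum K v = S n by rwa [h]
  have hcard : ∀ i < n, ({v, b i, b (i + 1)} : Finset (E d)).card = 3 := fun i hi => by
    rw [Finset.card_insert_of_notMem (by simp [(hbv i hi.le).symm, (hbv (i + 1) hi).symm]),
      Finset.card_pair (hne i hi)]
  have hsum : angleSum K v = ∑ i ∈ Finset.range n, angleAt v {v, b i, b (i + 1)} := by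
    rw [angleSum]
    refine (Finset.sum_bij (fun i _ => {v, b i, b (i + 1)}) ?_ ?_ ?_ (fun _ _ => rfl)).symm
    · intro i hi
      rw [Finset.mem_range] at hi
      simp only [Cplx.trianglesAt, Finset.mem_filter, Finite.mem_toFinset]
      exact ⟨(hface _ (by simp)).2 ⟨i, hi, subset_rfl⟩, hcard i hi, by simp⟩
    · intro i hi j hj he
      rw [Finset.mem_range] at hi hj
      have h1 := hfan.consec_unique ((hcon _ _).2 ⟨i, hi, rfl, rfl⟩)
        ((hcon _ _).2 ⟨j, hj, rfl, rfl⟩)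
        (by
          rw [hu i hi.le, hu j hj.le, hu (j + 1) hj, ← he]
          simp)
        (by
          rw [hu (i + 1) hi, hu j hj.le, hu (j + 1) hj, ← he]
          simp)
      exact hSinj i hi.le j hj.le h1
    · intro σ hσ
      simp only [Cplx.trianglesAt, Finset.mem_filter, Finite.mem_toFinset] at hσ
      obtain ⟨i, hi, hs⟩ := (hface σ hσ.2.2).1 hσ.1
      refine ⟨i, Finset.mem_range.2 hi, ?_⟩
      exact (Finset.eq_of_subset_of_card_le hs (by rw [hcard i hi, hσ.2.1])).symm
  rw [hsum, Finset.mul_sum]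
  refine Finset.sum_congr rfl fun i hi => ?_
  rw [Finset.mem_range] at hi
  rw [angleAt_eq (hbv i hi.le).symm (hbv (i + 1) hi).symm (hne i hi)]
  have := Real.pi_pos
  field_simp

open Classical in
/-- The star of every vertex of a simplicial surface is a fan. -/
theorem IsSimplicialSurface.exists_fan {d : ℕ} {K : Cplx d} (hK : IsSimplicialSurface K) {v : E d}
    (hv : v ∈ K.vertices) :
    ∃ (C : Finset ℝ) (u : ℝ → E d), FanAt K v (2 * Real.pi * angleSum K v) C u := by
  let V := {b : E d // b ≠ v ∧ {v, b} ∈ K.faces}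
  have hfinV : Finite V := by
    have := K.finite_vertices.to_subtype
    refine Finite.of_injective (β := K.vertices) (fun b => ⟨b.1, ?_⟩) ?_
    · exact K.down_closed b.2.2 (by simp) (by simp)
    · exact fun a b hab => Subtype.ext (congrArg (fun x : K.vertices => (x : E d)) hab)
  -- The link as a graph: every degree is two and it is connected, so it is a single cycle.
  let G : SimpleGraph V :=
    { Adj := fun a b => a ≠ b ∧ {v, a.1, b.1} ∈ K.faces
      symm := ⟨fun a b h => ⟨h.1.symm, by
        rw [Finset.pair_comm b.1 a.1]
        exact h.2⟩⟩
      loopless := ⟨fun a h => h.1 rfl⟩ }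
  have hGadj : ∀ a b : V, G.Adj a b ↔ a ≠ b ∧ {v, a.1, b.1} ∈ K.faces := fun a b => Iff.rfl
  have hncard : ∀ b : V, (G.neighborSet b).ncard = 2 := by
    intro b
    obtain ⟨c₁, c₂, hc, ⟨h1v, h1b, h1⟩, ⟨h2v, h2b, h2⟩, hall⟩ :=
      exists_two_triangles hK b.2.1.symm b.2.2
    let c₁' : V := ⟨c₁, h1v, K.down_closed h1 (by
      simp [Finset.insert_subset_iff]) (by simp)⟩
    let c₂' : V := ⟨c₂, h2v, K.down_closed h2 (by
      simp [Finset.insert_subset_iff]) (by simp)⟩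
    have heq : G.neighborSet b = {c₁', c₂'} := by
      ext x
      simp only [SimpleGraph.mem_neighborSet, hGadj, mem_insert_iff, mem_singleton_iff]
      constructor
      · rintro ⟨hbx, hx⟩
        rcases hall x.1 x.2.1 (fun h => hbx (Subtype.ext h.symm)) hx with h | h
        · exact Or.inl (Subtype.ext h)
        · exact Or.inr (Subtype.ext h)
      · rintro (rfl | rfl)
        · exact ⟨fun h => h1b (congrArg Subtype.val h).symm, h1⟩
        · exact ⟨fun h => h2b (congrArg Subtype.val h).symm, h2⟩
    rw [heq, ncard_pair (fun h => hc (congrArg Subtype.val h))]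
  have hcyc : G.IsCycles := fun b _ => hncard b
  obtain ⟨b₀, hb₀, hE₀⟩ := exists_edge hK hv
  let B₀ : V := ⟨b₀, hb₀, hE₀⟩
  have hreach : ∀ b : V, G.Reachable B₀ b := by
    intro b
    have := link_connected hK (S := {x | ∃ h, G.Reachable B₀ (⟨x, h⟩ : V)}) (v := v)
      (by
        rintro x y ⟨hx, hr⟩ hxv hyv hxy
        by_cases hxy' : x = y
        · exact hxy' ▸ ⟨hx, hr⟩
        · have hy : y ≠ v ∧ {v, y} ∈ K.faces := ⟨hyv, K.down_closed hxy (by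
            simp [Finset.insert_subset_iff]) (by simp)⟩
          refine ⟨hy, hr.trans (SimpleGraph.Adj.reachable ?_)⟩
          exact ⟨fun h => hxy' (congrArg Subtype.val h), hxy⟩)
      hb₀ b.2.1 hE₀ b.2.2 ⟨⟨hb₀, hE₀⟩, .refl _⟩
    exact this.2
  have hsupp : ∀ b : V, b ∈ (G.connectedComponentMk B₀).supp := fun b =>
    SimpleGraph.ConnectedComponent.sound (hreach b).symm
  obtain ⟨p, hp, hpv⟩ := hcyc.exists_cycle_toSubgraph_verts_eq_connectedComponentSupp (hsupp B₀)
    (nonempty_of_ncard_ne_zero (by rw [hncard B₀]; norm_num))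
  have hmem : ∀ b : V, b ∈ p.support := fun b => by
    rw [← SimpleGraph.Walk.mem_verts_toSubgraph, hpv]
    exact hsupp b
  -- The cycle already has two neighbours at every vertex, so no edge of the link is left out.
  have hadj : ∀ a b : V, G.Adj a b → p.toSubgraph.Adj a b := by
    intro a b hab
    have h1 : p.toSubgraph.neighborSet a = G.neighborSet a :=
      eq_of_subset_of_ncard_le (p.toSubgraph.neighborSet_subset a)
        (by rw [hncard, hp.ncard_neighborSet_toSubgraph_eq_two (hmem a)])
    have h2 : b ∈ p.toSubgraph.neighborSet a := h1 ▸ hab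
    exact h2
  refine exists_fan_of_cycle (n := p.length) hp.three_le_length (b := fun i => (p.getVert i).1)
    (by simp) ?_ (fun i _ => (p.getVert i).2.1) ?_ ?_
  · intro i hi j hj hij
    exact hp.getVert_injOn' (show i ≤ p.length - 1 by omega) (show j ≤ p.length - 1 by omega)
      (Subtype.ext hij)
  · intro i hi h
    exact (p.adj_getVert_succ hi).1 (Subtype.ext h)
  · intro s hvs
    constructor
    · intro hs
      have hV : ∀ x ∈ s, x ≠ v → x ≠ v ∧ {v, x} ∈ K.faces := fun x hx hxv =>
        ⟨hxv, K.down_closed hs (by simp [Finset.insert_subset_iff, hvs, hx]) (by simp)⟩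
      have hone : ∀ x : V, ∃ i < p.length, x = p.getVert i := by
        intro x
        obtain ⟨i, hi, hle⟩ := SimpleGraph.Walk.mem_support_iff_exists_getVert.1 (hmem x)
        rcases hle.lt_or_eq with h | h
        · exact ⟨i, h, hi.symm⟩
        · refine ⟨0, by have := hp.three_le_length; omega, ?_⟩
          rw [← hi, h, p.getVert_length, p.getVert_zero]
      by_cases h1 : ∃ x ∈ s, x ≠ v
      swap
      · push Not at h1
        exact ⟨0, by have := hp.three_le_length; omega, fun x hx => by simp [h1 x hx]⟩
      obtain ⟨x, hx, hxv⟩ := h1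
      by_cases h2 : ∃ y ∈ s, y ≠ v ∧ y ≠ x
      swap
      · push Not at h2
        obtain ⟨i, hi, hxi⟩ := hone ⟨x, hV x hx hxv⟩
        refine ⟨i, hi, fun y hy => ?_⟩
        by_cases hyv : y = v
        · simp [hyv]
        · rw [h2 y hy hyv, ← hxi]
          simp
      obtain ⟨y, hy, hyv, hyx⟩ := h2
      have hsub : {v, x, y} ⊆ s := by simp [Finset.insert_subset_iff, hvs, hx, hy]
      have hs3 : s = {v, x, y} := by
        refine (Finset.eq_of_subset_of_card_le hsub ?_).symm
        refine (K.card_le_three s hs).trans ?_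
        rw [Finset.card_insert_of_notMem (by simp [hxv.symm, hyv.symm]),
          Finset.card_pair hyx.symm]
      have h3 := hadj ⟨x, hV x hx hxv⟩ ⟨y, hV y hy hyv⟩
        ⟨fun h => hyx (congrArg Subtype.val h).symm, K.down_closed hs hsub (by simp)⟩
      obtain ⟨i, hi, hil⟩ := p.toSubgraph_adj_iff.1 h3
      refine ⟨i, hil, ?_⟩
      rw [Sym2.eq_iff] at hi
      rw [hs3]
      rcases hi with ⟨h4, h5⟩ | ⟨h4, h5⟩
      · rw [h4, h5]
      · rw [h4, h5, Finset.pair_comm]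
    · rintro ⟨i, hi, hs⟩
      exact K.down_closed (p.adj_getVert_succ hi).2 hs ⟨v, hvs⟩

/-- On the surfaces in `𝒮`, the value of `φ` at a vertex depends only on the angle sum. -/
theorem eq_of_angleSum_eq {𝒮 : CplxSet} {φ : VertexFun}
    (hsurf : ∀ (d : ℕ), ∀ K ∈ 𝒮 d, IsSimplicialSurface K) (hsub : SubdivisionClosed 𝒮)
    (h1 : InvariantUnderStarIsometry 𝒮 φ) (h2 : InvariantUnderSubdivision 𝒮 φ) {d e : ℕ}
    {K : Cplx d} (hK : K ∈ 𝒮 d) {L : Cplx e} (hL : L ∈ 𝒮 e) {v : E d} (hv : v ∈ K.vertices)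
    {w : E e} (hw : w ∈ L.vertices) (h : angleSum K v = angleSum L w) : φ K v = φ L w := by
  obtain ⟨C, u, hu⟩ := (hsurf d K hK).exists_fan hv
  obtain ⟨D, u', hu'⟩ := (hsurf e L hL).exists_fan hw
  rw [h] at hu
  exact eq_of_fans hsub h1 h2 hK hL hu hu'

lemma IsSimplicialSurface.angleSum_pos {d : ℕ} {K : Cplx d} (hK : IsSimplicialSurface K) {v : E d}
    (hv : v ∈ K.vertices) : 0 < angleSum K v := by
  obtain ⟨C, u, hu⟩ := hK.exists_fan hv
  have := hu.zero_lt_top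
  have hpi := Real.pi_pos
  by_contra! h
  nlinarith

end AngleDefect


/-! ### Plane polygons with alternating radii. -/

namespace AngleDefect
open Set Filter Topology
open scoped EuclideanGeometry

/-- The radius of the `j`-th vertex of a polygon whose vertices alternate between two circles. -/
noncomputable def ringRadius (r₀ r₁ : ℝ) (j : ℕ) : ℝ := if Even j then r₀ else r₁

/-- The `j`-th vertex of the `2m`-gon with vertices at equally spaced angles and alternating
distances `r₀`, `r₁` from the origin. -/
noncomputable def ringPoint (m : ℕ) (r₀ r₁ : ℝ) (j : ℕ) : E 2 :=
  !₂[ringRadius r₀ r₁ j * Real.cos (j * (Real.pi / m)),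
    ringRadius r₀ r₁ j * Real.sin (j * (Real.pi / m))]

variable {m : ℕ} {r₀ r₁ : ℝ}

lemma ringRadius_pos (h₀ : 0 < r₀) (h₁ : 0 < r₁) (j : ℕ) : 0 < ringRadius r₀ r₁ j := by
  unfold ringRadius; split_ifs <;> assumption

lemma ringRadius_add_two (j : ℕ) : ringRadius r₀ r₁ (j + 2) = ringRadius r₀ r₁ j := by
  simp [ringRadius, Nat.even_add]

lemma ringRadius_add_period (j : ℕ) : ringRadius r₀ r₁ (j + 2 * m) = ringRadius r₀ r₁ j := by
  simp [ringRadius, Nat.even_add]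

lemma ringPoint_add_period (hm : m ≠ 0) (j : ℕ) :
    ringPoint m r₀ r₁ (j + 2 * m) = ringPoint m r₀ r₁ j := by
  have h : ((j + 2 * m : ℕ) : ℝ) * (Real.pi / m) = j * (Real.pi / m) + 2 * Real.pi := by
    have : (m : ℝ) ≠ 0 := by exact_mod_cast hm
    push_cast
    field_simp
  rw [ringPoint, h, ringRadius_add_period, Real.cos_add_two_pi, Real.sin_add_two_pi, ringPoint]

/-- The cross product of the direction with number `k` and a point. -/
noncomputable def ringCross (m k : ℕ) : E 2 →ₗ[ℝ] ℝ where
  toFun v := v 1 * Real.cos (k * (Real.pi / m)) - v 0 * Real.sin (k * (Real.pi / m))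
  map_add' v w := by simp; ring
  map_smul' a v := by simp; ring

lemma ringCross_ringPoint (k j : ℕ) :
    ringCross m k (ringPoint m r₀ r₁ j)
      = ringRadius r₀ r₁ j * Real.sin (((j : ℝ) - k) * (Real.pi / m)) := by
  have : ((j : ℝ) - k) * (Real.pi / m) = j * (Real.pi / m) - k * (Real.pi / m) := by ring
  rw [this, Real.sin_sub]
  simp [ringCross, ringPoint]
  ring

/-- The inner product of the direction with number `k` and a point. -/
noncomputable def ringDot (m k : ℕ) : E 2 →ₗ[ℝ] ℝ where
  toFun v := v 0 * Real.cos (k * (Real.pi / m)) + v 1 * Real.sin (k * (Real.pi / m))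
  map_add' v w := by simp; ring
  map_smul' a v := by simp; ring

lemma ringDot_ringPoint (k j : ℕ) :
    ringDot m k (ringPoint m r₀ r₁ j)
      = ringRadius r₀ r₁ j * Real.cos (((j : ℝ) - k) * (Real.pi / m)) := by
  have : ((j : ℝ) - k) * (Real.pi / m) = j * (Real.pi / m) - k * (Real.pi / m) := by ring
  rw [this, Real.cos_sub]
  simp [ringDot, ringPoint]
  ring

lemma sin_step_pos (hm : 2 ≤ m) {t : ℝ} (h0 : 0 < t) (h1 : t < m) :
    0 < Real.sin (t * (Real.pi / m)) := by
  have hm' : (0 : ℝ) < m := by positivity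
  have := Real.pi_pos
  apply Real.sin_pos_of_pos_of_lt_pi (by positivity)
  rw [← mul_div_assoc, div_lt_iff₀ hm']
  nlinarith

/-- Two points in sectors of the fan spanned by the points of the ring agree only for the obvious
reasons: the case where the second sector is at most half a turn ahead. -/
lemma ring_sector_unique_of_lt (hm : 2 ≤ m) (h₀ : 0 < r₀) (h₁ : 0 < r₁) {i j : ℕ} (hij : i < j)
    (hjm : j ≤ i + m) {a b a' b' : ℝ} (ha : 0 ≤ a) (hb : 0 ≤ b) (ha' : 0 ≤ a') (hb' : 0 ≤ b')
    (h : a • ringPoint m r₀ r₁ i + b • ringPoint m r₀ r₁ (i + 1)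
      = a' • ringPoint m r₀ r₁ j + b' • ringPoint m r₀ r₁ (j + 1)) :
    a = 0 ∧ b' = 0 ∧ b = a' ∧ (j = i + 1 ∨ b = 0) := by
  have R := ringRadius_pos h₀ h₁
  have hm0 : (m : ℝ) ≠ 0 := by positivity
  have hm2 : (2 : ℝ) ≤ m := by exact_mod_cast hm
  -- Cross products with the two directions that bound the first sector. In `e1` the two sides have
  -- opposite signs, so each term vanishes; `e0` then settles the rest.
  have e0 := congrArg (ringCross m i) h
  have e1 := congrArg (ringCross m (i + 1)) h
  simp only [map_add, map_smul, ringCross_ringPoint, smul_eq_mul] at e0 e1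
  push_cast at e0 e1
  have s1 := sin_step_pos hm (t := 1) one_pos (by linarith)
  have z0 : ((i : ℝ) - i) * (Real.pi / m) = 0 := by ring
  have z1 : ((i : ℝ) + 1 - (i + 1)) * (Real.pi / m) = 0 := by ring
  have z2 : ((i : ℝ) + 1 - i) * (Real.pi / m) = 1 * (Real.pi / m) := by ring
  have z3 : ((i : ℝ) - (i + 1)) * (Real.pi / m) = -(1 * (Real.pi / m)) := by ring
  rw [z0, z2, Real.sin_zero] at e0
  rw [z1, z3, Real.sin_zero, Real.sin_neg] at e1
  have hij' : (i : ℝ) + 1 ≤ j := by exact_mod_cast hij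
  have Ri := R i
  have Ri1 := R (i + 1)
  have Rj := R j
  have Rj1 := R (j + 1)
  rcases hjm.lt_or_eq with hlt | rfl
  · have hlt' : (j : ℝ) < i + m := by exact_mod_cast hlt
    have p1 := sin_step_pos hm (t := (j : ℝ) - i) (by linarith) (by linarith)
    have p2 : (j : ℝ) + 1 - (i + 1) = j - i := by ring
    rw [p2] at e1
    have q0 : 0 ≤ Real.sin (((j : ℝ) - (i + 1)) * (Real.pi / m)) := by
      rcases hij'.eq_or_lt with h' | h'
      · rw [← h']; simp
      · exact (sin_step_pos hm (by linarith) (by linarith)).le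
    have n1 : 0 ≤ a * (ringRadius r₀ r₁ i * Real.sin (1 * (Real.pi / m))) := by positivity
    have n2 : 0 ≤ a' * (ringRadius r₀ r₁ j * Real.sin (((j : ℝ) - (i + 1)) * (Real.pi / m))) := by
      positivity
    have n3 : 0 ≤ b' * (ringRadius r₀ r₁ (j + 1) * Real.sin (((j : ℝ) - i) * (Real.pi / m))) := by
      positivity
    have m1 : a * (ringRadius r₀ r₁ i * Real.sin (1 * (Real.pi / m))) = 0 := by linarith
    have m2 : a' * (ringRadius r₀ r₁ j * Real.sin (((j : ℝ) - (i + 1)) * (Real.pi / m))) = 0 := by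
      linarith
    have m3 : b' * (ringRadius r₀ r₁ (j + 1) * Real.sin (((j : ℝ) - i) * (Real.pi / m))) = 0 := by
      linarith
    have ha0 : a = 0 := (mul_eq_zero.1 m1).resolve_right (by positivity)
    have hb0 : b' = 0 := (mul_eq_zero.1 m3).resolve_right (by positivity)
    refine ⟨ha0, hb0, ?_⟩
    rw [ha0, hb0] at e0
    rcases hij'.eq_or_lt with h' | h'
    · have hj : j = i + 1 := by exact_mod_cast h'.symm
      subst hj
      push_cast at e0
      rw [z2] at e0
      have : (b - a') * (ringRadius r₀ r₁ (i + 1) * Real.sin (1 * (Real.pi / m))) = 0 := by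
        linarith
      have := (mul_eq_zero.1 this).resolve_right (by positivity)
      exact ⟨by linarith, Or.inl rfl⟩
    · have q1 := sin_step_pos hm (t := (j : ℝ) - (i + 1)) (by linarith) (by linarith)
      have ha0' : a' = 0 := (mul_eq_zero.1 m2).resolve_right (by positivity)
      rw [ha0'] at e0
      have : b * (ringRadius r₀ r₁ (i + 1) * Real.sin (1 * (Real.pi / m))) = 0 := by linarith
      have := (mul_eq_zero.1 this).resolve_right (by positivity)
      exact ⟨by linarith, Or.inr this⟩
  -- Opposite sectors meet only in the origin.
  · push_cast at e0 e1
    have y1 : ((i : ℝ) + m - i) * (Real.pi / m) = Real.pi := by field_simp; ring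
    have y2 : ((i : ℝ) + m + 1 - i) * (Real.pi / m) = 1 * (Real.pi / m) + Real.pi := by
      field_simp; ring
    have y3 : ((i : ℝ) + m - (i + 1)) * (Real.pi / m) = Real.pi - 1 * (Real.pi / m) := by
      field_simp; ring
    have y4 : ((i : ℝ) + m + 1 - (i + 1)) * (Real.pi / m) = Real.pi := by
      field_simp; ring
    rw [y1, y2, Real.sin_pi, Real.sin_add_pi] at e0
    rw [y3, y4, Real.sin_pi, Real.sin_pi_sub] at e1
    have n1 : 0 ≤ b * (ringRadius r₀ r₁ (i + 1) * Real.sin (1 * (Real.pi / m))) := by positivity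
    have n2 : 0 ≤ b' * (ringRadius r₀ r₁ (i + m + 1) * Real.sin (1 * (Real.pi / m))) := by
      positivity
    have n3 : 0 ≤ a * (ringRadius r₀ r₁ i * Real.sin (1 * (Real.pi / m))) := by positivity
    have n4 : 0 ≤ a' * (ringRadius r₀ r₁ (i + m) * Real.sin (1 * (Real.pi / m))) := by
      positivity
    have m1 : b * (ringRadius r₀ r₁ (i + 1) * Real.sin (1 * (Real.pi / m))) = 0 := by linarith
    have m2 : b' * (ringRadius r₀ r₁ (i + m + 1) * Real.sin (1 * (Real.pi / m))) = 0 := by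
      linarith
    have m3 : a * (ringRadius r₀ r₁ i * Real.sin (1 * (Real.pi / m))) = 0 := by linarith
    have m4 : a' * (ringRadius r₀ r₁ (i + m) * Real.sin (1 * (Real.pi / m))) = 0 := by linarith
    have k1 := (mul_eq_zero.1 m1).resolve_right (by positivity)
    have k2 := (mul_eq_zero.1 m2).resolve_right (by positivity)
    have k3 := (mul_eq_zero.1 m3).resolve_right (by positivity)
    have k4 := (mul_eq_zero.1 m4).resolve_right (by positivity)
    exact ⟨k3, k2, by rw [k1, k4], Or.inr k1⟩

/-- The coefficients of a point of the closed sector between two neighbouring ring points are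
unique, also across different sectors. -/
lemma ring_sector_unique (hm : 2 ≤ m) (h₀ : 0 < r₀) (h₁ : 0 < r₁) {i j : ℕ} (hi : i < 2 * m)
    (hj : j < 2 * m) {a b a' b' : ℝ} (ha : 0 ≤ a) (hb : 0 ≤ b) (ha' : 0 ≤ a') (hb' : 0 ≤ b')
    (h : a • ringPoint m r₀ r₁ i + b • ringPoint m r₀ r₁ (i + 1)
      = a' • ringPoint m r₀ r₁ j + b' • ringPoint m r₀ r₁ (j + 1)) :
    (i = j ∧ a = a' ∧ b = b') ∨
    (a = 0 ∧ b' = 0 ∧ b = a' ∧ (j = (i + 1) % (2 * m) ∨ b = 0)) ∨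
    (a' = 0 ∧ b = 0 ∧ b' = a ∧ (i = (j + 1) % (2 * m) ∨ b' = 0)) := by
  have key : ∀ {i j : ℕ} (_ : i < 2 * m) (_ : j < 2 * m) {a b a' b' : ℝ} (_ : 0 ≤ a) (_ : 0 ≤ b)
      (_ : 0 ≤ a') (_ : 0 ≤ b') (_ : i < j)
      (_ : a • ringPoint m r₀ r₁ i + b • ringPoint m r₀ r₁ (i + 1)
        = a' • ringPoint m r₀ r₁ j + b' • ringPoint m r₀ r₁ (j + 1)),
      (a = 0 ∧ b' = 0 ∧ b = a' ∧ (j = (i + 1) % (2 * m) ∨ b = 0)) ∨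
      (a' = 0 ∧ b = 0 ∧ b' = a ∧ (i = (j + 1) % (2 * m) ∨ b' = 0)) := by
    intro i j hi hj a b a' b' ha hb ha' hb' hij h
    rcases le_or_gt j (i + m) with hjm | hjm
    · left
      obtain ⟨e1, e2, e3, e4⟩ := ring_sector_unique_of_lt hm h₀ h₁ hij hjm ha hb ha' hb' h
      refine ⟨e1, e2, e3, e4.imp_left fun e => ?_⟩
      rw [e, Nat.mod_eq_of_lt (by omega)]
    -- More than half a turn ahead: after adding a period, the first sector is less than half a turn
    -- ahead of the second.
    · right
      have h' : a' • ringPoint m r₀ r₁ j + b' • ringPoint m r₀ r₁ (j + 1)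
          = a • ringPoint m r₀ r₁ (i + 2 * m) + b • ringPoint m r₀ r₁ (i + 2 * m + 1) := by
        rw [add_right_comm, ringPoint_add_period (by omega), ringPoint_add_period (by omega), h]
      obtain ⟨e1, e2, e3, e4⟩ :=
        ring_sector_unique_of_lt hm h₀ h₁ (by omega) (by omega) ha' hb' ha hb h'
      refine ⟨e1, e2, e3, e4.imp_left fun e => ?_⟩
      rw [← e, Nat.add_mod_right, Nat.mod_eq_of_lt hi]
  rcases lt_trichotomy i j with hij | rfl | hij
  · exact Or.inr (key hi hj ha hb ha' hb' hij h)
  · left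
    have R := ringRadius_pos h₀ h₁
    have hm2 : (2 : ℝ) ≤ m := by exact_mod_cast hm
    have e0 := congrArg (ringCross m i) h
    have e1 := congrArg (ringCross m (i + 1)) h
    simp only [map_add, map_smul, ringCross_ringPoint, smul_eq_mul] at e0 e1
    push_cast at e0 e1
    have s1 := sin_step_pos hm (t := 1) one_pos (by linarith)
    have z0 : ((i : ℝ) - i) * (Real.pi / m) = 0 := by ring
    have z1 : ((i : ℝ) + 1 - (i + 1)) * (Real.pi / m) = 0 := by ring
    have z2 : ((i : ℝ) + 1 - i) * (Real.pi / m) = 1 * (Real.pi / m) := by ring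
    have z3 : ((i : ℝ) - (i + 1)) * (Real.pi / m) = -(1 * (Real.pi / m)) := by ring
    rw [z0, z2, Real.sin_zero] at e0
    rw [z1, z3, Real.sin_zero, Real.sin_neg] at e1
    have Ri := R i
    have Ri1 := R (i + 1)
    have m1 : (b - b') * (ringRadius r₀ r₁ (i + 1) * Real.sin (1 * (Real.pi / m))) = 0 := by
      linarith
    have m2 : (a - a') * (ringRadius r₀ r₁ i * Real.sin (1 * (Real.pi / m))) = 0 := by
      linarith
    have k1 := (mul_eq_zero.1 m1).resolve_right (by positivity)
    have k2 := (mul_eq_zero.1 m2).resolve_right (by positivity)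
    exact ⟨rfl, by linarith, by linarith⟩
  · exact Or.inr (key hj hi ha' hb' ha hb hij h.symm).symm

lemma ringPoint_injOn (hm : 2 ≤ m) (h₀ : 0 < r₀) (h₁ : 0 < r₁) {i j : ℕ} (hi : i < 2 * m)
    (hj : j < 2 * m) (h : ringPoint m r₀ r₁ i = ringPoint m r₀ r₁ j) : i = j := by
  have := ring_sector_unique (a := 1) (b := 0) (a' := 1) (b' := 0) hm h₀ h₁ hi hj zero_le_one
    le_rfl zero_le_one le_rfl (by simp [h])
  simp at this
  exact this

lemma ringPoint_mod (hm : 2 ≤ m) (i : ℕ) :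
    ringPoint m r₀ r₁ (i % (2 * m)) = ringPoint m r₀ r₁ i :=
  Function.Periodic.map_mod_nat (f := ringPoint m r₀ r₁)
    (fun j => ringPoint_add_period (by omega) j) i

lemma ringPoint_eq_iff (hm : 2 ≤ m) (h₀ : 0 < r₀) (h₁ : 0 < r₁) {i j : ℕ} :
    ringPoint m r₀ r₁ i = ringPoint m r₀ r₁ j ↔ i % (2 * m) = j % (2 * m) := by
  constructor
  · intro h
    rw [← ringPoint_mod hm i, ← ringPoint_mod hm j] at h
    exact ringPoint_injOn hm h₀ h₁ (Nat.mod_lt _ (by omega)) (Nat.mod_lt _ (by omega)) h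
  · intro h
    rw [← ringPoint_mod hm i, ← ringPoint_mod hm j, h]

/-- Three consecutive points of the ring are not collinear, except for one ratio of the radii. -/
lemma ringPoint_affineIndependent (hm : 2 ≤ m) (h₀ : 0 < r₀) (h₁ : 0 < r₁)
    (hc₀ : Real.cos (Real.pi / m) * r₀ ≠ r₁) (hc₁ : Real.cos (Real.pi / m) * r₁ ≠ r₀) (i : ℕ) :
    AffineIndependent ℝ ![ringPoint m r₀ r₁ i, ringPoint m r₀ r₁ (i + 1),
      ringPoint m r₀ r₁ (i + 2)] := by
  have R := ringRadius_pos h₀ h₁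
  have hm2 : (2 : ℝ) ≤ m := by exact_mod_cast hm
  have s1 := sin_step_pos hm (t := 1) one_pos (by linarith)
  rw [affineIndependent_iff_of_fintype]
  intro w hw0 hw
  rw [Finset.weightedVSub_eq_linear_combination _ hw0] at hw
  simp only [Fin.sum_univ_three, Matrix.cons_val_zero, Matrix.cons_val_one, Matrix.cons_val] at hw hw0
  -- Components across and along the middle direction. The first forces equal outer coefficients;
  -- the second then vanishes only trivially unless the middle vertex lies on the chord of its
  -- neighbours.
  have e0 := congrArg (ringCross m (i + 1)) hw
  have e1 := congrArg (ringDot m (i + 1)) hw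
  simp only [map_add, map_smul, ringCross_ringPoint, ringDot_ringPoint, smul_eq_mul, map_zero]
    at e0 e1
  push_cast at e0 e1
  have z1 : ((i : ℝ) + 1 - (i + 1)) * (Real.pi / m) = 0 := by ring
  have z2 : ((i : ℝ) + 2 - (i + 1)) * (Real.pi / m) = 1 * (Real.pi / m) := by ring
  have z3 : ((i : ℝ) - (i + 1)) * (Real.pi / m) = -(1 * (Real.pi / m)) := by ring
  rw [z1, z2, z3, Real.sin_zero, Real.sin_neg, ringRadius_add_two] at e0
  rw [z1, z2, z3, Real.cos_zero, Real.cos_neg, ringRadius_add_two, one_mul] at e1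
  have Ri := R i
  have m0 : (w 2 - w 0) * (ringRadius r₀ r₁ i * Real.sin (1 * (Real.pi / m))) = 0 := by
    linarith
  have k0 := (mul_eq_zero.1 m0).resolve_right (by positivity)
  have k1 : w 2 = w 0 := by linarith
  have k2 : w 1 = -2 * w 0 := by linarith
  have hne : Real.cos (Real.pi / m) * ringRadius r₀ r₁ i - ringRadius r₀ r₁ (i + 1) ≠ 0 := by
    rw [sub_ne_zero]
    unfold ringRadius
    by_cases hi : Even i <;> simp [hi, Nat.even_add_one] <;> assumption
  have m1 : 2 * w 0 * (Real.cos (Real.pi / m) * ringRadius r₀ r₁ i - ringRadius r₀ r₁ (i + 1)) = 0 := by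
    rw [k1, k2] at e1
    linarith
  have k3 := (mul_eq_zero.1 m1).resolve_right hne
  have k4 : w 0 = 0 := by linarith
  intro j
  fin_cases j
  · exact k4
  · change w 1 = 0
    rw [k2, k4, mul_zero]
  · exact k1.trans k4

/-- The polygon formed by a ring. -/
noncomputable def ringPolygon (m : ℕ) (r₀ r₁ : ℝ) : Polygon (E 2) (2 * m) :=
  ⟨fun i => ringPoint m r₀ r₁ i⟩

lemma ringPolygon_succ [NeZero (2 * m)] (hm : 2 ≤ m) (i : Fin (2 * m)) :
    ringPolygon m r₀ r₁ (i + 1) = ringPoint m r₀ r₁ (i + 1) := by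
  rw [← ringPoint_mod hm]
  change ringPoint m r₀ r₁ _ = _
  congr 1
  rw [Fin.val_add, Fin.val_one', Nat.add_mod_mod]

lemma isSimplePolygon_ringPolygon [NeZero (2 * m)] (hm : 2 ≤ m) (h₀ : 0 < r₀) (h₁ : 0 < r₁)
    (hc₀ : Real.cos (Real.pi / m) * r₀ ≠ r₁) (hc₁ : Real.cos (Real.pi / m) * r₁ ≠ r₀) :
    IsSimplePolygon (ringPolygon m r₀ r₁) := by
  refine ⟨fun i j h => Fin.ext (ringPoint_injOn hm h₀ h₁ i.2 j.2 h), fun i => ?_, ?_⟩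
  · have h2 : ringPolygon m r₀ r₁ (i + 2) = ringPoint m r₀ r₁ (i + 2) := by
      rw [← ringPoint_mod hm]
      change ringPoint m r₀ r₁ _ = _
      congr 1
      rw [Fin.val_add, show ((2 : Fin (2 * m)) : ℕ) = 2 % (2 * m) from rfl,
        Nat.add_mod_mod]
    have := ringPoint_affineIndependent hm h₀ h₁ hc₀ hc₁ i
    rw [← h2, ← ringPolygon_succ hm] at this
    exact this
  · rintro i j hij z ⟨⟨a, b, ha, hb, hab, hz⟩, ⟨a', b', ha', hb', hab', hz'⟩⟩
    rw [ringPolygon_succ hm] at hz hz'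
    have h := ring_sector_unique hm h₀ h₁ i.2 j.2 ha hb ha' hb' (hz.trans hz'.symm)
    have hval : ∀ i : Fin (2 * m), ((i + 1 : Fin (2 * m)) : ℕ) = (i + 1) % (2 * m) := fun i => by
      rw [Fin.val_add, Fin.val_one', Nat.add_mod_mod]
    rw [← ringPolygon_succ hm] at hz hz'
    rcases h with ⟨h, -⟩ | ⟨h1, h2, h3, h4⟩ | ⟨h1, h2, h3, h4⟩
    · exact absurd (Fin.ext h) hij
    · have hb1 : b = 1 := by linarith
      have ha1 : a' = 1 := by linarith
      have hj : j = i + 1 := by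
        apply Fin.ext
        rw [hval]
        exact h4.resolve_right (by rw [hb1]; norm_num)
      have hz1 : z = ringPolygon m r₀ r₁ (i + 1) := by
        rw [← hz, h1, hb1]; simp
      rw [hz1, hj]
      simp
    · have hb1 : b' = 1 := by linarith
      have ha1 : a = 1 := by linarith
      have hj : i = j + 1 := by
        apply Fin.ext
        rw [hval]
        exact h4.resolve_right (by rw [hb1]; norm_num)
      have hz1 : z = ringPolygon m r₀ r₁ (j + 1) := by
        rw [← hz', h1, hb1]; simp
      rw [hz1, hj]
      simp

end AngleDefect


/-! ### The bipyramid over a ring as a complex. -/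

namespace AngleDefect
open Set Filter Topology
open scoped EuclideanGeometry

/-- The point at height `z` on the axis. -/
noncomputable def apex (z : ℝ) : E 3 := !₂[0, 0, z]

/-- The projection of space to the plane. -/
noncomputable def planeProj : E 3 →ₗ[ℝ] E 2 where
  toFun v := !₂[v 0, v 1]
  map_add' v w := by ext i; fin_cases i <;> simp
  map_smul' a v := by ext i; fin_cases i <;> simp

/-- The third coordinate. -/
noncomputable def height : E 3 →ₗ[ℝ] ℝ where
  toFun v := v 2
  map_add' v w := by simp
  map_smul' a v := by simp

@[simp] lemma planeProj_apex (z : ℝ) : planeProj (apex z) = 0 := by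
  ext i; fin_cases i <;> simp [planeProj, apex]

@[simp] lemma planeProj_planeIncl (v : E 2) : planeProj (planeIncl v) = v := by
  ext i; fin_cases i <;> simp [planeProj, planeIncl]

@[simp] lemma height_apex (z : ℝ) : height (apex z) = z := rfl

@[simp] lemma height_planeIncl (v : E 2) : height (planeIncl v) = 0 := rfl

lemma planeIncl_injective : Function.Injective planeIncl :=
  Function.LeftInverse.injective planeProj_planeIncl

lemma apex_ne_planeIncl {z : ℝ} (hz : z ≠ 0) (v : E 2) : apex z ≠ planeIncl v := fun h => by
  have := congrArg height h
  simp at this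
  exact hz this

lemma apex_injective : Function.Injective apex :=
  Function.LeftInverse.injective height_apex

lemma eq_sum_single_of_support_subset {α : Type*} [DecidableEq α] {w : α →₀ ℝ} {p q r : α}
    (hpq : p ≠ q) (hpr : p ≠ r) (hqr : q ≠ r) (h : w.support ⊆ {p, q, r}) :
    w = Finsupp.single p (w p) + (Finsupp.single q (w q) + Finsupp.single r (w r)) := by
  ext z
  by_cases hz : z ∈ ({p, q, r} : Finset α)
  · simp only [Finset.mem_insert, Finset.mem_singleton] at hz
    rcases hz with rfl | rfl | rfl <;> simp [*, hpq.symm, hpr.symm, hqr.symm]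
  · have : w z = 0 := by
      by_contra h0
      exact hz (h (Finsupp.mem_support_iff.2 h0))
    simp only [Finset.mem_insert, Finset.mem_singleton, not_or] at hz
    simp [this, Ne.symm hz.1, Ne.symm hz.2.1, Ne.symm hz.2.2]

variable {m : ℕ} {r₀ r₁ h : ℝ}

/-- The ring points in space. -/
noncomputable def rim (m : ℕ) (r₀ r₁ : ℝ) (j : ℕ) : E 3 := planeIncl (ringPoint m r₀ r₁ j)

lemma rim_eq_iff (hm : 2 ≤ m) (h₀ : 0 < r₀) (h₁ : 0 < r₁) {i j : ℕ} :
    rim m r₀ r₁ i = rim m r₀ r₁ j ↔ i % (2 * m) = j % (2 * m) :=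
  planeIncl_injective.eq_iff.trans (ringPoint_eq_iff hm h₀ h₁)

lemma apex_ne_rim {z : ℝ} (hz : z ≠ 0) (i : ℕ) : apex z ≠ rim m r₀ r₁ i :=
  apex_ne_planeIncl hz _

lemma rim_mod (hm : 2 ≤ m) (i : ℕ) : rim m r₀ r₁ (i % (2 * m)) = rim m r₀ r₁ i := by
  rw [rim, ringPoint_mod hm, rim]

lemma rim_mod_succ (hm : 2 ≤ m) (i : ℕ) :
    rim m r₀ r₁ (i % (2 * m) + 1) = rim m r₀ r₁ (i + 1) := by
  rw [← rim_mod hm, Nat.mod_add_mod, rim_mod hm]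

lemma rim_ne_succ (hm : 2 ≤ m) (h₀ : 0 < r₀) (h₁ : 0 < r₁) (i : ℕ) :
    rim m r₀ r₁ i ≠ rim m r₀ r₁ (i + 1) := by
  intro h
  rw [rim_eq_iff hm h₀ h₁] at h
  have h := (Nat.modEq_iff_dvd.1 (show i ≡ i + 1 [MOD 2 * m] from h))
  push_cast at h
  simp only [add_sub_cancel_left] at h
  have := Int.le_of_dvd one_pos h
  omega

open Classical in
/-- The simplices of the bipyramid over a ring, with apices at the heights `h` and `-h`. -/
def bipyramidFaces (m : ℕ) (r₀ r₁ h : ℝ) : Set (Finset (E 3)) :=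
  {s | s.Nonempty ∧ ∃ i : ℕ, ∃ z : ℝ, (z = h ∨ z = -h) ∧
    s ⊆ {apex z, rim m r₀ r₁ i, rim m r₀ r₁ (i + 1)}}

lemma exists_lt_of_mem_bipyramidFaces (hm : 2 ≤ m) {s : Finset (E 3)}
    (hs : s ∈ bipyramidFaces m r₀ r₁ h) :
    s.Nonempty ∧ ∃ i < 2 * m, ∃ z : ℝ, (z = h ∨ z = -h) ∧
    s ⊆ {apex z, rim m r₀ r₁ i, rim m r₀ r₁ (i + 1)} := by
  obtain ⟨hs0, i, z, hz, hs⟩ := hs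
  refine ⟨hs0, i % (2 * m), Nat.mod_lt _ (by omega), z, hz, ?_⟩
  rw [rim_mod hm, rim_mod_succ hm]
  exact hs

/-- The height determines the apex weights, since opposite apices have heights of opposite sign. The
apices project to the origin, so the rim weights are determined in the plane by
`ring_sector_unique`. -/
lemma bipyramid_unique (hm : 2 ≤ m) (h₀ : 0 < r₀) (h₁ : 0 < r₁) (hh : 0 < h) {w w' : E 3 →₀ ℝ}
    (hw : IsWeight w) (hw' : IsWeight w') (hs : w.support ∈ bipyramidFaces m r₀ r₁ h)
    (hs' : w'.support ∈ bipyramidFaces m r₀ r₁ h) (heq : bary w = bary w') : w = w' := by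
  classical
  obtain ⟨-, i, hi, z, hz, hs⟩ := exists_lt_of_mem_bipyramidFaces hm hs
  obtain ⟨-, j, hj, z', hz', hs'⟩ := exists_lt_of_mem_bipyramidFaces hm hs'
  have hz0 : z ≠ 0 := by rcases hz with rfl | rfl <;> simp [hh.ne']
  have hz0' : z' ≠ 0 := by rcases hz' with rfl | rfl <;> simp [hh.ne']
  have e := eq_sum_single_of_support_subset (apex_ne_rim hz0 _) (apex_ne_rim hz0 _)
    (rim_ne_succ hm h₀ h₁ i) (by convert hs)
  have e' := eq_sum_single_of_support_subset (apex_ne_rim hz0' _) (apex_ne_rim hz0' _)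
    (rim_ne_succ hm h₀ h₁ j) (by convert hs')
  have ha := hw.nonneg (rim m r₀ r₁ i)
  have hb := hw.nonneg (rim m r₀ r₁ (i + 1))
  have ht := hw.nonneg (apex z)
  have ha' := hw'.nonneg (rim m r₀ r₁ j)
  have hb' := hw'.nonneg (rim m r₀ r₁ (j + 1))
  have ht' := hw'.nonneg (apex z')
  generalize w (apex z) = t at *
  generalize w (rim m r₀ r₁ i) = a at *
  generalize w (rim m r₀ r₁ (i + 1)) = b at *
  generalize w' (apex z') = t' at *
  generalize w' (rim m r₀ r₁ j) = a' at *
  generalize w' (rim m r₀ r₁ (j + 1)) = b' at *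
  subst e e'
  simp only [map_add, bary_single] at heq
  have q1 := congrArg height heq
  have q2 := congrArg planeProj heq
  simp only [map_add, map_smul, rim, height_apex, height_planeIncl, planeProj_apex,
    planeProj_planeIncl, smul_zero, mul_zero, add_zero, zero_add, smul_eq_mul] at q1 q2
  congr 1
  · rcases hz with rfl | rfl <;> rcases hz' with rfl | rfl
    · rw [mul_right_cancel₀ hz0' q1]
    · have : t = 0 := by nlinarith
      have : t' = 0 := by nlinarith
      simp [*]
    · have : t = 0 := by nlinarith
      have : t' = 0 := by nlinarith
      simp [*]
    · rw [mul_right_cancel₀ hz0' q1]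
  · rcases ring_sector_unique hm h₀ h₁ hi hj ha hb ha' hb' q2 with
      ⟨rfl, rfl, rfl⟩ | ⟨rfl, rfl, rfl, h4⟩ | ⟨rfl, rfl, rfl, h4⟩
    · rfl
    · rcases h4 with rfl | rfl
      · rw [rim_mod hm]; simp
      · simp
    · rcases h4 with rfl | rfl
      · rw [rim_mod hm]; simp
      · simp

lemma finite_bipyramidFaces (hm : 2 ≤ m) : (bipyramidFaces m r₀ r₁ h).Finite := by
  classical
  have hfin : (((insert (apex h) (insert (apex (-h))
    ((Finset.range (2 * m)).image (rim m r₀ r₁)))).powerset : Finset (Finset (E 3))) :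
      Set (Finset (E 3))).Finite := Finset.finite_toSet _
  refine hfin.subset fun s hs => ?_
  obtain ⟨-, i, hi, z, hz, hs⟩ := exists_lt_of_mem_bipyramidFaces hm hs
  rw [Finset.mem_coe, Finset.mem_powerset]
  intro q hq
  have hq := hs hq
  simp only [Finset.mem_insert, Finset.mem_singleton, Finset.mem_image, Finset.mem_range] at hq ⊢
  rcases hq with rfl | rfl | rfl
  · rcases hz with rfl | rfl <;> simp
  · exact Or.inr (Or.inr ⟨i, hi, rfl⟩)
  · exact Or.inr (Or.inr ⟨(i + 1) % (2 * m), Nat.mod_lt _ (by omega), rim_mod hm _⟩)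

/-- The bipyramid over a ring, with apices at the heights `h` and `-h`. -/
noncomputable def bipyramid (hm : 2 ≤ m) (h₀ : 0 < r₀) (h₁ : 0 < r₁) (hh : 0 < h) : Cplx 3 :=
  Cplx.ofUnique (bipyramidFaces m r₀ r₁ h) (finite_bipyramidFaces hm)
    (fun _ ⟨_, _, _, _, hs⟩ => (Finset.card_le_card hs).trans Finset.card_le_three)
    (fun _ hs => hs.1)
    (fun _ ⟨_, i, z, hz, hs⟩ _ hts ht => ⟨ht, i, z, hz, hts.trans hs⟩)
    (fun _ _ hw hw' hs hs' heq => bipyramid_unique hm h₀ h₁ hh hw hw' hs hs' heq)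

lemma bipyramid_faces (hm : 2 ≤ m) (h₀ : 0 < r₀) (h₁ : 0 < r₁) (hh : 0 < h) :
    (bipyramid hm h₀ h₁ hh).faces = bipyramidFaces m r₀ r₁ h := rfl

lemma isBipyramid_bipyramid (hm : 2 ≤ m) (h₀ : 0 < r₀) (h₁ : 0 < r₁) (hh : 0 < h)
    (hc₀ : Real.cos (Real.pi / m) * r₀ ≠ r₁) (hc₁ : Real.cos (Real.pi / m) * r₁ ≠ r₀) :
    IsBipyramid (bipyramid hm h₀ h₁ hh) := by
  classical
  have : NeZero (2 * m) := ⟨by omega⟩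
  refine ⟨2 * m, inferInstance, ringPolygon m r₀ r₁, apex h, apex (-h),
    isSimplePolygon_ringPolygon hm h₀ h₁ hc₀ hc₁, by simpa [apex] using hh, by simpa [apex] using hh,
    fun s => ?_⟩
  rw [bipyramid_faces]
  have hsucc : ∀ i : Fin (2 * m), planeIncl (ringPolygon m r₀ r₁ (i + 1)) = rim m r₀ r₁ (i + 1) :=
    fun i => by rw [ringPolygon_succ hm, rim]
  have hself : ∀ i : Fin (2 * m), planeIncl (ringPolygon m r₀ r₁ i) = rim m r₀ r₁ i :=
    fun _ => rfl
  constructor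
  · intro hs
    obtain ⟨hs0, i, hi, z, hz, hs'⟩ := exists_lt_of_mem_bipyramidFaces hm hs
    refine ⟨hs0, ⟨i, hi⟩, ?_⟩
    rw [hsucc, hself]
    rcases hz with hz | hz <;> rw [hz] at hs'
    · exact Or.inl (by convert hs')
    · exact Or.inr (by convert hs')
  · rintro ⟨hs0, i, hs⟩
    rw [hsucc, hself] at hs
    rcases hs with hs | hs
    · exact ⟨hs0, i, h, Or.inl rfl, by convert hs⟩
    · exact ⟨hs0, i, -h, Or.inr rfl, by convert hs⟩

end AngleDefect


/-! ### Angle sums in bipyramids. -/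

namespace AngleDefect
open Set Filter Topology
open scoped EuclideanGeometry

section Cyclic

variable {V : Type*} [DecidableEq V] {n : ℕ} {P : ℕ → V} {a b : V}

lemma succ_mod_of_lt {i : ℕ} (hi : i < n) : (i + 1) % n = if i + 1 = n then 0 else i + 1 := by
  split_ifs with h
  · rw [h, Nat.mod_self]
  · exact Nat.mod_eq_of_lt (by omega)

/-- Membership of a cyclic vertex in the triangles of a cone over a cycle. -/
lemma succ_mem_cone_triangle (hP : ∀ i j, P i = P j ↔ i % n = j % n)
    (ha : ∀ i, a ≠ P i) {i j : ℕ} (hj : j < n) (hi : i < n) :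
    P (j + 1) ∈ ({a, P i, P (i + 1)} : Finset V) ↔ i = j ∨ i = (j + 1) % n := by
  simp only [Finset.mem_insert, Finset.mem_singleton, (ha _).symm, false_or, hP]
  rw [succ_mod_of_lt hi, succ_mod_of_lt hj, Nat.mod_eq_of_lt hi]
  grind

lemma cone_triangle_injOn (hn : 4 ≤ n) (hP : ∀ i j, P i = P j ↔ i % n = j % n)
    (ha : ∀ i, a ≠ P i) {i j : ℕ} (hi : i < n) (hj : j < n)
    (h : ({a, P i, P (i + 1)} : Finset V) = {a, P j, P (j + 1)}) : i = j := by
  have h1 := (succ_mem_cone_triangle hP ha hi hj).1 (h ▸ by simp)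
  have h2 := (succ_mem_cone_triangle hP ha hj hi).1 (h ▸ by simp)
  rw [succ_mod_of_lt hi] at h1
  rw [succ_mod_of_lt hj] at h2
  split_ifs at * <;> omega

lemma card_cone_triangle (hn : 4 ≤ n) (hP : ∀ i j, P i = P j ↔ i % n = j % n)
    (ha : ∀ i, a ≠ P i) {i : ℕ} (hi : i < n) : ({a, P i, P (i + 1)} : Finset V).card = 3 := by
  refine Finset.card_eq_three.2 ⟨a, P i, P (i + 1), ha _, ha _, fun h => ?_, rfl⟩
  rw [hP, succ_mod_of_lt hi, Nat.mod_eq_of_lt hi] at h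
  split_ifs at h <;> omega

lemma sum_range_alternating (A B : ℝ) (m : ℕ) :
    ∑ j ∈ Finset.range (2 * m), (if Even j then A else B) = m * A + m * B := by
  induction m with
  | zero => simp
  | succ k ih =>
    rw [Nat.mul_succ, Finset.sum_range_succ, Finset.sum_range_succ, ih]
    simp
    ring

end Cyclic

variable {m : ℕ} {r₀ r₁ h : ℝ}

/-- The angle at the apex of the triangles of a bipyramid over a ring. -/
noncomputable def apexAngle (m : ℕ) (r s h : ℝ) : ℝ :=
  Real.arccos ((r * s * Real.cos (Real.pi / m) + h ^ 2) / (√(r ^ 2 + h ^ 2) * √(s ^ 2 + h ^ 2)))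

/-- The angle at a rim vertex with distance `r` of the triangles of a bipyramid over a ring. -/
noncomputable def rimAngle (m : ℕ) (r s h : ℝ) : ℝ :=
  Real.arccos ((r ^ 2 - r * s * Real.cos (Real.pi / m)) /
    (√(r ^ 2 + h ^ 2) * √(r ^ 2 + s ^ 2 - 2 * r * s * Real.cos (Real.pi / m))))

lemma apexAngle_comm (m : ℕ) (r s h : ℝ) : apexAngle m r s h = apexAngle m s r h := by
  rw [apexAngle, apexAngle, mul_comm r s, mul_comm √(r ^ 2 + h ^ 2)]

lemma cos_sub_step (a b : ℕ) (hab : a = b + 1 ∨ b = a + 1) :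
    Real.cos (a * (Real.pi / m)) * Real.cos (b * (Real.pi / m))
      + Real.sin (a * (Real.pi / m)) * Real.sin (b * (Real.pi / m)) = Real.cos (Real.pi / m) := by
  rw [← Real.cos_sub]
  rcases hab with rfl | rfl
  · congr 1; push_cast; ring
  · rw [← Real.cos_neg]
    congr 1; push_cast; ring

lemma angle_apex_eq {z : ℝ} (hz : z ^ 2 = h ^ 2) (i : ℕ) :
    ∠ (rim m r₀ r₁ i) (apex z) (rim m r₀ r₁ (i + 1)) =
      apexAngle m (ringRadius r₀ r₁ i) (ringRadius r₀ r₁ (i + 1)) h := by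
  have hc := cos_sub_step (m := m) i (i + 1) (Or.inr rfl)
  have h1 := Real.sin_sq_add_cos_sq (i * (Real.pi / m))
  have h2 := Real.sin_sq_add_cos_sq (((i + 1 : ℕ) : ℝ) * (Real.pi / m))
  rw [EuclideanGeometry.angle, InnerProductGeometry.angle, apexAngle, ← hc]
  congr 2
  · simp only [rim, apex, ringPoint, planeIncl, vsub_eq_sub, PiLp.inner_apply, Fin.sum_univ_three]
    simp
    linear_combination hz
  · rw [EuclideanSpace.norm_eq, EuclideanSpace.norm_eq]
    simp only [rim, apex, ringPoint, planeIncl, vsub_eq_sub, Fin.sum_univ_three, Real.norm_eq_abs,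
      sq_abs]
    congr 2
    · simp
      linear_combination hz + ringRadius r₀ r₁ i ^ 2 * h1
    · simp only [PiLp.sub_apply, Matrix.cons_val_zero, Matrix.cons_val_one, Matrix.cons_val]
      linear_combination hz + ringRadius r₀ r₁ (i + 1) ^ 2 * h2

lemma angle_rim_eq {z : ℝ} (hz : z ^ 2 = h ^ 2) {a b : ℕ}
    (hab : a = b + 1 ∨ b = a + 1) :
    ∠ (apex z) (rim m r₀ r₁ a) (rim m r₀ r₁ b) =
      rimAngle m (ringRadius r₀ r₁ a) (ringRadius r₀ r₁ b) h := by
  have hc := cos_sub_step (m := m) a b hab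
  have h1 := Real.sin_sq_add_cos_sq (a * (Real.pi / m))
  have h2 := Real.sin_sq_add_cos_sq (b * (Real.pi / m))
  rw [EuclideanGeometry.angle, InnerProductGeometry.angle, rimAngle, ← hc]
  congr 2
  · simp only [rim, apex, ringPoint, planeIncl, vsub_eq_sub, PiLp.inner_apply, Fin.sum_univ_three]
    simp
    linear_combination ringRadius r₀ r₁ a ^ 2 * h1
  · rw [EuclideanSpace.norm_eq, EuclideanSpace.norm_eq]
    simp only [rim, apex, ringPoint, planeIncl, vsub_eq_sub, Fin.sum_univ_three, Real.norm_eq_abs,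
      sq_abs]
    congr 2
    · simp
      linear_combination hz + ringRadius r₀ r₁ a ^ 2 * h1
    · simp
      linear_combination ringRadius r₀ r₁ a ^ 2 * h1 + ringRadius r₀ r₁ b ^ 2 * h2

open Classical in
lemma angleAt_apex (hm : 2 ≤ m) (h₀ : 0 < r₀) (h₁ : 0 < r₁) (hh : 0 < h) {z : ℝ}
    (hz : z = h ∨ z = -h) (i : ℕ) :
    angleAt (apex z) {apex z, rim m r₀ r₁ i, rim m r₀ r₁ (i + 1)} =
      apexAngle m r₀ r₁ h / (2 * Real.pi) := by
  have hz0 : z ≠ 0 := by rcases hz with rfl | rfl <;> simp [hh.ne']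
  have hz2 : z ^ 2 = h ^ 2 := by rcases hz with rfl | rfl <;> simp
  rw [angleAt_eq (apex_ne_rim hz0 _) (apex_ne_rim hz0 _) (rim_ne_succ hm h₀ h₁ i),
    angle_apex_eq hz2]
  congr 1
  by_cases hi : Even i <;> simp [ringRadius, hi, Nat.even_add_one]
  exact apexAngle_comm _ _ _ _

open Classical in
lemma angleAt_rim (hm : 2 ≤ m) (h₀ : 0 < r₀) (h₁ : 0 < r₁) (hh : 0 < h) {z : ℝ}
    (hz : z = h ∨ z = -h) (i : ℕ) :
    angleAt (rim m r₀ r₁ i) {apex z, rim m r₀ r₁ i, rim m r₀ r₁ (i + 1)} =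
      rimAngle m (ringRadius r₀ r₁ i) (ringRadius r₀ r₁ (i + 1)) h / (2 * Real.pi) := by
  have hz0 : z ≠ 0 := by rcases hz with rfl | rfl <;> simp [hh.ne']
  have hz2 : z ^ 2 = h ^ 2 := by rcases hz with rfl | rfl <;> simp
  rw [Finset.insert_comm, angleAt_eq (apex_ne_rim hz0 _).symm (rim_ne_succ hm h₀ h₁ i)
    (apex_ne_rim hz0 _), angle_rim_eq hz2 (Or.inr rfl)]

open Classical in
lemma angleAt_rim_succ (hm : 2 ≤ m) (h₀ : 0 < r₀) (h₁ : 0 < r₁) (hh : 0 < h) {z : ℝ}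
    (hz : z = h ∨ z = -h) (i : ℕ) :
    angleAt (rim m r₀ r₁ (i + 1)) {apex z, rim m r₀ r₁ i, rim m r₀ r₁ (i + 1)} =
      rimAngle m (ringRadius r₀ r₁ (i + 1)) (ringRadius r₀ r₁ i) h / (2 * Real.pi) := by
  have hz0 : z ≠ 0 := by rcases hz with rfl | rfl <;> simp [hh.ne']
  have hz2 : z ^ 2 = h ^ 2 := by rcases hz with rfl | rfl <;> simp
  rw [Finset.pair_comm (rim m r₀ r₁ i), Finset.insert_comm,
    angleAt_eq (apex_ne_rim hz0 _).symm (rim_ne_succ hm h₀ h₁ i).symm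
    (apex_ne_rim hz0 _), angle_rim_eq hz2 (Or.inl rfl)]

open Classical in
lemma mem_trianglesAt_bipyramid (hm : 2 ≤ m) (h₀ : 0 < r₀) (h₁ : 0 < r₁) (hh : 0 < h) {v : E 3}
    {s : Finset (E 3)} :
    s ∈ (bipyramid hm h₀ h₁ hh).trianglesAt v ↔ v ∈ s ∧ ∃ i < 2 * m, ∃ z : ℝ, (z = h ∨ z = -h) ∧
      s = {apex z, rim m r₀ r₁ i, rim m r₀ r₁ (i + 1)} := by
  simp only [Cplx.trianglesAt, Finset.mem_filter, Finite.mem_toFinset, bipyramid_faces]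
  constructor
  · rintro ⟨hs, h3, hv⟩
    obtain ⟨-, i, hi, z, hz, hs⟩ := exists_lt_of_mem_bipyramidFaces hm hs
    refine ⟨hv, i, hi, z, hz, Finset.eq_of_subset_of_card_le (by convert hs) ?_⟩
    rw [h3]
    exact Finset.card_le_three
  · rintro ⟨hv, i, hi, z, hz, rfl⟩
    have hz0 : z ≠ 0 := by rcases hz with rfl | rfl <;> simp [hh.ne']
    refine ⟨⟨⟨_, hv⟩, i, z, hz, by convert Finset.Subset.refl _⟩, ?_, hv⟩
    exact card_cone_triangle (n := 2 * m) (by omega) (fun i j => rim_eq_iff hm h₀ h₁)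
      (fun i => apex_ne_rim hz0 i) hi

lemma angleSum_bipyramid_apex (hm : 2 ≤ m) (h₀ : 0 < r₀) (h₁ : 0 < r₁) (hh : 0 < h) {z : ℝ}
    (hz : z = h ∨ z = -h) :
    angleSum (bipyramid hm h₀ h₁ hh) (apex z) =
      2 * m * (apexAngle m r₀ r₁ h / (2 * Real.pi)) := by
  classical
  have hz0 : z ≠ 0 := by rcases hz with rfl | rfl <;> simp [hh.ne']
  have himage : (bipyramid hm h₀ h₁ hh).trianglesAt (apex z) = (Finset.range (2 * m)).image
      fun i => {apex z, rim m r₀ r₁ i, rim m r₀ r₁ (i + 1)} := by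
    ext s
    rw [mem_trianglesAt_bipyramid]
    simp only [Finset.mem_image, Finset.mem_range]
    constructor
    · rintro ⟨hv, i, hi, z', hz', rfl⟩
      simp only [Finset.mem_insert, Finset.mem_singleton, apex_ne_rim hz0, or_false] at hv
      exact ⟨i, hi, by rw [hv]⟩
    · rintro ⟨i, hi, rfl⟩
      exact ⟨by simp, i, hi, z, hz, rfl⟩
  rw [angleSum, himage, Finset.sum_image]
  · rw [Finset.sum_congr rfl fun i _ => angleAt_apex hm h₀ h₁ hh hz i]
    simp
  · intro i hi j hj hij
    rw [Finset.coe_range, mem_Iio] at hi hj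
    exact cone_triangle_injOn (n := 2 * m) (by omega) (fun i j => rim_eq_iff hm h₀ h₁)
      (fun i => apex_ne_rim hz0 i) hi hj hij

/-- Two triangles at each apex contain the rim vertex, and all four have the same angle there
because its two neighbours have the same radius. -/
lemma angleSum_bipyramid_rim (hm : 2 ≤ m) (h₀ : 0 < r₀) (h₁ : 0 < r₁) (hh : 0 < h) {j : ℕ}
    (hj : j < 2 * m) :
    angleSum (bipyramid hm h₀ h₁ hh) (rim m r₀ r₁ (j + 1)) =
      4 * (rimAngle m (ringRadius r₀ r₁ (j + 1)) (ringRadius r₀ r₁ j) h / (2 * Real.pi)) := by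
  classical
  have hne : ∀ {z : ℝ}, (z = h ∨ z = -h) → z ≠ 0 := by
    rintro z (rfl | rfl) <;> simp [hh.ne']
  have himage : (bipyramid hm h₀ h₁ hh).trianglesAt (rim m r₀ r₁ (j + 1)) =
      (({h, -h} : Finset ℝ) ×ˢ ({j, (j + 1) % (2 * m)} : Finset ℕ)).image
      fun p => {apex p.1, rim m r₀ r₁ p.2, rim m r₀ r₁ (p.2 + 1)} := by
    ext s
    rw [mem_trianglesAt_bipyramid]
    simp only [Finset.mem_image, Finset.mem_product, Finset.mem_insert, Finset.mem_singleton,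
      Prod.exists]
    constructor
    · rintro ⟨hv, i, hi, z, hz, rfl⟩
      rw [succ_mem_cone_triangle (n := 2 * m) (fun i j => rim_eq_iff hm h₀ h₁)
        (fun i => apex_ne_rim (hne hz) i) hj hi] at hv
      exact ⟨z, i, ⟨hz, hv⟩, rfl⟩
    · rintro ⟨z, i, ⟨hz, hi⟩, rfl⟩
      have hi' : i < 2 * m := by
        rcases hi with rfl | rfl
        exacts [hj, Nat.mod_lt _ (by omega)]
      exact ⟨(succ_mem_cone_triangle (n := 2 * m) (fun i j => rim_eq_iff hm h₀ h₁)
        (fun i => apex_ne_rim (hne hz) i) hj hi').2 hi, i, hi', z, hz, rfl⟩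
  have hjne : j ≠ (j + 1) % (2 * m) := by
    rw [succ_mod_of_lt hj]; split_ifs <;> omega
  have hhne : h ≠ -h := by linarith
  rw [angleSum, himage, Finset.sum_image]
  · rw [Finset.sum_product, Finset.sum_pair hhne, Finset.sum_pair hjne, Finset.sum_pair hjne]
    simp only [rim_mod hm, rim_mod_succ hm]
    rw [angleAt_rim_succ hm h₀ h₁ hh (Or.inl rfl), angleAt_rim_succ hm h₀ h₁ hh (Or.inr rfl),
      angleAt_rim hm h₀ h₁ hh (Or.inl rfl), angleAt_rim hm h₀ h₁ hh (Or.inr rfl),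
      ringRadius_add_two]
    ring
  · rintro ⟨z, i⟩ hp ⟨z', i'⟩ hp' hij
    simp only [Finset.coe_product, Finset.coe_insert, Finset.coe_singleton, mem_prod,
      mem_insert_iff, mem_singleton_iff] at hp hp'
    have hlt : ∀ {i : ℕ}, (i = j ∨ i = (j + 1) % (2 * m)) → i < 2 * m := by
      rintro i (rfl | rfl)
      exacts [hj, Nat.mod_lt _ (by omega)]
    dsimp only at hij
    have hz : apex z ∈ ({apex z', rim m r₀ r₁ i', rim m r₀ r₁ (i' + 1)} : Finset (E 3)) := by
      rw [← hij]; simp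
    simp only [Finset.mem_insert, Finset.mem_singleton, apex_ne_rim (hne hp.1), or_false] at hz
    have hz := apex_injective hz
    subst hz
    have := cone_triangle_injOn (n := 2 * m) (by omega) (fun i j => rim_eq_iff hm h₀ h₁)
      (fun i => apex_ne_rim (hne hp.1) i) (hlt hp.2) (hlt hp'.2) hij
    rw [this]

lemma bipyramid_mem_vertices (hm : 2 ≤ m) (h₀ : 0 < r₀) (h₁ : 0 < r₁) (hh : 0 < h) {v : E 3} :
    v ∈ (bipyramid hm h₀ h₁ hh).vertices ↔
      v = apex h ∨ v = apex (-h) ∨ ∃ j < 2 * m, v = rim m r₀ r₁ (j + 1) := by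
  classical
  change {v} ∈ bipyramidFaces m r₀ r₁ h ↔ _
  constructor
  · intro hv
    obtain ⟨-, i, hi, z, hz, hs⟩ := exists_lt_of_mem_bipyramidFaces hm hv
    have hv : v ∈ ({apex z, rim m r₀ r₁ i, rim m r₀ r₁ (i + 1)} : Finset (E 3)) := by
      have := hs (Finset.mem_singleton_self v)
      convert this
    simp only [Finset.mem_insert, Finset.mem_singleton] at hv
    rcases hv with rfl | rfl | rfl
    · rcases hz with rfl | rfl <;> simp
    -- The predecessor of `i` modulo `2 * m`; the added period keeps the subtraction from truncating
    -- at `i = 0`.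
    · refine Or.inr (Or.inr ⟨(i + 2 * m - 1) % (2 * m), Nat.mod_lt _ (by omega), ?_⟩)
      rw [rim_mod_succ hm, show i + 2 * m - 1 + 1 = i + 2 * m by omega, ← rim_mod hm,
        ← rim_mod hm (i + 2 * m), Nat.add_mod_right]
    · exact Or.inr (Or.inr ⟨i, hi, rfl⟩)
  · rintro (rfl | rfl | ⟨j, -, rfl⟩)
    · exact ⟨by simp, 0, h, Or.inl rfl, by simp⟩
    · exact ⟨by simp, 0, -h, Or.inr rfl, by simp⟩
    · exact ⟨by simp, j, h, Or.inl rfl, by simp⟩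

/-- A sum over the vertices of a bipyramid. -/
lemma sum_verts_bipyramid (hm : 2 ≤ m) (h₀ : 0 < r₀) (h₁ : 0 < r₁) (hh : 0 < h) (F : E 3 → ℝ) :
    ∑ v ∈ (bipyramid hm h₀ h₁ hh).verts, F v = F (apex h) + F (apex (-h)) +
      ∑ j ∈ Finset.range (2 * m), F (rim m r₀ r₁ (j + 1)) := by
  classical
  have hverts : (bipyramid hm h₀ h₁ hh).verts = insert (apex h) (insert (apex (-h))
      ((Finset.range (2 * m)).image fun j => rim m r₀ r₁ (j + 1))) := by
    ext v
    simp only [Cplx.verts, Finite.mem_toFinset, bipyramid_mem_vertices, Finset.mem_insert,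
      Finset.mem_image, Finset.mem_range]
    simp only [eq_comm]
  have hhne : apex h ≠ apex (-h) := fun e => by
    have := apex_injective e
    linarith
  rw [hverts, Finset.sum_insert, Finset.sum_insert, Finset.sum_image, add_assoc]
  · intro i hi j hj hij
    rw [Finset.coe_range, mem_Iio] at hi hj
    dsimp only at hij
    rw [rim_eq_iff hm h₀ h₁, succ_mod_of_lt hi, succ_mod_of_lt hj] at hij
    split_ifs at hij <;> omega
  · simp [Ne.symm (apex_ne_rim (m := m) (r₀ := r₀) (r₁ := r₁) (neg_ne_zero.2 hh.ne') _)]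
  · simp [hhne, Ne.symm (apex_ne_rim (m := m) (r₀ := r₀) (r₁ := r₁) hh.ne' _)]

/-- The angles of the triangles of a bipyramid over a ring add up to half a turn. -/
lemma apexAngle_add_rimAngle (hh : 0 < h) :
    apexAngle m r₀ r₁ h + rimAngle m r₀ r₁ h + rimAngle m r₁ r₀ h = Real.pi := by
  have e0 := angle_apex_eq (r₀ := r₀) (r₁ := r₁) (m := m) (rfl : h ^ 2 = h ^ 2) 0
  have e1 := angle_rim_eq (r₀ := r₀) (r₁ := r₁) (m := m) (rfl : h ^ 2 = h ^ 2)
    (a := 0) (b := 1) (Or.inr rfl)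
  have e2 := angle_rim_eq (r₀ := r₀) (r₁ := r₁) (m := m) (rfl : h ^ 2 = h ^ 2)
    (a := 1) (b := 0) (Or.inl rfl)
  have key := EuclideanGeometry.angle_add_angle_add_angle_eq_pi (p₁ := rim m r₀ r₁ 0)
    (p₂ := apex h) (rim m r₀ r₁ 1) (apex_ne_rim hh.ne' _)
  simp [ringRadius] at e0 e1 e2
  rw [← e0, ← e1, ← e2]
  linarith [EuclideanGeometry.angle_comm (rim m r₀ r₁ 0) (rim m r₀ r₁ 1) (apex h),
    EuclideanGeometry.angle_comm (rim m r₀ r₁ 1) (rim m r₀ r₁ 0) (apex h)]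

end AngleDefect


/-! ### Reduction to a function of the angle sum, and its continuity. -/

namespace AngleDefect
open Set Filter Topology
open scoped EuclideanGeometry

variable {m : ℕ} {r₀ r₁ h h' : ℝ}

/-- Scaling the third coordinate. -/
noncomputable def zScale (t : ℝ) (v : E 3) : E 3 := !₂[v 0, v 1, t * v 2]

lemma zScale_apex (t z : ℝ) : zScale t (apex z) = apex (t * z) := by
  ext i; fin_cases i <;> simp [zScale, apex]

lemma zScale_planeIncl (t : ℝ) (v : E 2) : zScale t (planeIncl v) = planeIncl v := by
  ext i; fin_cases i <;> simp [zScale, planeIncl]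

lemma zScale_rim (t : ℝ) (j : ℕ) : zScale t (rim m r₀ r₁ j) = rim m r₀ r₁ j :=
  zScale_planeIncl t _

lemma zScale_injective {t : ℝ} (ht : t ≠ 0) : Function.Injective (zScale t) := by
  intro v w h
  have h0 := congrArg (· 0) h
  have h1 := congrArg (· 1) h
  have h2 := congrArg (· 2) h
  simp [zScale, ht] at h0 h1 h2
  ext i; fin_cases i <;> assumption

/-- These stretchings along the axis are the combinatorial equivalences to which the continuity of
`φ` is applied. -/
lemma isSimplicialIso_zScale (hm : 2 ≤ m) (h₀ : 0 < r₀) (h₁ : 0 < r₁) (hh : 0 < h)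
    (hh' : 0 < h') :
    IsSimplicialIso (bipyramid hm h₀ h₁ hh) (bipyramid hm h₀ h₁ hh') (zScale (h' / h)) := by
  classical
  have ht : h' / h ≠ 0 := by positivity
  have hth : h' / h * h = h' := by field_simp
  have htn : h' / h * -h = -h' := by field_simp
  have hinj := zScale_injective ht
  refine ⟨⟨fun v hv => ?_, hinj.injOn, fun v hv => ?_⟩, fun s hs => ?_⟩
  · rw [bipyramid_mem_vertices] at hv ⊢
    rcases hv with rfl | rfl | ⟨j, hj, rfl⟩
    · left; rw [zScale_apex, hth]
    · right; left; rw [zScale_apex, htn]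
    · exact Or.inr (Or.inr ⟨j, hj, zScale_rim _ _⟩)
  · rw [bipyramid_mem_vertices] at hv
    rcases hv with rfl | rfl | ⟨j, hj, rfl⟩
    · exact ⟨apex h, by simp [bipyramid_mem_vertices], by rw [zScale_apex, hth]⟩
    · exact ⟨apex (-h), by simp [bipyramid_mem_vertices], by rw [zScale_apex, htn]⟩
    · exact ⟨_, (bipyramid_mem_vertices hm h₀ h₁ hh).2 (Or.inr (Or.inr ⟨j, hj, rfl⟩)),
        zScale_rim _ _⟩
  · have himage : ∀ (z : ℝ) (i : ℕ),
        ({apex z, rim m r₀ r₁ i, rim m r₀ r₁ (i + 1)} : Finset (E 3)).image (zScale (h' / h)) =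
          {apex (h' / h * z), rim m r₀ r₁ i, rim m r₀ r₁ (i + 1)} := fun z i => by
      simp [Finset.image_insert, zScale_apex, zScale_rim]
    rw [bipyramid_faces, bipyramid_faces]
    constructor
    · rintro ⟨hs0, i, z, hz, hsub⟩
      refine ⟨by convert hs0.image (zScale (h' / h)), i, h' / h * z, ?_, ?_⟩
      · rcases hz with rfl | rfl
        exacts [Or.inl hth, Or.inr htn]
      · rw [← himage]
        convert Finset.image_subset_image hsub
    · rintro ⟨hs0, i, z, hz, hsub⟩
      refine ⟨Finset.image_nonempty.1 hs0, i, h / h' * z, ?_, ?_⟩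
      · rcases hz with rfl | rfl
        · left; field_simp
        · right; field_simp
      · rw [← Finset.image_subset_image_iff hinj, himage,
          show h' / h * (h / h' * z) = z by field_simp]
        convert hsub

/-- The height of the square bipyramid with a given angle sum at the apices. -/
noncomputable def squareHeight (θ : ℝ) : ℝ :=
  √(Real.cos (Real.pi * θ / 2) / (1 - Real.cos (Real.pi * θ / 2)))

lemma cos_mem_Ioo {θ : ℝ} (h : θ ∈ Ioo (0 : ℝ) 1) :
    Real.cos (Real.pi * θ / 2) ∈ Ioo (0 : ℝ) 1 := by
  have := Real.pi_pos
  constructor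
  · apply Real.cos_pos_of_mem_Ioo
    constructor <;> nlinarith [h.1, h.2]
  · rw [← Real.cos_zero]
    apply Real.cos_lt_cos_of_nonneg_of_le_pi le_rfl <;> nlinarith [h.1, h.2]

lemma squareHeight_pos {θ : ℝ} (h : θ ∈ Ioo (0 : ℝ) 1) : 0 < squareHeight θ := by
  have := cos_mem_Ioo h
  exact Real.sqrt_pos.2 (div_pos this.1 (sub_pos.2 this.2))

lemma continuousOn_squareHeight : ContinuousOn squareHeight (Ioo 0 1) := by
  unfold squareHeight
  refine ContinuousOn.sqrt (ContinuousOn.div (by fun_prop) (by fun_prop) fun θ h => ?_)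
  exact (sub_pos.2 (cos_mem_Ioo h).2).ne'

/-- Over the unit square `cos (π / m) = 0`, so the apex angle has cosine `h ^ 2 / (1 + h ^ 2)`;
`squareHeight` solves for the height. -/
lemma apexAngle_squareHeight {θ : ℝ} (h : θ ∈ Ioo (0 : ℝ) 1) :
    apexAngle 2 1 1 (squareHeight θ) = Real.pi * θ / 2 := by
  have hc := cos_mem_Ioo h
  have h1 := sub_pos.2 hc.2
  have hpi := Real.pi_pos
  have hsq : squareHeight θ ^ 2
      = Real.cos (Real.pi * θ / 2) / (1 - Real.cos (Real.pi * θ / 2)) :=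
    Real.sq_sqrt (div_pos hc.1 h1).le
  have hpos : 0 < squareHeight θ ^ 2 := by have := squareHeight_pos h; positivity
  rw [apexAngle, Real.mul_self_sqrt (by positivity)]
  push_cast
  rw [Real.cos_pi_div_two, hsq]
  have : (1 * 1 * 0 + Real.cos (Real.pi * θ / 2) / (1 - Real.cos (Real.pi * θ / 2))) /
      (1 ^ 2 + Real.cos (Real.pi * θ / 2) / (1 - Real.cos (Real.pi * θ / 2)))
        = Real.cos (Real.pi * θ / 2) := by
    field_simp
    ring
  rw [this, Real.arccos_cos] <;> nlinarith [h.1, h.2]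

lemma cos_pi_div_two_nat : Real.cos (Real.pi / (2 : ℕ)) = 0 := by
  push_cast; exact Real.cos_pi_div_two

/-- The values at the vertices are a function of the angle sum; this function satisfies the
equations given by bipyramids, and is continuous on `(0, 1)`. -/
theorem exists_function_of_angleSum {𝒮 : CplxSet} {Λ : CplxFun} {φ : VertexFun} {c : ℝ}
    (hsurf : ∀ (d : ℕ), ∀ K ∈ 𝒮 d, IsSimplicialSurface K) (hsub : SubdivisionClosed 𝒮)
    (hbip : ∀ P : Cplx 3, IsBipyramid P → P ∈ 𝒮 3)
    (hΛ : GeometricallyLocallyDetermined 𝒮 Λ φ)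
    (hconst : ∀ P : Cplx 3, IsBipyramid P → Λ P = c) :
    ∃ f : ℝ → ℝ, (∀ (d : ℕ), ∀ K ∈ 𝒮 d, ∀ v ∈ K.vertices, φ K v = f (angleSum K v)) ∧
      (∀ (m : ℕ) (r₀ r₁ h : ℝ), 2 ≤ m → 0 < r₀ → 0 < r₁ → 0 < h →
        Real.cos (Real.pi / m) * r₀ ≠ r₁ → Real.cos (Real.pi / m) * r₁ ≠ r₀ →
        2 * f (2 * m * (apexAngle m r₀ r₁ h / (2 * Real.pi)))
          + m * f (4 * (rimAngle m r₀ r₁ h / (2 * Real.pi)))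
          + m * f (4 * (rimAngle m r₁ r₀ h / (2 * Real.pi))) = c) ∧
      ContinuousOn f (Ioo 0 1) := by
  classical
  obtain ⟨f, hf⟩ : ∃ f : ℝ → ℝ,
      ∀ (d : ℕ), ∀ K ∈ 𝒮 d, ∀ v ∈ K.vertices, φ K v = f (angleSum K v) := by
    -- Any value that occurs at the angle sum `θ` is chosen, and `0` if none occurs;
    -- `eq_of_angleSum_eq` makes the choice irrelevant.
    refine ⟨fun θ => if H : ∃ a : ℝ, ∃ (d : ℕ) (K : Cplx d) (v : E d), K ∈ 𝒮 d ∧ v ∈ K.vertices ∧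
      angleSum K v = θ ∧ φ K v = a then H.choose else 0, fun d K hK v hv => ?_⟩
    have H : ∃ a : ℝ, ∃ (d' : ℕ) (K' : Cplx d') (v' : E d'), K' ∈ 𝒮 d' ∧ v' ∈ K'.vertices ∧
      angleSum K' v' = angleSum K v ∧ φ K' v' = a := ⟨_, d, K, v, hK, hv, rfl, rfl⟩
    dsimp only
    rw [dif_pos H]
    obtain ⟨d', K', v', hK', hv', hs, he⟩ := H.choose_spec
    rw [← he]
    exact eq_of_angleSum_eq hsurf hsub hΛ.star_isometry hΛ.subdivision hK hK' hv hv' hs.symm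
  refine ⟨f, hf, fun m r₀ r₁ h hm h₀ h₁ hh hc₀ hc₁ => ?_, ?_⟩
  · have hB := isBipyramid_bipyramid hm h₀ h₁ hh hc₀ hc₁
    have hS := hbip _ hB
    have hgb := hΛ.gauss_bonnet _ hS
    have hsum : ∑ v ∈ (bipyramid hm h₀ h₁ hh).verts, φ (bipyramid hm h₀ h₁ hh) v
        = ∑ v ∈ (bipyramid hm h₀ h₁ hh).verts, f (angleSum (bipyramid hm h₀ h₁ hh) v) :=
      Finset.sum_congr rfl fun v hv => hf 3 _ hS v
        ((bipyramid hm h₀ h₁ hh).finite_vertices.mem_toFinset.1 hv)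
    rw [hconst _ hB, hsum, sum_verts_bipyramid, angleSum_bipyramid_apex hm h₀ h₁ hh (Or.inl rfl),
      angleSum_bipyramid_apex hm h₀ h₁ hh (Or.inr rfl)] at hgb
    rw [← hgb, ← two_mul, add_assoc]
    congr 1
    rw [add_comm, ← sum_range_alternating]
    refine Finset.sum_congr rfl fun j hj => ?_
    rw [angleSum_bipyramid_rim hm h₀ h₁ hh (Finset.mem_range.1 hj)]
    by_cases hj : Even j <;> simp [ringRadius, hj, Nat.even_add_one]
  -- Each `θ` in `(0, 1)` is the apex sum of a square bipyramid whose height depends continuously on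
  -- `θ`, so `f` inherits continuity from `φ`.
  · have hmem : ∀ {h : ℝ} (hh : 0 < h), bipyramid le_rfl one_pos one_pos hh ∈ 𝒮 3 := fun hh =>
      hbip _ (isBipyramid_bipyramid le_rfl one_pos one_pos hh
        (by rw [cos_pi_div_two_nat]; norm_num) (by rw [cos_pi_div_two_nat]; norm_num))
    have hval : ∀ {θ : ℝ} (hθ : θ ∈ Ioo (0 : ℝ) 1),
        φ (bipyramid le_rfl one_pos one_pos (squareHeight_pos hθ)) (apex (squareHeight θ))
          = f θ := fun {θ} hθ => by
      rw [hf 3 _ (hmem _) _ (by simp [bipyramid_mem_vertices]),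
        angleSum_bipyramid_apex le_rfl one_pos one_pos _ (Or.inl rfl), apexAngle_squareHeight hθ]
      congr 1
      have := Real.pi_pos.ne'
      push_cast
      field_simp
    rw [continuousOn_iff_continuous_domRestrict, continuous_iff_seqContinuous]
    intro u θ hu
    have hu' : Tendsto (fun n => (u n : ℝ)) atTop (𝓝[Ioo 0 1] (θ : ℝ)) :=
      tendsto_nhdsWithin_iff.2 ⟨(continuous_subtype_val.tendsto θ).comp hu,
        Eventually.of_forall fun n => (u n).2⟩
    have hh := (continuousOn_squareHeight θ θ.2).tendsto.comp hu'
    have hpos := squareHeight_pos θ.2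
    have hratio : Tendsto (fun n => squareHeight (u n) / squareHeight θ) atTop (𝓝 1) := by
      have := hh.div_const (squareHeight θ)
      rwa [div_self hpos.ne'] at this
    have key := hΛ.continuous _ (hmem hpos)
      (fun n => bipyramid le_rfl one_pos one_pos (squareHeight_pos (u n).2))
      (fun n => zScale (squareHeight (u n) / squareHeight θ)) (fun n => hmem _)
      (fun n => isSimplicialIso_zScale _ _ _ _ _) (fun v _ => ?_) (apex (squareHeight θ))
      (by simp [bipyramid_mem_vertices])
    · rw [hval θ.2] at key
      refine key.congr fun n => ?_
      rw [zScale_apex, div_mul_cancel₀ _ hpos.ne', hval (u n).2]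
      rfl
    · have hv : v = zScale 1 v := by ext i; fin_cases i <;> simp [zScale]
      have hcont : Continuous fun t => zScale t v := by
        unfold zScale
        refine (PiLp.continuous_toLp 2 _).comp (continuous_pi fun i => ?_)
        fin_cases i <;> simp <;> fun_prop
      conv => rhs; rw [hv]
      exact (hcont.tendsto 1).comp hratio

end AngleDefect


/-! ### The functional equation on `(0, 1)`. -/

namespace AngleDefect
open Set Filter Topology

/-- A continuous function on `(0, 1)` whose values at `A`, `B`, `C` add up to zero whenever
`A + B + C = 2` is a multiple of `t - 2/3`. -/
theorem exists_eq_mul_sub_of_sum_eq_zero {g : ℝ → ℝ} (hcont : ContinuousOn g (Ioo 0 1))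
    (hg : ∀ A ∈ Ioo (0 : ℝ) 1, ∀ B ∈ Ioo (0 : ℝ) 1, ∀ C ∈ Ioo (0 : ℝ) 1, A + B + C = 2 →
      g A + g B + g C = 0) :
    ∃ l : ℝ, ∀ t ∈ Ioo (0 : ℝ) 1, g t = l * (t - 2 / 3) := by
  -- Centred at `2 / 3`, the equation concerns triples with sum zero; it makes `G` odd and additive
  -- near `0`.
  set G : ℝ → ℝ := fun a => g (2 / 3 + a) with hG
  have hsum : ∀ a b c : ℝ, a ∈ Ioo (-2 / 3 : ℝ) (1 / 3) → b ∈ Ioo (-2 / 3 : ℝ) (1 / 3) →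
      c ∈ Ioo (-2 / 3 : ℝ) (1 / 3) → a + b + c = 0 → G a + G b + G c = 0 := by
    rintro a b c ⟨ha, ha'⟩ ⟨hb, hb'⟩ ⟨hc, hc'⟩ h
    exact hg _ ⟨by linarith, by linarith⟩ _ ⟨by linarith, by linarith⟩ _
      ⟨by linarith, by linarith⟩ (by linarith)
  have hzero : G 0 = 0 := by
    have := hsum 0 0 0 (by norm_num) (by norm_num) (by norm_num) (by norm_num)
    linarith
  have hneg : ∀ a ∈ Ioo (-1 / 3 : ℝ) (1 / 3), G (-a) = -G a := by
    rintro a ⟨ha, ha'⟩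
    have := hsum a (-a) 0 ⟨by linarith, by linarith⟩ ⟨by linarith, by linarith⟩
      (by norm_num) (by ring)
    linarith
  have hadd : ∀ a ∈ Ioo (-1 / 3 : ℝ) (1 / 3), ∀ b ∈ Ioo (-1 / 3 : ℝ) (1 / 3),
      a + b ∈ Ioo (-1 / 3 : ℝ) (1 / 3) → G (a + b) = G a + G b := by
    rintro a ⟨ha, ha'⟩ b ⟨hb, hb'⟩ hab
    have h1 := hneg _ hab
    have := hsum a b (-(a + b)) ⟨by linarith, by linarith⟩ ⟨by linarith, by linarith⟩
      ⟨by linarith [hab.2], by linarith [hab.1]⟩ (by ring)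
    linarith
  -- With this slope, `G a - l * a` vanishes at `1 / 4`, so by additivity it is unchanged by shifts
  -- by `1 / 4` within the interval.
  set l := 4 * G (1 / 4) with hl
  have hlin : ∀ a ∈ Icc (-1 / 4 : ℝ) (1 / 4), G a = l * a := by
    have hLcont : ContinuousOn (fun a => |G a - l * a|) (Icc (-1 / 4 : ℝ) (1 / 4)) := by
      refine ContinuousOn.abs (ContinuousOn.sub ?_ (by fun_prop))
      refine hcont.comp (by fun_prop) fun a ha => ?_
      constructor <;> linarith [ha.1, ha.2]
    obtain ⟨p, hp, hmax⟩ := isCompact_Icc.exists_isMaxOn (by norm_num) hLcont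
    have hmax : ∀ a ∈ Icc (-1 / 4 : ℝ) (1 / 4), |G a - l * a| ≤ |G p - l * p| := hmax
    -- The point of maximal deviation is shifted into `[-1/8, 1/8]`. Doubling it stays in the
    -- interval and doubles the deviation, which is therefore zero.
    obtain ⟨q, hq, hqp⟩ : ∃ q ∈ Icc (-1 / 8 : ℝ) (1 / 8), G q - l * q = G p - l * p := by
      rcases lt_or_ge (1 / 8) p with h8 | h8
      · refine ⟨p - 1 / 4, ⟨by linarith, by linarith [hp.2]⟩, ?_⟩
        have := hadd (p - 1 / 4) ⟨by linarith, by linarith [hp.2]⟩ (1 / 4) (by norm_num)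
          ⟨by linarith, by linarith [hp.2]⟩
        rw [sub_add_cancel] at this
        rw [this, hl]
        ring
      · rcases lt_or_ge p (-1 / 8) with h8' | h8'
        · refine ⟨p + 1 / 4, ⟨by linarith [hp.1], by linarith⟩, ?_⟩
          have := hadd p ⟨by linarith [hp.1], by linarith⟩ (1 / 4) (by norm_num)
            ⟨by linarith [hp.1], by linarith⟩
          rw [this, hl]
          ring
        · exact ⟨p, ⟨h8', h8⟩, rfl⟩
    have h2 := hadd q ⟨by linarith [hq.1], by linarith [hq.2]⟩ q
      ⟨by linarith [hq.1], by linarith [hq.2]⟩ ⟨by linarith [hq.1], by linarith [hq.2]⟩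
    have h3 := hmax (q + q) ⟨by linarith [hq.1], by linarith [hq.2]⟩
    rw [h2, show G q + G q - l * (q + q) = 2 * (G p - l * p) by linarith, abs_mul, abs_two] at h3
    have h4 : |G p - l * p| = 0 := le_antisymm (by linarith) (abs_nonneg _)
    intro a ha
    have := abs_nonpos_iff.1 ((hmax a ha).trans h4.le)
    linarith
  have hlin' : ∀ a ∈ Ioo (-1 / 3 : ℝ) (1 / 3), G a = l * a := by
    intro a ha
    have h1 := hadd (a / 2) ⟨by linarith [ha.1], by linarith [ha.2]⟩ (a / 2)
      ⟨by linarith [ha.1], by linarith [ha.2]⟩ ⟨by linarith [ha.1], by linarith [ha.2]⟩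
    rw [hlin (a / 2) ⟨by linarith [ha.1], by linarith [ha.2]⟩, add_halves] at h1
    linarith
  refine ⟨l, fun t ht => ?_⟩
  have hGt : g t = G (t - 2 / 3) := by rw [hG]; simp
  rw [hGt]
  rcases lt_or_ge (-1 / 3) (t - 2 / 3) with h | h
  · exact hlin' _ ⟨h, by linarith [ht.2]⟩
  -- To the left of the symmetric interval, the triple `a`, `-a / 2`, `-a / 2` determines the value.
  · have hm : -(t - 2 / 3) / 2 ∈ Ioo (-1 / 3 : ℝ) (1 / 3) := ⟨by linarith, by linarith [ht.1]⟩
    have := hsum (t - 2 / 3) (-(t - 2 / 3) / 2) (-(t - 2 / 3) / 2)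
      ⟨by linarith [ht.1], by linarith [ht.2]⟩ ⟨by linarith, by linarith [ht.1]⟩
      ⟨by linarith, by linarith [ht.1]⟩ (by ring)
    rw [hlin' _ hm] at this
    linarith

section Angles

variable {m : ℕ} {r s h : ℝ}

lemma cos_pi_div_nonneg (hm : 2 ≤ m) : 0 ≤ Real.cos (Real.pi / m) := by
  have hm' : (2 : ℝ) ≤ m := by exact_mod_cast hm
  have := Real.pi_pos
  apply Real.cos_nonneg_of_neg_pi_div_two_le_of_le
  · have : 0 ≤ Real.pi / m := by positivity
    linarith
  · gcongr

lemma cos_pi_div_lt_one (hm : 2 ≤ m) : Real.cos (Real.pi / m) < 1 := by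
  have hm' : (2 : ℝ) ≤ m := by exact_mod_cast hm
  have hpi := Real.pi_pos
  have h0 : 0 < Real.pi / m := by positivity
  rw [← Real.cos_zero]
  apply Real.cos_lt_cos_of_nonneg_of_le_pi le_rfl _ h0
  exact div_le_self hpi.le (by linarith)

lemma apexAngle_pos (hm : 2 ≤ m) (hr : 0 < r) (hs : 0 < s) : 0 < apexAngle m r s h := by
  have hk := cos_pi_div_lt_one hm
  have hk0 := cos_pi_div_nonneg hm
  rw [apexAngle, Real.arccos_pos, div_lt_one (by positivity), ← Real.sqrt_mul (by positivity)]
  apply Real.lt_sqrt_of_sq_lt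
  have hrs : 0 < r * s := mul_pos hr hs
  have h1 : r * s * Real.cos (Real.pi / m) < r * s := mul_lt_of_lt_one_right hrs hk
  have h2 : (r * s * Real.cos (Real.pi / m) + h ^ 2) ^ 2 < (r * s + h ^ 2) ^ 2 := by
    have : 0 ≤ r * s * Real.cos (Real.pi / m) := by positivity
    gcongr
  nlinarith [sq_nonneg (h * (r - s))]

lemma edge_sq_pos (hm : 2 ≤ m) (hs : 0 < s) :
    0 < r ^ 2 + s ^ 2 - 2 * r * s * Real.cos (Real.pi / m) := by
  have hk := cos_pi_div_lt_one hm
  have hk0 := cos_pi_div_nonneg hm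
  have : 0 < s ^ 2 * (1 - Real.cos (Real.pi / m) ^ 2) := by
    apply mul_pos (by positivity)
    nlinarith
  nlinarith [sq_nonneg (r - s * Real.cos (Real.pi / m))]

/-- The projection of a rim edge to the radial direction at its end is no longer than the edge. -/
lemma sq_sub_le_edge_sq : (r - s * Real.cos (Real.pi / m)) ^ 2 ≤
    r ^ 2 + s ^ 2 - 2 * r * s * Real.cos (Real.pi / m) := by
  nlinarith [mul_nonneg (sq_nonneg s) (sub_nonneg.2 (Real.cos_sq_le_one (Real.pi / m)))]

lemma rimAngle_pos (hm : 2 ≤ m) (hs : 0 < s) (hh : 0 < h) :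
    0 < rimAngle m r s h := by
  have hD := edge_sq_pos (r := r) hm hs
  rw [rimAngle, Real.arccos_pos, div_lt_one (by positivity), ← Real.sqrt_mul (by positivity)]
  apply Real.lt_sqrt_of_sq_lt
  have h1 := sq_sub_le_edge_sq (m := m) (r := r) (s := s)
  calc (r ^ 2 - r * s * Real.cos (Real.pi / m)) ^ 2
      = r ^ 2 * (r - s * Real.cos (Real.pi / m)) ^ 2 := by ring
    _ ≤ r ^ 2 * (r ^ 2 + s ^ 2 - 2 * r * s * Real.cos (Real.pi / m)) := by gcongr
    _ < _ := by
      have : 0 < h ^ 2 := by positivity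
      gcongr
      linarith

/-- For `s ≤ r` the numerator `r * (r - s * cos (π / m))` of the cosine is positive. -/
lemma rimAngle_lt_pi_div_two (hm : 2 ≤ m) (hr : 0 < r) (hs : 0 < s)
    (hh : 0 < h) (hsr : s ≤ r) : rimAngle m r s h < Real.pi / 2 := by
  have hk := cos_pi_div_lt_one hm
  have hD := edge_sq_pos (r := r) hm hs
  rw [rimAngle, Real.arccos_lt_pi_div_two]
  refine div_pos ?_ (by positivity)
  nlinarith [mul_pos hr hs]

end Angles

/-- The relations for octahedra with perpendicular diagonals. -/
lemma octahedron_relation {g : ℝ → ℝ}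
    (hB : ∀ (m : ℕ) (r₀ r₁ h : ℝ), 2 ≤ m → 0 < r₀ → 0 < r₁ → 0 < h →
      Real.cos (Real.pi / m) * r₀ ≠ r₁ → Real.cos (Real.pi / m) * r₁ ≠ r₀ →
      2 * g (2 * m * (apexAngle m r₀ r₁ h / (2 * Real.pi)))
        + m * g (4 * (rimAngle m r₀ r₁ h / (2 * Real.pi)))
        + m * g (4 * (rimAngle m r₁ r₀ h / (2 * Real.pi))) = 0)
    {A B C : ℝ} (hA : A ∈ Ioo (0 : ℝ) 1) (hB' : B ∈ Ioo (0 : ℝ) 1) (hC : C ∈ Ioo (0 : ℝ) 1)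
    (hABC : A + B + C = 2) : g A + g B + g C = 0 := by
  have hpi := Real.pi_pos
  have hcos : ∀ {t : ℝ}, t ∈ Ioo (0 : ℝ) 1 → 0 < Real.cos (Real.pi * t / 2) := fun ht =>
    (cos_mem_Ioo ht).1
  have hsin : ∀ {t : ℝ}, t ∈ Ioo (0 : ℝ) 1 → 0 < Real.sin (Real.pi * t / 2) := fun ht => by
    apply Real.sin_pos_of_pos_of_lt_pi <;> nlinarith [ht.1, ht.2]
  have harc : ∀ {t : ℝ}, t ∈ Ioo (0 : ℝ) 1 →
      Real.arccos (Real.cos (Real.pi * t / 2)) = Real.pi * t / 2 := fun ht => by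
    apply Real.arccos_cos <;> nlinarith [ht.1, ht.2]
  have cA := hcos hA
  have cB := hcos hB'
  have cC := hcos hC
  have sA := hsin hA
  have sB := hsin hB'
  have sC := hsin hC
  have aA := harc hA
  have aB := harc hB'
  have aC := harc hC
  -- The half-turn multiples of `A`, `B`, `C`, halved, are the angles of an acute triangle; the
  -- three addition formulas express this.
  have eC : Real.sin (Real.pi * C / 2) = Real.sin (Real.pi * A / 2) * Real.cos (Real.pi * B / 2)
      + Real.cos (Real.pi * A / 2) * Real.sin (Real.pi * B / 2) := by
    rw [← Real.sin_add, ← Real.sin_pi_sub]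
    congr 1
    linear_combination (-Real.pi / 2) * hABC
  have eB : Real.sin (Real.pi * B / 2) = Real.sin (Real.pi * A / 2) * Real.cos (Real.pi * C / 2)
      + Real.cos (Real.pi * A / 2) * Real.sin (Real.pi * C / 2) := by
    rw [← Real.sin_add, ← Real.sin_pi_sub]
    congr 1
    linear_combination (-Real.pi / 2) * hABC
  have eA : Real.sin (Real.pi * A / 2) = Real.sin (Real.pi * B / 2) * Real.cos (Real.pi * C / 2)
      + Real.cos (Real.pi * B / 2) * Real.sin (Real.pi * C / 2) := by
    rw [← Real.sin_add, ← Real.sin_pi_sub]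
    congr 1
    linear_combination (-Real.pi / 2) * hABC
  generalize Real.cos (Real.pi * A / 2) = ca at *
  generalize Real.cos (Real.pi * B / 2) = cb at *
  generalize Real.cos (Real.pi * C / 2) = cc at *
  generalize Real.sin (Real.pi * A / 2) = sa at *
  generalize Real.sin (Real.pi * B / 2) = sb at *
  generalize Real.sin (Real.pi * C / 2) = sc at *
  -- By the sine rule the faces may be given the sides `sa`, `sb`, `sc`. For perpendicular semi-axes
  -- the squares must be `(sb² + sc² - sa²) / 2 = ca * sb * sc` and its analogues, which are
  -- positive because the triangle is acute.
  have hh : 0 < √(ca * sb * sc) := by positivity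
  have h0 : 0 < √(cb * sa * sc) := by positivity
  have h1 : 0 < √(cc * sa * sb) := by positivity
  have key := hB 2 _ _ _ le_rfl h0 h1 hh (by rw [cos_pi_div_two_nat, zero_mul]; exact h1.ne)
    (by rw [cos_pi_div_two_nat, zero_mul]; exact h0.ne)
  rw [apexAngle, rimAngle, rimAngle, cos_pi_div_two_nat] at key
  simp only [mul_zero, zero_add, sub_zero, Real.sq_sqrt (show 0 ≤ ca * sb * sc by positivity),
    Real.sq_sqrt (show 0 ≤ cb * sa * sc by positivity),
    Real.sq_sqrt (show 0 ≤ cc * sa * sb by positivity)] at key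
  have q1 : √(cb * sa * sc + ca * sb * sc) = sc := by
    rw [show cb * sa * sc + ca * sb * sc = sc ^ 2 by rw [sq]; nth_rw 3 [eC]; ring,
      Real.sqrt_sq sC.le]
  have q2 : √(cc * sa * sb + ca * sb * sc) = sb := by
    rw [show cc * sa * sb + ca * sb * sc = sb ^ 2 by linear_combination (-sb) * eB,
      Real.sqrt_sq sB.le]
  have q3 : √(cb * sa * sc + cc * sa * sb) = sa := by
    rw [show cb * sa * sc + cc * sa * sb = sa ^ 2 by linear_combination (-sa) * eA,
      Real.sqrt_sq sA.le]
  rw [add_comm (cc * sa * sb) (cb * sa * sc), q1, q2, q3,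
    show ca * sb * sc / (sc * sb) = ca by field_simp,
    show cb * sa * sc / (sc * sa) = cb by field_simp,
    show cc * sa * sb / (sb * sa) = cc by field_simp, aA, aB, aC] at key
  push_cast at key
  rw [show 2 * 2 * (Real.pi * A / 2 / (2 * Real.pi)) = A by field_simp,
    show 4 * (Real.pi * B / 2 / (2 * Real.pi)) = B by field_simp; ring,
    show 4 * (Real.pi * C / 2 / (2 * Real.pi)) = C by field_simp; ring] at key
  linarith

end AngleDefect


/-! ### The homogeneous bipyramid relations have only the zero solution. -/

namespace AngleDefect
open Set Filter Topology

/-- The only solution of the bipyramid equations that is continuous on `(0, 1)` vanishes. -/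
theorem eq_zero_of_bipyramid_relations {g : ℝ → ℝ} (hcont : ContinuousOn g (Ioo 0 1))
    (hB : ∀ (m : ℕ) (r₀ r₁ h : ℝ), 2 ≤ m → 0 < r₀ → 0 < r₁ → 0 < h →
      Real.cos (Real.pi / m) * r₀ ≠ r₁ → Real.cos (Real.pi / m) * r₁ ≠ r₀ →
      2 * g (2 * m * (apexAngle m r₀ r₁ h / (2 * Real.pi)))
        + m * g (4 * (rimAngle m r₀ r₁ h / (2 * Real.pi)))
        + m * g (4 * (rimAngle m r₁ r₀ h / (2 * Real.pi))) = 0)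
    {θ : ℝ} (hθ : 0 < θ) : g θ = 0 := by
  have hpi := Real.pi_pos
  have hcos3 : Real.cos (Real.pi / (3 : ℕ)) = 1 / 2 := by
    push_cast; exact Real.cos_pi_div_three
  have hm3 : 2 ≤ 3 := by norm_num
  have hrim : ∀ {x : ℝ}, 0 < x → x < Real.pi / 2 → 4 * (x / (2 * Real.pi)) ∈ Ioo (0 : ℝ) 1 := by
    intro x h0 h1
    refine ⟨by positivity, ?_⟩
    rw [mul_div_assoc', div_lt_one (by positivity)]
    linarith
  have hthird : ∀ {x : ℝ}, 0 < x → x < Real.pi / 3 →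
      2 * ((3 : ℕ) : ℝ) * (x / (2 * Real.pi)) ∈ Ioo (0 : ℝ) 1 := by
    intro x h0 h1
    refine ⟨by positivity, ?_⟩
    rw [mul_div_assoc', div_lt_one (by positivity)]
    push_cast
    linarith
  -- vanishing on `(0, 1)`
  have hzero : ∀ t ∈ Ioo (0 : ℝ) 1, g t = 0 := by
    obtain ⟨l, hl⟩ := exists_eq_mul_sub_of_sum_eq_zero hcont
      fun A hA B hB' C hC h => octahedron_relation hB hA hB' hC h
    -- In this hexagonal bipyramid, an apex sum `A` goes with rim sums `1 - A / 3`, and all lie in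
    -- `(0, 1)`; the relation reduces to `2 / 3 * l = 0`.
    have hsum := apexAngle_add_rimAngle (m := 3) (r₀ := 1) (r₁ := 1) (h := 1) one_pos
    have ha0 := apexAngle_pos (m := 3) (h := 1) hm3 one_pos one_pos
    have hb0 := rimAngle_pos (m := 3) (r := 1) hm3 one_pos one_pos
    have hb1 := rimAngle_lt_pi_div_two hm3 one_pos one_pos one_pos le_rfl
    have ha1 : apexAngle 3 1 1 1 < Real.pi / 3 := by
      rw [← Real.arccos_cos (x := Real.pi / 3) (by linarith) (by linarith), apexAngle, hcos3,
        Real.cos_pi_div_three, Real.mul_self_sqrt (by norm_num)]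
      apply Real.arccos_lt_arccos <;> norm_num
    have key := hB 3 1 1 1 hm3 one_pos one_pos one_pos (by rw [hcos3]; norm_num)
      (by rw [hcos3]; norm_num)
    rw [hl _ (hthird ha0 ha1), hl _ (hrim hb0 hb1)] at key
    have hb : rimAngle 3 1 1 1 = (Real.pi - apexAngle 3 1 1 1) / 2 := by linarith
    rw [hb] at key
    push_cast at key
    field_simp at key
    have hl0 : l = 0 := by nlinarith
    intro t ht
    rw [hl t ht, hl0, zero_mul]
  -- vanishing slightly above `1`
  set τ := rimAngle 3 1 4 1 with hτ
  have hright : ∀ t : ℝ, 1 < t → t ≤ 4 * (τ / (2 * Real.pi)) → g t = 0 := by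
    intro t h1 ht
    -- For `ρ` between `2` and `4`, the sums at the inner rim vertices cover everything from `1` to
    -- the bound. The apex and outer rim sums stay below `1`, where `g` vanishes.
    have hcontρ : ContinuousOn (fun ρ => 4 * (rimAngle 3 1 ρ 1 / (2 * Real.pi))) (Icc 2 4) := by
      unfold rimAngle
      rw [hcos3]
      refine ContinuousOn.mul continuousOn_const (ContinuousOn.div_const ?_ _)
      refine Real.continuous_arccos.comp_continuousOn (ContinuousOn.div (by fun_prop)
        (by fun_prop) fun ρ hρ => ?_)
      have : 0 < (1 : ℝ) ^ 2 + ρ ^ 2 - 2 * 1 * ρ * (1 / 2) := by nlinarith [hρ.1]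
      positivity
    -- At `ρ = 2` an inner vertex lies on the chord of its neighbours and the rim angle is right.
    -- This is the excluded degenerate polygon, so `t = 1` is not reached.
    have h2 : 4 * (rimAngle 3 1 2 1 / (2 * Real.pi)) = 1 := by
      rw [rimAngle, hcos3]
      norm_num
      field_simp
      norm_num
    obtain ⟨ρ, ⟨hρ2, hρ4⟩, hρ⟩ := intermediate_value_Icc (by norm_num) hcontρ
      ⟨by simp only [h2]; exact h1.le, ht⟩
    dsimp only at hρ
    have hne : ρ ≠ 2 := by
      rintro rfl
      linarith
    have hρ0 : 0 < ρ := by linarith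
    have key := hB 3 1 ρ 1 hm3 one_pos hρ0 one_pos (by rw [hcos3]; intro h; linarith)
      (by rw [hcos3]; intro h; apply hne; linarith)
    have ha1 : apexAngle 3 1 ρ 1 < Real.pi / 3 := by
      rw [← Real.arccos_cos (x := Real.pi / 3) (by linarith) (by linarith), apexAngle, hcos3,
        Real.cos_pi_div_three, ← Real.sqrt_mul (by norm_num)]
      have hpos : 0 < √((1 ^ 2 + 1 ^ 2) * (ρ ^ 2 + 1 ^ 2)) := by positivity
      apply Real.arccos_lt_arccos (by norm_num)
      · rw [lt_div_iff₀ hpos, mul_comm, ← lt_div_iff₀ (by norm_num), Real.sqrt_lt' (by positivity)]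
        nlinarith
      · rw [div_le_one hpos]
        apply Real.le_sqrt_of_sq_le
        nlinarith
    rw [hρ, hzero _ (hthird (apexAngle_pos hm3 one_pos hρ0) ha1),
      hzero _ (hrim (rimAngle_pos hm3 one_pos one_pos)
        (rimAngle_lt_pi_div_two hm3 hρ0 one_pos one_pos (by linarith)))] at key
    push_cast at key
    linarith
  rcases lt_or_ge θ 1 with hθ1 | hθ1
  · exact hzero θ ⟨hθ, hθ1⟩
  -- the general case
  obtain ⟨m, hmθ⟩ := exists_nat_ge (4 * θ)
  have hm4 : (4 : ℝ) ≤ m := by linarith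
  have hm : 2 ≤ m := by
    have : (2 : ℝ) ≤ m := by linarith
    exact_mod_cast this
  have hm0 : (0 : ℝ) < m := by linarith
  set k := Real.cos (Real.pi / m) with hk
  have hk0 : 0 ≤ k := cos_pi_div_nonneg hm
  have hk1 : k < 1 := cos_pi_div_lt_one hm
  -- The apex angle of each of the `2 * m` triangles. The bound `θ ≥ 1` gives `α ≥ π / m`, and `4 *
  -- θ ≤ m` gives `α ≤ π / 4`.
  set α := Real.pi * θ / m with hα
  have hα0 : Real.pi / m ≤ α := by
    rw [hα, mul_div_right_comm]
    exact le_mul_of_one_le_right (by positivity) hθ1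
  have hα1 : α ≤ Real.pi / 4 := by
    rw [hα, div_le_div_iff₀ hm0 (by norm_num)]
    nlinarith
  have hαk : Real.cos α ≤ k :=
    Real.cos_le_cos_of_nonneg_of_le_pi (by positivity) (by linarith) hα0
  have hαs : 1 / 2 ≤ Real.cos α := by
    rw [← Real.cos_pi_div_three]
    exact Real.cos_le_cos_of_nonneg_of_le_pi (by positivity) (by linarith) (by linarith)
  have hcontR : ContinuousOn (fun R : ℝ => (1 / 6 * R * k + 1 ^ 2) /
      (√((1 / 6) ^ 2 + 1 ^ 2) * √(R ^ 2 + 1 ^ 2))) (Icc (1 / 6) 4) := by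
    refine ContinuousOn.div (by fun_prop) (by fun_prop) fun R _ => ?_
    positivity
  -- With height `1` and inner radius `1 / 6`, the cosine of the apex angle is at least `k ≥ cos α`
  -- at `R = 1 / 6` and at most `1 / 2 ≤ cos α` at `R = 4`.
  obtain ⟨R, ⟨hR1, hR4⟩, hR⟩ : Real.cos α ∈ (fun R : ℝ => (1 / 6 * R * k + 1 ^ 2) /
      (√((1 / 6) ^ 2 + 1 ^ 2) * √(R ^ 2 + 1 ^ 2))) '' (Icc (1 / 6) 4) := by
    refine intermediate_value_Icc' (by norm_num) hcontR ⟨?_, ?_⟩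
    · refine le_trans ?_ hαs
      have h4 : 4 ≤ √(((1 / 6) ^ 2 + 1 ^ 2) * ((4 : ℝ) ^ 2 + 1 ^ 2)) :=
        Real.le_sqrt_of_sq_le (by norm_num)
      rw [← Real.sqrt_mul (by norm_num), div_le_iff₀ (by positivity)]
      linarith
    · refine hαk.trans ?_
      rw [Real.mul_self_sqrt (by positivity), le_div_iff₀ (by positivity)]
      nlinarith
  dsimp only at hR
  have hR0 : 0 < R := by linarith
  have hr0 : (0 : ℝ) < 1 / 6 := by norm_num
  have hapex : apexAngle m (1 / 6) R 1 = α := by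
    rw [apexAngle, ← hk, hR, Real.arccos_cos (le_trans (by positivity) hα0) (by linarith)]
  -- A degenerate corner would make the cosine of the apex angle larger than `k`, hence `α < π / m`.
  have hne : k * R ≠ 1 / 6 := by
    intro h
    apply hαk.not_gt
    rw [← hR, ← Real.sqrt_mul (by norm_num), lt_div_iff₀ (by positivity)]
    refine lt_of_pow_lt_pow_left₀ 2 (by positivity) ?_
    rw [mul_pow, Real.sq_sqrt (by positivity), mul_assoc, mul_comm R k, h]
    have : k ^ 2 * (((1 / 6) ^ 2 + 1 ^ 2) * (R ^ 2 + 1 ^ 2)) =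
        ((1 / 6) ^ 2 + 1) * ((k * R) ^ 2 + k ^ 2) := by ring
    rw [this, h]
    nlinarith
  have key := hB m (1 / 6) R 1 hm hr0 hR0 one_pos (by rw [← hk]; intro h; nlinarith)
    (by rw [← hk]; exact hne)
  have hb1 := hzero _ (hrim (rimAngle_pos hm hr0 one_pos)
    (rimAngle_lt_pi_div_two hm hR0 hr0 one_pos hR1))
  have hD := edge_sq_pos (r := 1 / 6) hm hR0
  have hb0τ : rimAngle m (1 / 6) R 1 ≤ τ := by
    refine Real.antitone_arccos ?_
    -- The cosine of `τ` is `-1 / √26`, while at an inner vertex the cosine is at least minus the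
    -- inner radius; this is why that radius is `1 / 6`.
    trans (-1 / 6 : ℝ)
    · have h6 : √((1 ^ 2 + 1 ^ 2) * ((1 : ℝ) ^ 2 + 4 ^ 2 - 2 * 1 * 4 * (1 / 2))) ≤ 6 :=
        Real.sqrt_le_iff.2 (by norm_num)
      rw [hcos3, ← Real.sqrt_mul (by norm_num), div_le_iff₀ (by positivity)]
      linarith
    · have h1 : 1 ≤ √((1 / 6 : ℝ) ^ 2 + 1 ^ 2) := Real.le_sqrt_of_sq_le (by norm_num)
      have h2 := (abs_le.1 (Real.abs_le_sqrt (sq_sub_le_edge_sq (m := m) (r := 1 / 6) (s := R)))).1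
      rw [le_div_iff₀ (by positivity)]
      have h3 := le_mul_of_one_le_left (Real.sqrt_nonneg ((1 / 6) ^ 2 + R ^ 2
        - 2 * (1 / 6) * R * Real.cos (Real.pi / m))) h1
      linarith
  -- A right angle occurs only at a degenerate corner. So the rim sum is never `1`, the one value up
  -- to the bound not treated so far.
  have hb0ne : rimAngle m (1 / 6) R 1 ≠ Real.pi / 2 := by
    rw [rimAngle, Ne, Real.arccos_eq_pi_div_two, div_eq_zero_iff, not_or]
    refine ⟨fun h => hne ?_, by positivity⟩
    rw [hk]
    linarith
  have hb0 : g (4 * (rimAngle m (1 / 6) R 1 / (2 * Real.pi))) = 0 := by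
    rcases hb0ne.lt_or_gt with h | h
    · exact hzero _ (hrim (rimAngle_pos hm hR0 one_pos) h)
    · refine hright _ ?_ (by gcongr)
      rw [mul_div_assoc', one_lt_div (by positivity)]
      linarith
  rw [hapex, hb0, hb1, show 2 * (m : ℝ) * (α / (2 * Real.pi)) = θ by rw [hα]; field_simp] at key
  linarith

end AngleDefect

open AngleDefect in
theorem theorem2p5 (𝒮 : CplxSet) (Λ : CplxFun) (φ : VertexFun) (c : ℝ)
    (hsurf : ∀ (d : ℕ), ∀ K ∈ 𝒮 d, IsSimplicialSurface K)
    (hsub : SubdivisionClosed 𝒮)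
    (hpyr : ∀ P : Cplx 3, IsPyramid P ∨ IsBipyramid P → P ∈ 𝒮 3)
    (hΛ : GeometricallyLocallyDetermined 𝒮 Λ φ)
    (hconst : ∀ P : Cplx 3, IsPyramid P ∨ IsBipyramid P → Λ P = c) :
    ∀ (d : ℕ), ∀ K ∈ 𝒮 d, ∀ v ∈ K.vertices,
      φ K v = 1 / 2 * c * (1 - angleSum K v) := by
  obtain ⟨f, hf, hrel, hcont⟩ := exists_function_of_angleSum hsurf hsub
    (fun P hP => hpyr P (Or.inr hP)) hΛ (fun P hP => hconst P (Or.inr hP))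
  intro d K hK v hv
  rw [hf d K hK v hv]
  -- The claimed formula satisfies the bipyramid relations, because the three angles of a face add
  -- up to half a turn; the difference solves the homogeneous ones.
  have hzero := eq_zero_of_bipyramid_relations (g := fun t => f t - 1 / 2 * c * (1 - t))
    (hcont.sub (by fun_prop)) (fun m r₀ r₁ h hm h₀ h₁ hh hc₀ hc₁ => by
      have h1 := hrel m r₀ r₁ h hm h₀ h₁ hh hc₀ hc₁
      have h2 := apexAngle_add_rimAngle (m := m) (r₀ := r₀) (r₁ := r₁) hh
      have hpi := Real.pi_pos.ne'
      have h3 : apexAngle m r₀ r₁ h / (2 * Real.pi) = 1 / 2 - rimAngle m r₀ r₁ h / (2 * Real.pi)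
          - rimAngle m r₁ r₀ h / (2 * Real.pi) := by
        field_simp
        linarith
      linear_combination h1 + 2 * m * c * h3) ((hsurf d K hK).angleSum_pos hv)
  exact sub_eq_zero.1 hzero
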